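/- Let $q$ be a prime power, $k\ge 1$, $n\ge 2$, and let $B$ be a smooth projective geometrically connected curve over $\mathbb{F}_{q^k}$ with function field $K_1=\mathbb{F}_{q^k}(B)$; put $K_2=\mathbb{F}_{q^{2k}}(B)=K_1\otimes_{\mathbb{F}_{q^k}}\mathbb{F}_{q^{2k}}$. Let $X\subset\mathbb{P}^n_{K_1}$ be a smooth cubic hypersurface, and let $N\ge 0$ be an integer. A place $v$ of $K\in\{K_1,K_2\}$ (a closed point of the curve) is of good reduction for a smooth cubic hypersurface $X$ over $K$ if there is a cubic hypersurface $\widehat{\mathcal X}_v\subset\mathbb{P}^n$ over the complete local ring $\widehat{\mathcal O}_v$, with smooth closed fibre, whose generic fibre is projectively equivalent to $X$ over the completion $\widehat K_v$; such an $\widehat{\mathcal X}_v$ together with the equivalence is called a smooth model at $v$. We say that weak approximation at order $N$ holds for $X$ over $K$ at the places of good reduction whose residue fields have at least $11$ elements if one can choose smooth models $\widehat{\mathcal X}_v$ at all places $v$ of good reduction such that, for every finite sequence $b_1,\dots,b_l$ ($l\ge 0$) of distinct places of good reduction with residue fields of at least $11$ elements and all sections $\widehat s_i\in\widehat{\mathcal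 X}_{b_i}(\widehat{\mathcal O}_{b_i})$, there is a point $x\in X(K)$ whose induced section of $\widehat{\mathcal X}_{b_i}$ agrees with $\widehat s_i$ modulo $\mathfrak m_{b_i}^{N+1}$ for each $i$. If weak approximation at order $N$ holds for $X_{K_2}$ over $K_2$ at the places of good reduction whose residue fields have at least $11$ elements, then weak approximation at order $N$ holds for $X$ over $K_1$ at the places of good reduction whose residue fields have at least $11$ elements. (If $q^k\ge 11$, the condition on the residue fields is automatic, and may be omitted.) -/

import Mathlib

noncomputable section

/-- `K` is the function field of a smooth projective geometrically connected curve over the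
perfect field `k`: it is finitely generated of transcendence degree one over `k`, and `k` is
algebraically closed in `K`. -/
structure IsCurveFunctionField (k K : Type*) [Field k] [Field K] [Algebra k K] : Prop where
  fg : (⊤ : IntermediateField k K).FG
  trdeg_eq_one : Algebra.trdeg k K = 1
  integralClosure_eq_bot : integralClosure k K = ⊥

/-- A homogeneous cubic form `F` in `n + 1` variables over the field `L` defines a smooth cubic
hypersurface in `ℙⁿ` over `L`: over an algebraic closure of `L`, the form and its partial
derivatives have no common nontrivial zero. -/
structure IsSmoothCubic {L : Type*} [Field L] {n : ℕ}
    (F : MvPolynomial (Fin (n + 1)) L) : Prop where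
  homogeneous : F.IsHomogeneous 3
  nonsingular : ∀ x : Fin (n + 1) → AlgebraicClosure L, x ≠ 0 →
    ¬ (MvPolynomial.aeval x F = 0 ∧ ∀ i, MvPolynomial.aeval x (MvPolynomial.pderiv i F) = 0)

/-- The linear change of variables `F ↦ F (g y)`. -/
def substLinear {R : Type*} [CommRing R] {n : ℕ} (g : Matrix (Fin (n + 1)) (Fin (n + 1)) R)
    (F : MvPolynomial (Fin (n + 1)) R) : MvPolynomial (Fin (n + 1)) R :=
  MvPolynomial.bind₁ (fun i => ∑ j, MvPolynomial.C (g i j) * MvPolynomial.X j) F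

/-- The places of `K` over `k`: the nontrivial valuation rings of `K` containing `k`. For the
function field of a curve these are the local rings of the closed points of the curve. -/
structure Place (k K : Type*) [Field k] [Field K] [Algebra k K] where
  localRing : ValuationSubring K
  algebraMap_mem : ∀ a : k, algebraMap k K a ∈ localRing
  ne_top : localRing ≠ ⊤

namespace Place

variable {k K : Type*} [Field k] [Field K] [Algebra k K]

/-- The completion of `K` at the place `v`. -/
abbrev completion (v : Place k K) : Type _ := v.localRing.valuation.Completion

/-- The embedding of `K` in its completion at `v`. -/
def toCompletion (v : Place k K) : K →+* v.completion :=
  (UniformSpace.Completion.coeRingHom (α := WithVal v.localRing.valuation)).comp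
    (WithVal.equiv v.localRing.valuation).symm.toRingHom

/-- The complete local ring at `v`: the ring of integers of the completion. -/
abbrev integers (v : Place k K) : ValuationSubring v.completion :=
  (Valued.v : Valuation v.completion _).valuationSubring

/-- The number of elements of the residue field at `v`. -/
def residueCard (v : Place k K) : ℕ := Nat.card (IsLocalRing.ResidueField v.localRing)

end Place

variable {k K : Type*} [Field k] [Field K] [Algebra k K] {n : ℕ}

/-- A smooth model over the complete local ring at `v` of the cubic hypersurface `F = 0`:
a cubic form with coefficients in this ring, whose closed fibre is a smooth cubic hypersurface over
the residue field, and whose generic fibre is identified with `F = 0` over the completion of `K`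
by the projective linear isomorphism `y ↦ frame y`. -/
structure SmoothModel (F : MvPolynomial (Fin (n + 1)) K) (v : Place k K) where
  form : MvPolynomial (Fin (n + 1)) v.integers
  homogeneous : form.IsHomogeneous 3
  closedFibre : IsSmoothCubic (MvPolynomial.map (IsLocalRing.residue v.integers) form)
  frame : GL (Fin (n + 1)) v.completion
  scale : v.completion
  scale_ne_zero : scale ≠ 0
  genericFibre : MvPolynomial.map v.integers.subtype form =
    MvPolynomial.C scale * substLinear frame.val (MvPolynomial.map v.toCompletion F)

/-- `v` is a place of good reduction of the cubic hypersurface `F = 0`. -/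
def HasGoodReduction (F : MvPolynomial (Fin (n + 1)) K) (v : Place k K) : Prop :=
  Nonempty (SmoothModel F v)

/-- A formal section of the model at `v`, that is, a point of the model with values in the complete
local ring, given by primitive homogeneous coordinates. -/
structure FormalSection {F : MvPolynomial (Fin (n + 1)) K} {v : Place k K}
    (M : SmoothModel F v) where
  coord : Fin (n + 1) → v.integers
  primitive : ∃ i, IsUnit (coord i)
  eval_eq_zero : MvPolynomial.eval coord M.form = 0

/-- The `K`-rational points of the hypersurface `F = 0`, given by homogeneous coordinates. -/
structure RationalPoint (F : MvPolynomial (Fin (n + 1)) K) where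
  coord : Fin (n + 1) → K
  ne_zero : coord ≠ 0
  eval_eq_zero : MvPolynomial.eval coord F = 0

/-- The section of the model defined by the `K`-rational point `x` agrees with the formal section
`s` modulo the `(N + 1)`-st power of the maximal ideal: suitable homogeneous coordinates of `x`
in the model are integral and congruent to those of `s`. -/
def Agrees {F : MvPolynomial (Fin (n + 1)) K} {v : Place k K} {M : SmoothModel F v}
    (N : ℕ) (x : RationalPoint F) (s : FormalSection M) : Prop :=
  ∃ a : v.completion, ∀ j, ∃ e ∈ IsLocalRing.maximalIdeal v.integers ^ (N + 1),
    a * (M.frame⁻¹.val.mulVec (fun i => v.toCompletion (x.coord i))) j =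
      ((s.coord j + e : v.integers) : v.completion)

/-- Weak approximation at order `N` at the places of good reduction whose residue fields have at
least `c` elements, for the hypersurface `F = 0` over the function field `K` of a curve over `k`:
there is a model, smooth at the places of good reduction, such that for any finite sequence of
distinct such places and any formal sections of the model at these places, there is a rational
point agreeing with all of these formal sections to order `N`. -/
def WeakApproximationAtGoodPlaces (k : Type*) {K : Type*} [Field k] [Field K] [Algebra k K] {n : ℕ}
    (F : MvPolynomial (Fin (n + 1)) K) (c N : ℕ) : Prop :=
  ∃ M : ∀ v : Place k K, HasGoodReduction F v → SmoothModel F v,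
    ∀ (l : ℕ) (b : Fin l → Place k K) (_ : Function.Injective b)
      (good : ∀ i, HasGoodReduction F (b i)) (_ : ∀ i, c ≤ (b i).residueCard)
      (s : ∀ i, FormalSection (M (b i) (good i))),
      ∃ x : RationalPoint F, ∀ i, Agrees N x (s i)

end

/-! Let σ be the conjugation of `K₂` over `K₁`. For a point x of the cubic over `K₂`, the line
through x and σx is defined over `K₁`, and so is its third intersection point with X. In coordinates
this point is `thirdPoint`, a polynomial in x and σx, so it respects congruences modulo powers of
the maximal ideal. It therefore suffices to write each prescribed section s at a place v of `K₁` as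
the third point of a line through two sections: conjugate to each other if the place w over v is its
own conjugate, both defined over the complete local ring at v if v splits. Approximating these
sections at the places over v (one of them at w and, in the split case, the other at the conjugate
of w) by a point x over `K₂`, one takes the third point of x and σx. If the third-point formula
degenerates, x is rational or its line lies in X; this can occur only when no condition is imposed,
and a rational point still exists.

The local problem reduces by Hensel's lemma to the residue field. For a point s and a direction t
put A = `polar G s t`, B = `polar G t s`, C = `eval t G`. The residual intersection with the line is
governed by y² + By + AC, whose coefficients are forms in t of degrees 2 and 4. A line with two
further rational points, or with two conjugate ones, exists as soon as this quadratic is split with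
distinct roots, or irreducible, for some t. If one type never occurs, the discriminant (in
characteristic two, the Artin–Schreier class) has constant quadratic character in a weak sense. A
polynomial argument in the style of Stepanov, with auxiliary polynomials of degree at most 10 < q,
then shows that y² + By + AC splits into quadratic forms over the algebraic closure
(`quarticForm_eq_square`, `quarticForm_eq_of_root_values`). But then the linear form A divides one
root, the cubic contains a hyperplane, and it is singular (`exists_singular_of_factor`), against
good reduction.

The rest is arithmetic of places: they are discrete valuations, the constant extension is unramified
because ω − σω is a nonzero constant, and a self-conjugate place is inert because σ moves the
residue of ω. Finally, two smooth models of one cubic differ by an integral invertible matrix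
(`exists_integral_frame`), so the choice of models does not matter. -/

noncomputable section
open MvPolynomial

/-! ### Cubic forms restricted to lines, and the third intersection point. -/

section Cubic

variable {ι : Type*} {R S : Type*} [CommRing R] [CommRing S]

/-- A finitely supported function of positive degree splits off a unit at some point. -/
theorem Finsupp.exists_eq_single_add {m : ℕ} {d : ι →₀ ℕ} (hd : d.degree = m + 1) :
    ∃ i e, d = Finsupp.single i 1 + e ∧ e.degree = m := by
  have hne : d ≠ 0 := by rintro rfl; simp at hd
  obtain ⟨i, hi⟩ := Finsupp.support_nonempty_iff.mpr hne
  have hle : Finsupp.single i 1 ≤ d := by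
    rw [Finsupp.single_le_iff]
    exact Nat.one_le_iff_ne_zero.mpr (Finsupp.mem_support_iff.mp hi)
  refine ⟨i, d - Finsupp.single i 1, (add_tsub_cancel_of_le hle).symm, ?_⟩
  have := congrArg Finsupp.degree (add_tsub_cancel_of_le hle)
  rw [map_add, Finsupp.degree_single] at this
  omega

theorem MvPolynomial.IsHomogeneous.degree_of_mem_support {m : ℕ} {F : MvPolynomial ι R}
    (hF : F.IsHomogeneous m) {d : ι →₀ ℕ} (hd : d ∈ F.support) : d.degree = m := by
  have := hF (mem_support_iff.mp hd)
  rw [← this, Finsupp.degree_eq_weight_one]; rfl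

/-- A property of cubic forms holds if it is additive and holds for monomials. -/
theorem MvPolynomial.IsHomogeneous.cubic_induction {P : MvPolynomial ι R → Prop}
    {F : MvPolynomial ι R} (hF : F.IsHomogeneous 3) (h0 : P 0)
    (hadd : ∀ p q, P p → P q → P (p + q))
    (hmon : ∀ a i j k, P (C a * (X i * X j * X k))) : P F := by
  rw [F.as_sum]
  refine Finset.sum_induction _ P (fun p q => hadd p q) h0 fun d hd => ?_
  have hdeg := hF.degree_of_mem_support hd
  generalize coeff d F = a
  clear hd
  obtain ⟨i, e₁, rfl, he₁⟩ := Finsupp.exists_eq_single_add hdeg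
  obtain ⟨j, e₂, rfl, he₂⟩ := Finsupp.exists_eq_single_add he₁
  obtain ⟨k, e₃, rfl, he₃⟩ := Finsupp.exists_eq_single_add he₂
  rw [Finsupp.degree_eq_zero_iff] at he₃
  subst he₃
  convert! hmon a i j k using 1
  simp only [X, monomial_mul, C_mul_monomial, add_zero, mul_one, add_assoc]

/-- A property of quadratic forms holds if it is additive and holds for monomials. -/
theorem MvPolynomial.IsHomogeneous.quadratic_induction {P : MvPolynomial ι R → Prop}
    {F : MvPolynomial ι R} (hF : F.IsHomogeneous 2) (h0 : P 0)
    (hadd : ∀ p q, P p → P q → P (p + q))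
    (hmon : ∀ a i j, P (C a * (X i * X j))) : P F := by
  rw [F.as_sum]
  refine Finset.sum_induction _ P (fun p q => hadd p q) h0 fun d hd => ?_
  have hdeg := hF.degree_of_mem_support hd
  generalize coeff d F = a
  clear hd
  obtain ⟨i, e₁, rfl, he₁⟩ := Finsupp.exists_eq_single_add hdeg
  obtain ⟨j, e₂, rfl, he₂⟩ := Finsupp.exists_eq_single_add he₁
  rw [Finsupp.degree_eq_zero_iff] at he₂
  subst he₂
  convert! hmon a i j using 1
  simp only [X, monomial_mul, C_mul_monomial, add_zero, mul_one]

theorem map_eval' (φ : R →+* S) (F : MvPolynomial ι R) (x : ι → R) :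
    φ (eval x F) = eval (fun i => φ (x i)) (map φ F) := by
  rw [eval_map, eval₂_comp]; rfl

variable [Fintype ι]

/-- The derivative of the form `F` at `x` in the direction `y`. -/
def polar (F : MvPolynomial ι R) (x y : ι → R) : R := ∑ i, y i * eval x (pderiv i F)

theorem polar_add (F G : MvPolynomial ι R) (x y : ι → R) :
    polar (F + G) x y = polar F x y + polar G x y := by
  simp [polar, mul_add, Finset.sum_add_distrib]

theorem polar_mul (F G : MvPolynomial ι R) (x y : ι → R) :
    polar (F * G) x y = eval x F * polar G x y + eval x G * polar F x y := by
  simp only [polar, Derivation.leibniz, smul_eq_mul, map_add, map_mul, mul_add,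
    Finset.sum_add_distrib, Finset.mul_sum]
  congr 1 <;> exact Finset.sum_congr rfl fun i _ => by ring

@[simp] theorem polar_C (a : R) (x y : ι → R) : polar (C a) x y = 0 := by simp [polar]

@[simp] theorem polar_X (i : ι) (x y : ι → R) : polar (X i) x y = y i := by
  classical
  simp [polar, pderiv_X, Pi.single_apply, Finset.sum_ite_eq, apply_ite]

@[simp] theorem polar_zero (x y : ι → R) : polar 0 x y = 0 := by simp [polar]

theorem polar_add_right (F : MvPolynomial ι R) (x y z : ι → R) :
    polar F x (y + z) = polar F x y + polar F x z := by
  simp [polar, add_mul, Finset.sum_add_distrib]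

theorem polar_smul_right (F : MvPolynomial ι R) (x y : ι → R) (a : R) :
    polar F x (a • y) = a * polar F x y := by
  simp [polar, Finset.mul_sum, mul_assoc]

theorem polar_single [DecidableEq ι] (F : MvPolynomial ι R) (x : ι → R) (i : ι) :
    polar F x (Pi.single i 1) = eval x (pderiv i F) := by
  simp [polar, Pi.single_apply]

theorem map_polar (φ : R →+* S) (F : MvPolynomial ι R) (x y : ι → R) :
    φ (polar F x y) = polar (map φ F) (fun i => φ (x i)) (fun i => φ (y i)) := by
  simp only [polar, map_sum, map_mul, pderiv_map, eval_map]
  refine Finset.sum_congr rfl fun i _ => ?_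
  congr 1
  exact (eval₂_comp φ x _).symm ▸ rfl

theorem polar_sum {σ : Type*} (s : Finset σ) (F : σ → MvPolynomial ι R) (x y : ι → R) :
    polar (∑ j ∈ s, F j) x y = ∑ j ∈ s, polar (F j) x y := by
  induction s using Finset.cons_induction with
  | empty => simp
  | cons a s ha ih => rw [Finset.sum_cons, Finset.sum_cons, polar_add, ih]

/-- The chain rule. -/
theorem polar_bind₁ {κ : Type*} [Fintype κ] (f : κ → MvPolynomial ι R) (G : MvPolynomial κ R)
    (x y : ι → R) :
    polar (bind₁ f G) x y = polar G (fun i => eval x (f i)) (fun i => polar (f i) x y) := by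
  induction G using MvPolynomial.induction_on with
  | C a => simp
  | add p q hp hq => rw [map_add, polar_add, polar_add, hp, hq]
  | mul_X p i hp =>
    have : eval x (bind₁ f p) = eval (fun i => eval x (f i)) p := by
      rw [← coe_aeval_eq_eval, ← coe_aeval_eq_eval, RingHom.coe_coe, RingHom.coe_coe, aeval_bind₁]
    rw [map_mul, bind₁_X_right, polar_mul, polar_mul, hp, this, eval_X, polar_X]

theorem polar_monomial (a : R) (i j k : ι) (x y : ι → R) :
    polar (C a * (X i * X j * X k)) x y =
      a * (y i * x j * x k + x i * y j * x k + x i * x j * y k) := by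
  simp only [polar_mul, polar_C, polar_X, eval_C, eval_X, map_mul]
  ring

/-- Values of a cubic form on the line spanned by two vectors. -/
theorem eval_combination {F : MvPolynomial ι R} (hF : F.IsHomogeneous 3) (s t : ι → R) (a b : R) :
    eval (a • s + b • t) F = a ^ 3 * eval s F + a ^ 2 * b * polar F s t + a * b ^ 2 * polar F t s
      + b ^ 3 * eval t F := by
  refine hF.cubic_induction (P := fun F => eval (a • s + b • t) F = a ^ 3 * eval s F +
    a ^ 2 * b * polar F s t + a * b ^ 2 * polar F t s + b ^ 3 * eval t F) (by simp) ?_ ?_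
  · intro p q hp hq
    rw [polar_add, polar_add, map_add, map_add, map_add, hp, hq]; ring
  · intro c i j k
    simp only [polar_monomial, map_mul, eval_C, eval_X, Pi.add_apply, Pi.smul_apply, smul_eq_mul]
    ring

/-- Derivatives of a cubic form on the line spanned by two vectors. -/
theorem polar_combination {F : MvPolynomial ι R} (hF : F.IsHomogeneous 3) (s t : ι → R)
    (a b c d : R) :
    polar F (a • s + b • t) (c • s + d • t) =
      c * (3 * a ^ 2 * eval s F + 2 * a * b * polar F s t + b ^ 2 * polar F t s) +
      d * (a ^ 2 * polar F s t + 2 * a * b * polar F t s + 3 * b ^ 2 * eval t F) := by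
  refine hF.cubic_induction (P := fun F => polar F (a • s + b • t) (c • s + d • t) =
      c * (3 * a ^ 2 * eval s F + 2 * a * b * polar F s t + b ^ 2 * polar F t s) +
      d * (a ^ 2 * polar F s t + 2 * a * b * polar F t s + 3 * b ^ 2 * eval t F)) (by simp) ?_ ?_
  · intro p q hp hq
    simp only [polar_add, map_add, hp, hq]; ring
  · intro c i j k
    simp only [polar_monomial, map_mul, eval_C, eval_X, Pi.add_apply, Pi.smul_apply, smul_eq_mul]
    ring

/-- Values of a quadratic form on the plane spanned by two vectors. -/
theorem eval_combination_quadratic {Q : MvPolynomial ι R} (hQ : Q.IsHomogeneous 2) (s t : ι → R)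
    (a b : R) :
    eval (a • s + b • t) Q = a ^ 2 * eval s Q + a * b * polar Q s t + b ^ 2 * eval t Q := by
  refine hQ.quadratic_induction (P := fun Q => eval (a • s + b • t) Q =
    a ^ 2 * eval s Q + a * b * polar Q s t + b ^ 2 * eval t Q) (by simp) ?_ ?_
  · intro p q hp hq
    rw [polar_add, map_add, map_add, map_add, hp, hq]; ring
  · intro c i j
    simp only [polar_mul, polar_C, polar_X, map_mul, eval_C, eval_X, Pi.add_apply, Pi.smul_apply,
      smul_eq_mul]
    ring

theorem eval_smul_cubic {F : MvPolynomial ι R} (hF : F.IsHomogeneous 3) (s : ι → R) (a : R) :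
    eval (a • s) F = a ^ 3 * eval s F := by
  simpa using eval_combination hF s 0 a 0

theorem polar_smul_left {F : MvPolynomial ι R} (hF : F.IsHomogeneous 3) (s t : ι → R) (a : R) :
    polar F (a • s) t = a ^ 2 * polar F s t := by
  simpa using polar_combination hF s t a 0 0 1

theorem polar_self {F : MvPolynomial ι R} (hF : F.IsHomogeneous 3) (s : ι → R) :
    polar F s s = 3 * eval s F := by
  simpa using polar_combination hF s 0 1 0 1 0

/-- The third point of intersection of the cubic hypersurface `F = 0` with the line through its
points `x` and `y`. -/
def thirdPoint (F : MvPolynomial ι R) (x y : ι → R) : ι → R :=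
  polar F x y • y + (-polar F y x) • x

/-- On the line, F(ax + by) = ab(a·`polar F x y` + b·`polar F y x`), and the coefficients in
`thirdPoint` annihilate the last factor. -/
theorem eval_thirdPoint {F : MvPolynomial ι R} (hF : F.IsHomogeneous 3) {x y : ι → R}
    (hx : eval x F = 0) (hy : eval y F = 0) : eval (thirdPoint F x y) F = 0 := by
  rw [thirdPoint, eval_combination hF, hx, hy]; ring

theorem map_thirdPoint (φ : R →+* S) (F : MvPolynomial ι R) (x y : ι → R) (j : ι) :
    φ (thirdPoint F x y j) = thirdPoint (map φ F) (fun i => φ (x i)) (fun i => φ (y i)) j := by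
  simp [thirdPoint, map_polar]

/-- The third point is polynomial in the coordinates of both points; this is how approximation
passes to it. -/
theorem thirdPoint_sub_mem {I : Ideal R} (F : MvPolynomial ι R) {x x' y y' : ι → R}
    (hx : ∀ i, x i - x' i ∈ I) (hy : ∀ i, y i - y' i ∈ I) (j : ι) :
    thirdPoint F x y j - thirdPoint F x' y' j ∈ I := by
  rw [← Ideal.Quotient.eq, map_thirdPoint, map_thirdPoint]
  have h1 : (fun i => Ideal.Quotient.mk I (x i)) = fun i => Ideal.Quotient.mk I (x' i) :=
    funext fun i => Ideal.Quotient.eq.mpr (hx i)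
  have h2 : (fun i => Ideal.Quotient.mk I (y i)) = fun i => Ideal.Quotient.mk I (y' i) :=
    funext fun i => Ideal.Quotient.eq.mpr (hy i)
  rw [h1, h2]

/-- If the points `C s + y₁ t` and `C s + y₂ t` lie on a cubic hypersurface through `s`, then
they are collinear with `s`. -/
theorem residual_points {F : MvPolynomial ι R} (hF : F.IsHomogeneous 3) {s t : ι → R}
    (hs : eval s F = 0) {y₁ y₂ : R} (hadd : y₁ + y₂ = -polar F t s)
    (hmul : y₁ * y₂ = polar F s t * eval t F) :
    eval (eval t F • s + y₁ • t) F = 0 ∧ eval (eval t F • s + y₂ • t) F = 0 ∧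
    thirdPoint F (eval t F • s + y₁ • t) (eval t F • s + y₂ • t) =
      (-(eval t F) ^ 2 * (y₁ - y₂) ^ 3) • s := by
  -- With A, B, C the coefficients along the line, F(Cs + yt) = Cy(y² + By + AC), and y₁, y₂ are the
  -- roots of the last factor. The scaling by C avoids any division by A.
  have hB : polar F t s = -(y₁ + y₂) := by rw [hadd, neg_neg]
  refine ⟨?_, ?_, ?_⟩
  · rw [eval_combination hF, hs, hB]
    linear_combination (-(y₁ * eval t F) * hmul)
  · rw [eval_combination hF, hs, hB]
    linear_combination (-(y₂ * eval t F) * hmul)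
  · ext j
    simp only [thirdPoint, polar_combination hF, hs, hB, Pi.add_apply, Pi.smul_apply, smul_eq_mul]
    linear_combination
      (eval t F * (y₁ ^ 2 - y₂ ^ 2) * t j - eval t F ^ 2 * (y₁ - y₂) * s j) * hmul

end Cubic

/-! ### The coefficients A and B as forms in the direction t. -/

section Forms

variable {ι R : Type*} [CommRing R] [Fintype ι]

/-- The derivative of a form in the direction `s`, as a form. -/
def dirDeriv (s : ι → R) (F : MvPolynomial ι R) : MvPolynomial ι R := ∑ i, C (s i) * pderiv i F

/-- The differential of a form at `s`, as a linear form. -/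
def tangentForm (s : ι → R) (F : MvPolynomial ι R) : MvPolynomial ι R :=
  ∑ i, C (eval s (pderiv i F)) * X i

@[simp] theorem eval_dirDeriv (s x : ι → R) (F : MvPolynomial ι R) :
    eval x (dirDeriv s F) = polar F x s := by simp [dirDeriv, polar]

@[simp] theorem eval_tangentForm (s x : ι → R) (F : MvPolynomial ι R) :
    eval x (tangentForm s F) = polar F s x := by simp [tangentForm, polar, mul_comm]

theorem MvPolynomial.IsHomogeneous.dirDeriv {F : MvPolynomial ι R} {m : ℕ}
    (hF : F.IsHomogeneous m) (s : ι → R) : (dirDeriv s F).IsHomogeneous (m - 1) :=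
  IsHomogeneous.sum _ _ _ fun i _ => by simpa using (isHomogeneous_C ι (s i)).mul hF.pderiv

theorem isHomogeneous_tangentForm (s : ι → R) (F : MvPolynomial ι R) :
    (tangentForm s F).IsHomogeneous 1 :=
  IsHomogeneous.sum _ _ _ fun i _ => by
    simpa using (isHomogeneous_C ι (eval s (pderiv i F))).mul (isHomogeneous_X R i)

theorem tangentForm_ne_zero {s : ι → R} {F : MvPolynomial ι R} {i : ι}
    (h : eval s (pderiv i F) ≠ 0) : tangentForm s F ≠ 0 := by
  classical
  intro h0
  have := eval_tangentForm s (Pi.single i 1) F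
  rw [h0, map_zero, polar_single] at this
  exact h this.symm

end Forms

/-! ### Linear changes of variables. -/

section Substitution

variable {R : Type*} [CommRing R] {n : ℕ}

theorem eval_substLinear (g : Matrix (Fin (n + 1)) (Fin (n + 1)) R)
    (F : MvPolynomial (Fin (n + 1)) R) (y : Fin (n + 1) → R) :
    eval y (substLinear g F) = eval (g.mulVec y) F := by
  rw [substLinear, ← coe_aeval_eq_eval, ← coe_aeval_eq_eval, RingHom.coe_coe, RingHom.coe_coe,
    aeval_bind₁]
  congr 2
  ext i
  simp [Matrix.mulVec, dotProduct]

theorem polar_substLinear (g : Matrix (Fin (n + 1)) (Fin (n + 1)) R)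
    (F : MvPolynomial (Fin (n + 1)) R) (y z : Fin (n + 1) → R) :
    polar (substLinear g F) y z = polar F (g.mulVec y) (g.mulVec z) := by
  rw [substLinear, polar_bind₁]
  congr 1 <;> ext i <;> simp [polar_sum, polar_mul, Matrix.mulVec, dotProduct]

theorem map_substLinear {S : Type*} [CommRing S] (φ : R →+* S)
    (g : Matrix (Fin (n + 1)) (Fin (n + 1)) R) (F : MvPolynomial (Fin (n + 1)) R) :
    map φ (substLinear g F) = substLinear (g.map φ) (map φ F) := by
  rw [substLinear, substLinear, map_bind₁]
  congr 2
  ext i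
  simp

end Substitution

theorem IsSmoothCubic.not_singular {L : Type*} [Field L] {n : ℕ}
    {F : MvPolynomial (Fin (n + 1)) L} (hF : IsSmoothCubic F) {x : Fin (n + 1) → L} (hx : x ≠ 0)
    (h0 : eval x F = 0) : ∃ i, eval x (pderiv i F) ≠ 0 := by
  by_contra! h
  have key : ∀ p : MvPolynomial (Fin (n + 1)) L,
      aeval (fun i => algebraMap L (AlgebraicClosure L) (x i)) p =
        algebraMap L (AlgebraicClosure L) (eval x p) := fun p => by
    rw [map_eval', eval_map, aeval_def]
  refine hF.nonsingular (fun i => algebraMap L (AlgebraicClosure L) (x i)) ?_ ⟨?_, fun i => ?_⟩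
  · contrapose! hx
    ext i
    simpa using congrFun hx i
  · rw [key, h0, map_zero]
  · rw [key, h i, map_zero]

end

noncomputable section
open MvPolynomial

/-! ### A split residual quadratic forces a singular point. -/

section AlgClosed

variable {L : Type*} [Field L] [IsAlgClosed L]

/-- Fewer equations without constant terms than variables have a nontrivial common zero over an
algebraically closed field. -/
theorem exists_common_zero {n : ℕ} (f : Fin n → MvPolynomial (Fin (n + 1)) L)
    (hf : ∀ i, eval 0 (f i) = 0) : ∃ x : Fin (n + 1) → L, x ≠ 0 ∧ ∀ i, eval x (f i) = 0 := by
  by_contra! h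
  set I : Ideal (MvPolynomial (Fin (n + 1)) L) := Ideal.span (Set.range f) with hI
  have hloc : zeroLocus L I = {0} := by
    ext x
    rw [hI, zeroLocus_span, Set.mem_singleton_iff]
    constructor
    · intro hx
      by_contra hne
      obtain ⟨i, hi⟩ := h x hne
      exact hi (by simpa [coe_aeval_eq_eval] using hx (f i) ⟨i, rfl⟩)
    · rintro rfl p ⟨i, rfl⟩
      simpa [coe_aeval_eq_eval] using hf i
  have hmax : (vanishingIdeal L {(0 : Fin (n + 1) → L)}).IsMaximal :=
    isMaximal_iff_eq_vanishingIdeal_singleton.mpr ⟨0, rfl⟩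
  -- If the origin is the only common zero, its maximal ideal is minimal over an ideal with n
  -- generators, so Krull's theorem bounds its height by n.
  have hrad : I.radical = vanishingIdeal L {(0 : Fin (n + 1) → L)} := by
    rw [← vanishingIdeal_zeroLocus_eq_radical (K := L), hloc]
  have hmin : vanishingIdeal L {(0 : Fin (n + 1) → L)} ∈ I.minimalPrimes := by
    rw [← Ideal.radical_minimalPrimes, hrad, Ideal.minimalPrimes_eq_subsingleton_self]
    exact rfl
  have hheight : (vanishingIdeal L {(0 : Fin (n + 1) → L)}).height ≤ n := by
    refine (Ideal.height_le_card_of_mem_minimalPrimes_span (Set.finite_range f) hmin).trans ?_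
    have := Set.ncard_image_le (Set.finite_univ (α := Fin n)) (f := f)
    rw [Set.image_univ, Set.ncard_univ, Nat.card_eq_fintype_card, Fintype.card_fin] at this
    exact_mod_cast this
  have hdim : ringKrullDim (MvPolynomial (Fin (n + 1)) L) ≤ (n : ℕ∞) := by
    rw [ringKrullDim_le_iff_isMaximal_height_le]
    intro m hm
    obtain ⟨x, rfl⟩ := isMaximal_iff_eq_vanishingIdeal_singleton.mp hm
    have hinv : ∀ a : Fin (n + 1) → L, (aeval (fun i => X i + C (a i))).comp
        (aeval (fun i => X i + C (-a i))) = AlgHom.id L (MvPolynomial (Fin (n + 1)) L) := by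
      intro a
      ext i : 1
      simp
    -- Translation moves any maximal ideal to that of the origin, so the whole ring would have
    -- dimension at most n.
    let e : MvPolynomial (Fin (n + 1)) L ≃ₐ[L] MvPolynomial (Fin (n + 1)) L :=
      AlgEquiv.ofAlgHom (aeval fun i => X i + C (x i)) (aeval fun i => X i + C (-x i)) (hinv x)
        (by simpa using hinv (-x))
    have hcomap : Ideal.comap e.toRingEquiv (vanishingIdeal L {(0 : Fin (n + 1) → L)}) =
        vanishingIdeal L {x} := by
      ext p
      rw [Ideal.mem_comap, mem_vanishingIdeal_singleton_iff, mem_vanishingIdeal_singleton_iff]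
      have : aeval (0 : Fin (n + 1) → L) (e p) = aeval x p := by
        change (aeval (0 : Fin (n + 1) → L)).comp (aeval fun i => X i + C (x i)) p = _
        congr 1
        ext i
        simp
      exact iff_of_eq (congrArg (· = 0) this)
    rw [← hcomap, RingEquiv.height_comap]
    exact_mod_cast hheight
  have h1 := ringKrullDim_add_natCard_le_ringKrullDim_mvPolynomial (R := L) (Fin (n + 1))
  rw [ringKrullDim_eq_zero_of_field, zero_add, Nat.card_eq_fintype_card, Fintype.card_fin] at h1
  have h2 := h1.trans hdim
  have : n + 1 ≤ n := by exact_mod_cast h2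
  omega

/-- A binary quadratic form has a nontrivial zero over an algebraically closed field. -/
theorem exists_zero_binary_quadratic (a b c : L) :
    ∃ x y : L, (x ≠ 0 ∨ y ≠ 0) ∧ x ^ 2 * a + x * y * b + y ^ 2 * c = 0 := by
  by_cases ha : a = 0
  · exact ⟨1, 0, Or.inl one_ne_zero, by simp [ha]⟩
  · obtain ⟨x, hx⟩ := IsAlgClosed.exists_root
      (Polynomial.C a * Polynomial.X ^ 2 + Polynomial.C b * Polynomial.X + Polynomial.C c)
      (by rw [Polynomial.degree_quadratic ha]; norm_num)
    refine ⟨x, 1, Or.inr one_ne_zero, ?_⟩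
    simp only [Polynomial.IsRoot, Polynomial.eval_add, Polynomial.eval_mul, Polynomial.eval_C,
      Polynomial.eval_pow, Polynomial.eval_X] at hx
    linear_combination hx

/-- A cubic hypersurface in a projective space of dimension at least two for which the discriminant
of the projection from a point is a square is singular. -/
theorem exists_singular_of_factor {n : ℕ} (hn : 2 ≤ n) {G : MvPolynomial (Fin (n + 1)) L}
    (hG : G.IsHomogeneous 3) {s : Fin (n + 1) → L} (hs : s ≠ 0) (hs0 : eval s G = 0)
    {y₁ y₂ : MvPolynomial (Fin (n + 1)) L} (h₁ : y₁.IsHomogeneous 2) (h₂ : y₂.IsHomogeneous 2)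
    (hadd : y₁ + y₂ = -dirDeriv s G) (hmul : y₁ * y₂ = tangentForm s G * G) :
    ∃ x : Fin (n + 1) → L, x ≠ 0 ∧ eval x G = 0 ∧ ∀ i, eval x (pderiv i G) = 0 := by
  by_cases hA : ∀ i, eval s (pderiv i G) = 0
  · exact ⟨s, hs, hs0, hA⟩
  push Not at hA
  obtain ⟨i, hi⟩ := hA
  have hA0 : tangentForm s G ≠ 0 := tangentForm_ne_zero hi
  have hprime : Prime (tangentForm s G) := by
    refine (irreducible_of_totalDegree_eq_one
      ((isHomogeneous_tangentForm s G).totalDegree hA0) fun x hx => ?_).prime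
    rw [isUnit_iff_ne_zero]
    rintro rfl
    exact hA0 (MvPolynomial.ext _ _ fun d => by simpa using hx d)
  -- A is a nonzero linear form, hence prime, and divides y₁y₂ = AG. If y₁ = Am, then G = m·y₂ and B
  -- = −(Am + y₂).
  wlog hdvd : tangentForm s G ∣ y₁ generalizing y₁ y₂
  · refine this h₂ h₁ ((add_comm _ _).trans hadd) ((mul_comm _ _).trans hmul) ?_
    exact (hprime.dvd_or_dvd (hmul ▸ dvd_mul_right _ _)).resolve_left hdvd
  obtain ⟨m, rfl⟩ := hdvd
  obtain ⟨i₀, hi₀⟩ := Function.ne_iff.mp hs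
  rw [Pi.zero_apply] at hi₀
  -- Here n ≥ 2 enters: two coordinate vectors besides `i₀` span a plane not containing s, and on it
  -- the quadratic form Q = Am − y₂ has a nontrivial zero t.
  obtain ⟨j, hj, k, hk, hjk⟩ := Finset.one_lt_card.mp
    (show 1 < (Finset.univ.erase i₀).card by rw [Finset.card_erase_of_mem (Finset.mem_univ _)]; simp; omega)
  have hj := Finset.ne_of_mem_erase hj
  have hk := Finset.ne_of_mem_erase hk
  set Q := tangentForm s G * m - y₂ with hQ
  have hQh : Q.IsHomogeneous 2 := h₁.sub h₂
  obtain ⟨α, β, hαβ, hzero⟩ := exists_zero_binary_quadratic (eval (Pi.single j 1) Q)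
    (polar Q (Pi.single j 1) (Pi.single k 1)) (eval (Pi.single k 1) Q)
  set t : Fin (n + 1) → L := α • Pi.single j 1 + β • Pi.single k 1 with ht
  have hQt : eval t Q = 0 := by rw [ht, eval_combination_quadratic hQh, hzero]
  have hB : ∀ x, polar G x s = -(polar G s x * eval x m + eval x y₂) := fun x => by
    have := congrArg (eval x) hadd
    simp only [map_add, map_mul, map_neg, eval_tangentForm, eval_dirDeriv] at this
    linear_combination this
  -- G(m(x)s + x) = m²A + mB + G vanishes identically once B and G are expressed through m and y₂:
  -- the points m(x)s + x all lie on the cubic.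
  have hsurf : bind₁ (fun i => m * C (s i) + X i) G = 0 := by
    refine (mul_eq_zero.mp (funext fun x => ?_ : tangentForm s G * _ = 0)).resolve_left hA0
    have h3 : eval x (bind₁ (fun i => m * C (s i) + X i) G) = eval (eval x m • s + (1 : L) • x) G := by
      rw [← coe_aeval_eq_eval, ← coe_aeval_eq_eval, RingHom.coe_coe, RingHom.coe_coe, aeval_bind₁]
      congr 2
      ext i
      simp
    have h4 := congrArg (eval x) hmul
    simp only [map_mul, eval_tangentForm] at h4
    rw [map_mul, h3, eval_combination hG, hs0, hB, eval_tangentForm, map_zero]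
    linear_combination -h4
  have hchain : ∀ τ, polar G (eval t m • s + (1 : L) • t) (polar m t τ • s + (1 : L) • τ) = 0 := by
    intro τ
    have := polar_bind₁ (fun i => m * C (s i) + X i) G t τ
    rw [hsurf, polar_zero] at this
    rw [this]
    congr 1 <;> ext i <;> simp [polar_add, polar_mul, mul_comm]
  -- The derivative in the direction s at P = m(t)s + t is 2mA + B = Q(t), zero by the choice of t.
  -- The directions obtained by differentiating the identity at t, together with s, span everything,
  -- so P is singular.
  have hPs : polar G (eval t m • s + (1 : L) • t) s = 0 := by
    have := polar_combination hG s t (eval t m) 1 1 0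
    rw [one_smul L s, zero_smul, add_zero] at this
    rw [this, hs0, hB]
    have : polar G s t * eval t m - eval t y₂ = 0 := by
      rw [← hQt, hQ, map_sub, map_mul, eval_tangentForm]
    linear_combination this
  refine ⟨eval t m • s + (1 : L) • t, ?_, ?_, fun l => ?_⟩
  · intro h0
    have t0 : t i₀ = 0 := by simp [ht, hj.symm, hk.symm]
    have tj : t j = α := by simp [ht, hjk]
    have tk : t k = β := by simp [ht, hjk.symm]
    have e : ∀ i, eval t m * s i + t i = 0 := fun i => by simpa using congrFun h0 i
    have hm0 : eval t m = 0 := (mul_eq_zero.mp (by rw [← e i₀, t0, add_zero])).resolve_right hi₀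
    have ej := e j
    have ek := e k
    rw [hm0, zero_mul, zero_add] at ej ek
    rw [tj] at ej
    rw [tk] at ek
    rcases hαβ with h | h
    · exact h ej
    · exact h ek
  · have h3 := congrArg (eval t) hsurf
    rw [map_zero] at h3
    rw [← h3, ← coe_aeval_eq_eval, ← coe_aeval_eq_eval, RingHom.coe_coe, RingHom.coe_coe,
      aeval_bind₁]
    congr 2
    ext i
    simp
  · have := hchain (Pi.single l 1)
    rw [polar_add_right, polar_smul_right, polar_smul_right, hPs, mul_zero, zero_add, one_mul,
      polar_single] at this
    exact this

end AlgClosed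

section Vanishing

variable {κ : Type*} [Field κ] [Fintype κ]

/-- A polynomial of small degree that vanishes at all points over a finite field is zero. -/
theorem eq_zero_of_totalDegree_lt_card {ι : Type*} [Finite ι] {p : MvPolynomial ι κ}
    (hdeg : p.totalDegree < Fintype.card κ) (h : ∀ x, eval x p = 0) : p = 0 :=
  eq_zero_of_eval_zero_at_prod_finset p (fun _ => Finset.univ)
    (fun i => (degreeOf_le_totalDegree p i).trans_lt hdeg) fun x _ => h x

end Vanishing
end

/-! ### Binary quartics without nonzero square values, in odd characteristic. -/

noncomputable section

namespace Polynomial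

variable {κ : Type*} [Field κ]

/-- The powers `1`, `X ^ q`, `X ^ (2 q)` are independent over polynomials of degree less than
`q`. -/
theorem eq_zero_of_add_mul_X_pow {q : ℕ} {w₀ w₁ w₂ : κ[X]} (h₀ : w₀.natDegree < q)
    (h₁ : w₁.natDegree < q)
    (h : w₀ + w₁ * X ^ q + w₂ * (X ^ q) ^ 2 = 0) : w₀ = 0 ∧ w₂ = 0 := by
  rw [← pow_mul] at h
  have hc : ∀ k, w₀.coeff k + (if q ≤ k then w₁.coeff (k - q) else 0) +
      (if q * 2 ≤ k then w₂.coeff (k - q * 2) else 0) = 0 := fun k => by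
    have := congrArg (fun p => coeff p k) h
    simpa only [coeff_add, coeff_mul_X_pow', coeff_zero] using this
  constructor
  · ext k
    rw [coeff_zero]
    by_cases hk : k < q
    · have := hc k
      rwa [if_neg (by omega), if_neg (by omega), add_zero, add_zero] at this
    · exact coeff_eq_zero_of_natDegree_lt (by omega)
  · ext k
    rw [coeff_zero]
    have := hc (k + q * 2)
    rwa [if_pos (by omega), if_pos (by omega), coeff_eq_zero_of_natDegree_lt (by omega),
      coeff_eq_zero_of_natDegree_lt (by omega), add_zero, zero_add, Nat.add_sub_cancel] at this

/-- The coefficient just below the top is needed to see two leading terms cancel in the degree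
estimate for U. -/
theorem Monic.coeff_pow_natDegree_mul_sub_one {h : κ[X]} (hh : h.Monic) (hd : h.natDegree ≠ 0)
    {M : ℕ} (hM : M ≠ 0) :
    (h ^ M).coeff (h.natDegree * M - 1) = M * h.coeff (h.natDegree - 1) := by
  have := hh.nextCoeff_pow M
  rw [nextCoeff_of_natDegree_pos (by rw [hh.natDegree_pow]; positivity), hh.natDegree_pow,
    nextCoeff_of_natDegree_pos (by omega), nsmul_eq_mul, mul_comm M] at this
  exact this

variable [Fintype κ]

theorem X_pow_card_sub_X_eq_prod :
    (X ^ Fintype.card κ - X : κ[X]) = ∏ a : κ, (X - C a) := by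
  classical
  have hmonic : (X ^ Fintype.card κ - X : κ[X]).Monic :=
    monic_X_pow_sub (by rw [degree_X]; exact_mod_cast Fintype.one_lt_card)
  rw [← prod_multiset_X_sub_C_of_monic_of_roots_card_eq hmonic, FiniteField.roots_X_pow_card_sub_X]
  · rfl
  · rw [FiniteField.roots_X_pow_card_sub_X,
      FiniteField.X_pow_card_sub_X_natDegree_eq _ Fintype.one_lt_card]
    rfl

/-- A polynomial vanishing to order two at all points of a finite field is divisible by
`(X ^ q - X) ^ 2`. -/
theorem X_pow_card_sub_X_sq_dvd {P : κ[X]} (h : ∀ a, eval a P = 0)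
    (h' : ∀ a, eval a (derivative P) = 0) : (X ^ Fintype.card κ - X) ^ 2 ∣ P := by
  by_cases hP : P = 0
  · simp [hP]
  rw [X_pow_card_sub_X_eq_prod, ← Finset.prod_pow]
  refine Finset.prod_dvd_of_coprime (fun a _ b _ hab => ?_) fun a _ => ?_
  · exact (pairwise_coprime_X_sub_C Function.injective_id hab).pow
  · exact (le_rootMultiplicity_iff hP).mp ((one_lt_rootMultiplicity_iff_isRoot hP).mpr ⟨h a, h' a⟩)

theorem natDegree_quotient_le {P U : κ[X]} {m : ℕ}
    (h : P = U * (X ^ Fintype.card κ - X) ^ 2) (hP : P.natDegree ≤ 2 * Fintype.card κ + m) :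
    U.natDegree ≤ m := by
  by_cases hU : U = 0
  · simp [hU]
  have hne := FiniteField.X_pow_card_sub_X_ne_zero κ (Fintype.one_lt_card (α := κ))
  rw [h, natDegree_mul hU (pow_ne_zero 2 hne), natDegree_pow,
    FiniteField.X_pow_card_sub_X_natDegree_eq _ Fintype.one_lt_card] at hP
  omega

/-- A binary quartic form over a finite field with more than ten elements of odd order that takes
no nonzero square value is a constant multiple of a square. -/
theorem quartic_eq_square_of_no_square_value (hq : 11 ≤ Fintype.card κ) (h2 : (2 : κ) ≠ 0)
    {f₀ e₁ f₂ e₃ f₄ : κ} (h0 : f₀ ≠ 0)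
    (hf : ∀ t y : κ, y ≠ 0 → f₀ + 2 * e₁ * t + f₂ * t ^ 2 + 2 * e₃ * t ^ 3 + f₄ * t ^ 4 ≠ y ^ 2)
    (hinf : ∀ y : κ, y ≠ 0 → f₄ ≠ y ^ 2) :
    4 * f₀ ^ 3 * f₄ = (e₁ ^ 2 - f₀ * f₂) ^ 2 := by
  classical
  set q := Fintype.card κ with hqdef
  have hq0 : (q : κ) = 0 := Nat.cast_card_eq_zero κ
  obtain ⟨M, hM⟩ : ∃ M, q + 1 = 2 * M := by
    have hodd : q % 2 = 1 := FiniteField.odd_card_of_char_ne_two (fun h => by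
      have := ringChar.spec κ 2
      rw [h] at this
      exact h2 (by exact_mod_cast this.mpr dvd_rfl))
    exact ⟨(q + 1) / 2, by omega⟩
  -- The exponent M = (q + 1)/2 is the scalar 1/2 in κ. At a point where f is a nonzero nonsquare,
  -- f^(M−1) = −1 and f^M = −f.
  have hM2 : (2 : κ) * M = 1 := by
    have : ((q + 1 : ℕ) : κ) = ((2 * M : ℕ) : κ) := by rw [hM]
    push_cast at this
    rw [← this, hq0, zero_add]
  have hneg : ∀ a : κ, (∀ y, y ≠ 0 → a ≠ y ^ 2) → a ≠ 0 → a ^ (M - 1) = -1 := by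
    intro a ha ha0
    have hns : ¬ IsSquare a := by
      rintro ⟨y, rfl⟩
      exact ha y (fun h => ha0 (by simp [h])) (sq y).symm
    have hhalf : q / 2 = M - 1 := by omega
    have hch : ringChar κ ≠ 2 := fun h => h2 (by
      have := ringChar.spec κ 2
      rw [h] at this
      exact_mod_cast this.mpr dvd_rfl)
    rcases FiniteField.pow_dichotomy hch ha0 with h | h
    · exact absurd ((FiniteField.isSquare_iff hch ha0).mpr h) hns
    · rwa [← hqdef, hhalf] at h
  set f : κ[X] := C f₀ + C (2 * e₁) * X + C f₂ * X ^ 2 + C (2 * e₃) * X ^ 3 + C f₄ * X ^ 4 with hfdef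
  have hfe : ∀ a, eval a f = f₀ + 2 * e₁ * a + f₂ * a ^ 2 + 2 * e₃ * a ^ 3 + f₄ * a ^ 4 := by
    intro a; simp [hfdef]
  set T : κ[X] := X ^ q with hT
  -- The symmetric biquadratic polarisation of f: on the diagonal T = X it equals f, and its
  -- X-derivative there is f′/2. Since T = X^q has value a at a and derivative 0, F + f^M vanishes
  -- to order two wherever f is nonzero.
  set F : κ[X] := C f₀ + C e₁ * (X + T) + C f₂ * (X * T) + C e₃ * (X * T * (X + T)) +
    C f₄ * (X ^ 2 * T ^ 2) with hF
  have hTe : ∀ a, eval a T = a := fun a => by rw [hT, eval_pow, eval_X, FiniteField.pow_card]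
  have hTd : derivative T = 0 := by rw [hT, derivative_X_pow, hq0, C_0, zero_mul]
  have hfq : f ^ q = C f₀ + C (2 * e₁) * T + C f₂ * T ^ 2 + C (2 * e₃) * T ^ 3 + C f₄ * T ^ 4 := by
    rw [hqdef, ← FiniteField.expand_card f, hfdef, hT, hqdef]
    simp
  have hnum : ∀ a, eval a f ≠ 0 → eval a (F + f ^ M) = 0 := by
    intro a ha
    have h1 := hneg _ (fun y hy => by rw [hfe]; exact hf a y hy) ha
    have h3 : eval a f ^ M = -eval a f := by
      obtain ⟨m, rfl⟩ : ∃ m, M = m + 1 := ⟨M - 1, by omega⟩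
      rw [pow_succ, show m = m + 1 - 1 from rfl, h1]; ring
    rw [eval_add, eval_pow, h3, hfe]
    simp only [hF, eval_add, eval_mul, eval_C, eval_X, eval_pow, hTe]
    ring
  -- At a root of f the second factor vanishes too, though perhaps only simply; the extra factor f
  -- supplies order two there.
  have hdvd : (X ^ q - X) ^ 2 ∣ f * (F + f ^ M) := by
    refine X_pow_card_sub_X_sq_dvd (fun a => ?_) fun a => ?_
    · by_cases ha : eval a f = 0
      · rw [eval_mul, ha, zero_mul]
      · rw [eval_mul, hnum a ha, mul_zero]
    · rw [derivative_mul, eval_add, eval_mul, eval_mul]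
      by_cases ha : eval a f = 0
      · have : eval a (F + f ^ M) = 0 := by
          rw [eval_add, eval_pow, ha, zero_pow (by omega), add_zero]
          have h3 := hfe a
          rw [ha] at h3
          simp only [hF, eval_add, eval_mul, eval_C, eval_X, eval_pow, hTe]
          linear_combination -h3
        rw [ha, this]; ring
      · have h1 := hneg _ (fun y hy => by rw [hfe]; exact hf a y hy) ha
        have h3 : 2 * eval a (derivative (F + f ^ M)) = 0 := by
          have h4 : eval a (derivative f) = 2 * e₁ + 2 * f₂ * a + 6 * e₃ * a ^ 2 + 4 * f₄ * a ^ 3 := by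
            simp [hfdef]; ring
          have h5 : eval a (derivative F) = e₁ + f₂ * a + 3 * e₃ * a ^ 2 + 2 * f₄ * a ^ 3 := by
            simp [hF, hTd, hTe, derivative_pow]; ring
          rw [derivative_add, derivative_pow, eval_add, eval_mul, eval_mul, eval_pow, h1, h4, h5,
            eval_C]
          linear_combination (-(2 * e₁ + 2 * f₂ * a + 6 * e₃ * a ^ 2 + 4 * f₄ * a ^ 3)) * hM2
        rw [hnum a ha, (mul_eq_zero.mp h3).resolve_left h2]; ring
  obtain ⟨U, hU⟩ := hdvd
  replace hU : f * (F + f ^ M) = U * (X ^ q - X) ^ 2 := hU.trans (mul_comm _ _)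
  have hfdeg : f.natDegree ≤ 4 := by rw [hfdef]; compute_degree
  -- If `f₄` is nonzero, F and f^M both have degree 2q + 2. The condition at infinity gives `f₄ ^ M
  -- = -f₄`, which cancels the top coefficients, and 2M = 1 cancels the next ones.
  have hUdeg : U.natDegree ≤ 4 := by
    refine natDegree_quotient_le hU ?_
    by_cases h4 : f₄ = 0
    · have h3 : f.natDegree ≤ 3 := by
        rw [hfdef, h4, C_0, zero_mul, add_zero]; compute_degree
      have h5 : (f ^ M).natDegree ≤ 2 * q + 1 := natDegree_pow_le.trans
        ((Nat.mul_le_mul_left M h3).trans (by omega))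
      have h6 : F.natDegree ≤ 2 * q + 1 := by
        rw [hF, h4, C_0, zero_mul, add_zero, hT]
        compute_degree
        omega
      refine natDegree_mul_le.trans ((Nat.add_le_add h3
        ((natDegree_add_le _ _).trans (max_le h6 h5))).trans ?_)
      omega
    · have hfn : f.natDegree = 4 := by rw [hfdef]; compute_degree!
      have hfc4 : f.coeff 4 = f₄ := by
        simp only [hfdef, coeff_add, coeff_C_mul, coeff_X_pow, coeff_X, coeff_C]; norm_num
      have hfc3 : f.coeff 3 = 2 * e₃ := by
        simp only [hfdef, coeff_add, coeff_C_mul, coeff_X_pow, coeff_X, coeff_C]; norm_num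
      set h := C f₄⁻¹ * f with hh
      have hhm : h.Monic := by
        rw [Monic, leadingCoeff_mul, leadingCoeff_C, leadingCoeff, hfn, hfc4, inv_mul_cancel₀ h4]
      have hhd : h.natDegree = 4 := by
        rw [hh, natDegree_C_mul (inv_ne_zero h4), hfn]
      have hh3 : h.coeff 3 = f₄⁻¹ * (2 * e₃) := by
        rw [hh, coeff_C_mul, hfc3]
      have hfM : f ^ M = C (-f₄) * h ^ M := by
        have h1 : f₄ ^ M = -f₄ := by
          obtain ⟨m, rfl⟩ : ∃ m, M = m + 1 := ⟨M - 1, by omega⟩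
          rw [pow_succ, show m = m + 1 - 1 from rfl, hneg f₄ hinf h4]; ring
        have h3 : f = C f₄ * h := by
          rw [hh, ← mul_assoc, ← C_mul, mul_inv_cancel₀ h4, C_1, one_mul]
        conv_lhs => rw [h3, mul_pow, ← C_pow, h1]
      have hF' : F = C f₄ * X ^ (4 * M) + C e₃ * X ^ (4 * M - 1) + (C f₀ + C e₁ * X + C e₁ * X ^ q +
          C f₂ * X ^ (q + 1) + C e₃ * X ^ (q + 2)) := by
        have e1 : 4 * M = 2 * q + 2 := by omega
        have e2 : 4 * M - 1 = 2 * q + 1 := by omega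
        rw [hF, hT, e1, show 2 * q + 2 - 1 = 2 * q + 1 from rfl]; ring
      have hnumdeg : (F + f ^ M).natDegree ≤ 2 * q := by
        rw [natDegree_le_iff_coeff_eq_zero]
        intro N hN
        have hrest : (C f₀ + C e₁ * X + C e₁ * X ^ q +
            C f₂ * X ^ (q + 1) + C e₃ * X ^ (q + 2)).coeff N = 0 := by
          refine coeff_eq_zero_of_natDegree_lt (lt_of_le_of_lt (b := q + 2) ?_ (by omega))
          compute_degree
        rw [coeff_add, hF', coeff_add, coeff_add, hrest, hfM, coeff_C_mul, coeff_C_mul, coeff_C_mul,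
          coeff_X_pow, coeff_X_pow]
        have hMd : (h ^ M).natDegree = 4 * M := by rw [hhm.natDegree_pow, hhd, mul_comm]
        rcases lt_trichotomy N (4 * M) with hN' | rfl | hN'
        · obtain rfl : N = 4 * M - 1 := by omega
          have := hhm.coeff_pow_natDegree_mul_sub_one (by omega) (show M ≠ 0 by omega)
          rw [hhd] at this
          rw [this, show 4 - 1 = 3 from rfl, hh3, if_neg (by omega), if_pos rfl]
          field_simp
          linear_combination (-e₃) * hM2
        · have : (h ^ M).coeff (4 * M) = 1 := by rw [← hMd]; exact (hhm.pow M).leadingCoeff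
          rw [this, if_pos rfl, if_neg (by omega)]; ring
        · rw [coeff_eq_zero_of_natDegree_lt (hMd.symm ▸ hN'), if_neg (by omega), if_neg (by omega)]
          ring
      refine natDegree_mul_le.trans ((Nat.add_le_add hfdeg hnumdeg).trans ?_)
      omega
  -- These are the coefficients of 1, T, T² after division by (T − X)². The equation squared is (U(T
  -- − X)² − fF)² = f³f(T), by 2M = q + 1 and f^q = f(T), and F² − f(X)f(T) is itself divisible by
  -- (T − X)².
  set w₀ : κ[X] := U ^ 2 * X ^ 2 - 2 * U * f * (C f₀ + C e₁ * X) +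
    f ^ 2 * (C (e₁ ^ 2 - f₀ * f₂) - C (2 * f₀ * e₃) * X - C (f₀ * f₄) * X ^ 2) with hw₀
  set w₁ : κ[X] := -(2 * U ^ 2 * X) - 2 * U * f * (C e₁ + C f₂ * X + C e₃ * X ^ 2) +
    f ^ 2 * (-C (2 * f₀ * e₃) - C (2 * f₀ * f₄ + 2 * e₁ * e₃) * X - C (2 * e₁ * f₄) * X ^ 2) with hw₁
  set w₂ : κ[X] := U ^ 2 - 2 * U * f * (C e₃ * X + C f₄ * X ^ 2) +
    f ^ 2 * (-C (f₀ * f₄) - C (2 * e₁ * f₄) * X + C (e₃ ^ 2 - f₂ * f₄) * X ^ 2) with hw₂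
  have hW : w₀ + w₁ * T + w₂ * T ^ 2 = 0 := by
    have hne : (T - X) ^ 2 ≠ 0 :=
      pow_ne_zero 2 (FiniteField.X_pow_card_sub_X_ne_zero κ (Fintype.one_lt_card (α := κ)))
    refine (mul_eq_zero.mp (?_ : (T - X) ^ 2 * _ = 0)).resolve_left hne
    have hfM : f ^ M * f ^ M = f * f ^ q := by rw [← pow_add, ← pow_succ', hM]; ring
    have hsq : (U * (T - X) ^ 2 - f * F) ^ 2 = f ^ 3 * f ^ q := by
      rw [← hU]
      linear_combination f ^ 2 * hfM
    rw [hfq] at hsq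
    have : (T - X) ^ 2 * (w₀ + w₁ * T + w₂ * T ^ 2) = (U * (T - X) ^ 2 - f * F) ^ 2 -
        f ^ 2 * (C f₀ + C (2 * e₁) * X + C f₂ * X ^ 2 + C (2 * e₃) * X ^ 3 + C f₄ * X ^ 4) *
        (C f₀ + C (2 * e₁) * T + C f₂ * T ^ 2 + C (2 * e₃) * T ^ 3 + C f₄ * T ^ 4) := by
      rw [hw₀, hw₁, hw₂, hF]
      simp only [C_mul, C_sub, C_add, C_pow, C_ofNat]
      clear_value f T
      ring
    rw [this, hsq]
    rw [← hfdef]; ring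
  have hUf : (U ^ 2).natDegree ≤ 8 := natDegree_pow_le.trans (by omega)
  have hff : (f ^ 2).natDegree ≤ 8 := natDegree_pow_le.trans (by omega)
  -- All bounds on `w₀` and `w₁` are 10: degree 8 from U² or f², and 2 from the explicit factor.
  -- This is the source of the condition q ≥ 11.
  obtain ⟨z₀, z₂⟩ := eq_zero_of_add_mul_X_pow (q := q) (w₀ := w₀) (w₁ := w₁) (w₂ := w₂)
    (lt_of_le_of_lt (b := 10) (by rw [hw₀]; compute_degree; omega) (by omega))
    (lt_of_le_of_lt (b := 10) (by rw [hw₁]; compute_degree; omega) (by omega)) hW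
  have hf0 : eval 0 f = f₀ := by rw [hfe]; ring
  -- At 0 the two relations read 2U(0) = `e₁ ^ 2 - f₀ * f₂` and U(0)² = `f₀ ^ 3 * f₄`; eliminating
  -- U(0) gives the claim.
  have e0 := congrArg (eval 0) z₀
  have e2 := congrArg (eval 0) z₂
  simp [hw₀, hf0] at e0
  simp [hw₂, hf0] at e2
  have hS : e₁ ^ 2 - f₀ * f₂ = 2 * eval 0 U :=
    mul_left_cancel₀ (pow_ne_zero 2 h0) (by linear_combination e0)
  rw [hS]
  linear_combination (-4 : κ) * e2

end Polynomial
end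

/-! ### The analogue in characteristic two: Artin–Schreier sums. -/

noncomputable section
namespace Polynomial

variable {κ : Type*} [Field κ]

/-- Formally the sum is B^q times the partial trace d + d² + d⁴ + ⋯ of d = D/B². Squaring shifts the
terms, so all but the first and the last cancel. -/
theorem artinSchreier_sum_sq {R : Type*} [CommRing R] [CharP R 2] (B D : R) {q k : ℕ}
    (hk : 2 ^ k ≤ q) :
    (∑ j ∈ Finset.range k, D ^ 2 ^ j * B ^ (q - 2 ^ (j + 1))) ^ 2 +
      B ^ q * ∑ j ∈ Finset.range k, D ^ 2 ^ j * B ^ (q - 2 ^ (j + 1)) =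
      B ^ (2 * q - 2) * D + D ^ 2 ^ k * B ^ (2 * q - 2 ^ (k + 1)) := by
  have h2 : (2 : R) = 0 := CharTwo.two_eq_zero
  induction k with
  | zero => simp; linear_combination (-B ^ (2 * q - 2) * D) * h2
  | succ k ih =>
    have hk' : 2 ^ (k + 1) = 2 * 2 ^ k := pow_succ' 2 k
    have hk'' : 2 ^ (k + 1 + 1) = 2 * 2 ^ (k + 1) := pow_succ' 2 (k + 1)
    have ih := ih (by omega)
    rw [Finset.sum_range_succ]
    have e1 : (D ^ 2 ^ k * B ^ (q - 2 ^ (k + 1))) ^ 2 =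
        D ^ 2 ^ (k + 1) * B ^ (2 * q - 2 ^ (k + 1 + 1)) := by
      rw [mul_pow, ← pow_mul, ← pow_mul, hk'', hk']
      congr 2; omega
    have e2 : B ^ q * (D ^ 2 ^ k * B ^ (q - 2 ^ (k + 1))) = D ^ 2 ^ k * B ^ (2 * q - 2 ^ (k + 1)) := by
      rw [mul_left_comm, ← pow_add]
      congr 2
      omega
    linear_combination ih + e1 + e2 + (D ^ 2 ^ k * B ^ (2 * q - 2 ^ (k + 1)) +
      (∑ j ∈ Finset.range k, D ^ 2 ^ j * B ^ (q - 2 ^ (j + 1))) *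
        (D ^ 2 ^ k * B ^ (q - 2 ^ (k + 1)))) * h2

/-- A root y makes D/B² equal to z² + z with z = y/B, so its partial trace telescopes. For `2 ^ k =
q` over the field with q elements the result is y + y = 0 where B is nonzero. -/
theorem artinSchreier_sum_of_root {R : Type*} [CommRing R] [CharP R 2] {B D y : R}
    (hy : y ^ 2 + B * y + D = 0) {q k : ℕ} (hk : 2 ^ k ≤ q) :
    ∑ j ∈ Finset.range k, D ^ 2 ^ j * B ^ (q - 2 ^ (j + 1)) =
      y ^ 2 ^ k * B ^ (q - 2 ^ k) + y * B ^ (q - 1) := by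
  have h2 : (2 : R) = 0 := CharTwo.two_eq_zero
  have hD : D = y ^ 2 + B * y := by linear_combination hy - (y ^ 2 + B * y) * h2
  induction k with
  | zero => simp; linear_combination (-y * B ^ (q - 1)) * h2
  | succ k ih =>
    have hk' : 2 ^ (k + 1) = 2 * 2 ^ k := pow_succ' 2 k
    rw [Finset.sum_range_succ, ih (by omega)]
    have : D ^ 2 ^ k = y ^ 2 ^ (k + 1) + B ^ 2 ^ k * y ^ 2 ^ k := by
      rw [hD, add_pow_char_pow, mul_pow, ← pow_mul, hk']
    have e : B ^ 2 ^ k * B ^ (q - 2 ^ (k + 1)) = B ^ (q - 2 ^ k) := by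
      rw [← pow_add]
      congr 1
      omega
    rw [this]
    linear_combination y ^ 2 ^ k * e + (y ^ 2 ^ k * B ^ (q - 2 ^ k)) * h2

/-- Substituting (X + T)(d₁ + d₃XT) into the quadratic equation of the trace sum leaves an error
divisible by (T − X)²; the identity displays the quotient as a polynomial in T of degree two. -/
theorem artinSchreier_biquadratic {R : Type*} [CommRing R] [CharP R 2] (X T b₀ b₁ b₂ d₀ d₁ d₂ d₃ d₄ : R) : (T - X) ^ 2 * ((d₁ * b₀ * (b₁ + b₂ * X) +
    b₀ ^ 2 * (d₂ + d₃ * X + d₄ * X ^ 2) + b₁ ^ 2 * d₀ + b₂ ^ 2 * d₀ * X ^ 2 +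
    d₁ ^ 2) + (d₁ * b₂ * (b₀ + b₁ * X) +
    d₃ * b₀ * X * (b₁ + b₂ * X) + b₀ ^ 2 * d₃ + b₂ ^ 2 * d₁ * X ^ 2) * T + (d₃ * b₂ * X * (b₀ + b₁ * X) +
    b₀ ^ 2 * d₄ + b₁ ^ 2 * d₄ * X ^ 2 + b₂ ^ 2 * (d₀ + d₁ * X + d₂ * X ^ 2) +
    d₃ ^ 2 * X ^ 2) * T ^ 2) - (((X + T) * (d₁ + d₃ * (X * T))) ^ 2 - (b₀ + b₁ * X + b₂ * X ^ 2) * (b₀ + b₁ * T + b₂ * T ^ 2) *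
     ((X + T) * (d₁ + d₃ * (X * T))) - ((b₀ + b₁ * T + b₂ * T ^ 2) ^ 2 * (d₀ + d₁ * X + d₂ * X ^ 2 + d₃ * X ^ 3 + d₄ * X ^ 4)
     + (b₀ + b₁ * X + b₂ * X ^ 2) ^ 2 * (d₀ + d₁ * T + d₂ * T ^ 2 + d₃ * T ^ 3 + d₄ * T ^ 4))) = 0 := by
  have h2 : (2 : R) = 0 := CharTwo.two_eq_zero
  have h4 : (4 : R) = 0 := by linear_combination (2 : R) * h2
  ring_nf
  simp only [h2, h4, mul_zero, sub_zero, add_zero]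

/-- Every exponent in the sum is even except that of D in the term j = 0. -/
theorem derivative_artinSchreier_sum [CharP κ 2] (B D : κ[X]) {q m : ℕ} (hm : m ≠ 0)
    (hq : q = 2 ^ m) :
    derivative (∑ j ∈ Finset.range m, D ^ 2 ^ j * B ^ (q - 2 ^ (j + 1))) =
      derivative D * B ^ (q - 2) := by
  obtain ⟨m, rfl⟩ := Nat.exists_eq_succ_of_ne_zero hm
  have hodd : ∀ (p : κ[X]) (e : ℕ), 2 ∣ e → derivative (p ^ e) = 0 := fun p e he => by
    rw [derivative_pow, (CharP.cast_eq_zero_iff κ 2 e).mpr he, C_0, zero_mul, zero_mul]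
  have he : ∀ j, j < m + 1 → 2 ∣ q - 2 ^ (j + 1) := fun j hj => by
    rw [hq]
    exact Nat.dvd_sub (dvd_pow_self 2 (Nat.succ_ne_zero m)) (dvd_pow_self 2 (Nat.succ_ne_zero j))
  rw [derivative_sum, Finset.sum_range_succ', Finset.sum_eq_zero]
  · rw [pow_zero, pow_one, derivative_mul, hodd _ _ (he 0 (Nat.succ_pos m))]
    simp
  · intro j hj
    rw [Finset.mem_range] at hj
    rw [derivative_mul, hodd _ _ (he (j + 1) (by omega)), hodd _ _ (dvd_pow_self 2 (Nat.succ_ne_zero j))]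
    simp

variable [Fintype κ]

/-- If `y ^ 2 + B y + D` has a root at every point of a finite field of characteristic two with more
than ten elements, where `B` and `D` have degrees two and four, then `D` differs from
a constant multiple of `B ^ 2` by a polynomial `h ^ 2 + B h`. -/
theorem quartic_eq_of_root_values [CharP κ 2] (hq : 11 ≤ Fintype.card κ)
    {b₀ b₁ b₂ d₀ d₁ d₂ d₃ d₄ r : κ} (hb : b₀ ≠ 0)
    (hroot : ∀ t : κ, ∃ y : κ, y ^ 2 + (b₀ + b₁ * t + b₂ * t ^ 2) * y +
      (d₀ + d₁ * t + d₂ * t ^ 2 + d₃ * t ^ 3 + d₄ * t ^ 4) = 0)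
    (hr : r = b₀ * b₁ * d₁ + b₀ ^ 2 * d₂ + b₁ ^ 2 * d₀ + d₁ ^ 2) :
    b₀ ^ 6 * d₄ = r ^ 2 + b₀ ^ 3 * b₂ * r + b₀ ^ 4 * b₂ ^ 2 * d₀ := by
  classical
  set q := Fintype.card κ with hqdef
  have h2 : (2 : κ) = 0 := CharTwo.two_eq_zero
  have h2X : (2 : κ[X]) = 0 := CharTwo.two_eq_zero
  have hq0 : (q : κ) = 0 := Nat.cast_card_eq_zero κ
  obtain ⟨m, hm⟩ : ∃ m : ℕ, q = 2 ^ m := by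
    obtain ⟨m, -, hm⟩ := FiniteField.card κ 2
    exact ⟨m, hm⟩
  have hm0 : m ≠ 0 := by rintro rfl; omega
  set B : κ[X] := C b₀ + C b₁ * X + C b₂ * X ^ 2 with hB
  set D : κ[X] := C d₀ + C d₁ * X + C d₂ * X ^ 2 + C d₃ * X ^ 3 + C d₄ * X ^ 4 with hD
  set T : κ[X] := X ^ q with hT
  -- The correction term: it vanishes on the diagonal T = X, and its X-derivative there is D′. As BS
  -- has derivative D′ where B is nonzero, BS + G vanishes to order two at those points.
  set G : κ[X] := (X + T) * (C d₁ + C d₃ * (X * T)) with hG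
  set S : κ[X] := ∑ j ∈ Finset.range m, D ^ 2 ^ j * B ^ (q - 2 ^ (j + 1)) with hS
  have hTe : ∀ a, eval a T = a := fun a => by rw [hT, eval_pow, eval_X, FiniteField.pow_card]
  have hTd : derivative T = 0 := by rw [hT, derivative_X_pow, hq0, C_0, zero_mul]
  have hBq : B ^ q = C b₀ + C b₁ * T + C b₂ * T ^ 2 := by
    rw [hqdef, ← FiniteField.expand_card B, hB, hT, hqdef]
    simp
  have hDq : D ^ q = C d₀ + C d₁ * T + C d₂ * T ^ 2 + C d₃ * T ^ 3 + C d₄ * T ^ 4 := by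
    rw [hqdef, ← FiniteField.expand_card D, hD, hT, hqdef]
    simp
  have hGe : ∀ a, eval a G = 0 := fun a => by
    rw [hG, eval_mul, eval_add, eval_X, hTe]
    linear_combination a * eval a (C d₁ + C d₃ * (X * T)) * h2
  have hSe : ∀ a, eval a B ≠ 0 → eval a S = 0 := fun a ha => by
    obtain ⟨y, hy⟩ := hroot a
    have h3 : y ^ 2 + eval a B * y + eval a D = 0 := by rw [← hy]; simp [hB, hD]
    have h4 := artinSchreier_sum_of_root h3 hm.ge
    have h5 : eval a S = ∑ j ∈ Finset.range m, eval a D ^ 2 ^ j * eval a B ^ (q - 2 ^ (j + 1)) := by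
      simp [hS, eval_finsetSum]
    rw [h5, h4, ← hm, Nat.sub_self, pow_zero, FiniteField.pow_card, FiniteField.pow_card_sub_one_eq_one _ ha]
    linear_combination y * h2
  have hdvd : (X ^ q - X) ^ 2 ∣ B * (B * S + G) := by
    have hnum : ∀ a, eval a (B * S + G) = 0 := fun a => by
      rw [eval_add, eval_mul, hGe, add_zero]
      by_cases ha : eval a B = 0
      · rw [ha, zero_mul]
      · rw [hSe a ha, mul_zero]
    refine X_pow_card_sub_X_sq_dvd (fun a => by rw [eval_mul, hnum, mul_zero]) fun a => ?_
    rw [derivative_mul, eval_add, eval_mul, eval_mul, hnum, mul_zero, zero_add]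
    by_cases ha : eval a B = 0
    · rw [ha, zero_mul]
    · have hBp : eval a B * eval a B ^ (q - 2) = 1 := by
        rw [← pow_succ', show q - 2 + 1 = q - 1 by omega,
          FiniteField.pow_card_sub_one_eq_one _ ha]
      have e1 : eval a (derivative D) = d₁ + 2 * d₂ * a + 3 * d₃ * a ^ 2 + 4 * d₄ * a ^ 3 := by
        simp [hD]; ring
      have e2 : eval a (derivative G) = d₁ + 3 * d₃ * a ^ 2 := by
        simp [hG, hTd, hTe]; ring
      have : eval a (derivative (B * S + G)) = 0 := by
        rw [derivative_add, derivative_mul, eval_add, eval_add, eval_mul, eval_mul, hSe a ha,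
          hS, derivative_artinSchreier_sum B D hm0 hm, eval_mul, eval_pow, e1, e2]
        linear_combination (d₁ + 2 * d₂ * a + 3 * d₃ * a ^ 2 + 4 * d₄ * a ^ 3) * hBp +
          (d₁ + d₂ * a + 3 * d₃ * a ^ 2 + 2 * d₄ * a ^ 3) * h2
      rw [this, mul_zero]
  obtain ⟨U, hU⟩ := hdvd
  replace hU : B * (B * S + G) = U * (X ^ q - X) ^ 2 := hU.trans (mul_comm _ _)
  have hBdeg : B.natDegree ≤ 2 := by rw [hB]; compute_degree
  have hDdeg : D.natDegree ≤ 4 := by rw [hD]; compute_degree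
  have hGdeg : G.natDegree ≤ 2 * q + 1 := by
    rw [hG, hT]; compute_degree; omega
  -- The degrees of D and B are in the ratio 2 : 1, so each summand satisfies the same bound 4·2^j +
  -- 2(q − 2^(j+1)) = 2q.
  have hSdeg : S.natDegree ≤ 2 * q := by
    refine natDegree_sum_le_of_forall_le _ _ fun j hj => ?_
    have hle : 2 ^ (j + 1) ≤ q := by
      rw [hm]; exact Nat.pow_le_pow_right two_pos (Finset.mem_range.mp hj)
    refine natDegree_mul_le.trans ((Nat.add_le_add
      (natDegree_pow_le.trans (Nat.mul_le_mul_left _ hDdeg))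
      (natDegree_pow_le.trans (Nat.mul_le_mul_left _ hBdeg))).trans ?_)
    rw [pow_succ] at hle ⊢
    omega
  have hUdeg : U.natDegree ≤ 4 := by
    refine natDegree_quotient_le hU ?_
    refine natDegree_mul_le.trans ((Nat.add_le_add hBdeg ((natDegree_add_le _ _).trans (max_le
      (natDegree_mul_le.trans (Nat.add_le_add hBdeg hSdeg)) (hGdeg.trans ?_)))).trans ?_) <;> omega
  set w₀ : κ[X] := U ^ 2 * X ^ 2 + B ^ 2 * U * C b₀ + B ^ 2 * (C d₁ * C b₀ * (C b₁ + C b₂ * X) +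
    C b₀ ^ 2 * (C d₂ + C d₃ * X + C d₄ * X ^ 2) + C b₁ ^ 2 * C d₀ + C b₂ ^ 2 * C d₀ * X ^ 2 +
    C d₁ ^ 2) with hw₀
  set w₁ : κ[X] := B ^ 2 * U * C b₁ + B ^ 2 * (C d₁ * C b₂ * (C b₀ + C b₁ * X) +
    C d₃ * C b₀ * X * (C b₁ + C b₂ * X) + C b₀ ^ 2 * C d₃ + C b₂ ^ 2 * C d₁ * X ^ 2) with hw₁
  set w₂ : κ[X] := U ^ 2 + B ^ 2 * U * C b₂ + B ^ 2 * (C d₃ * C b₂ * X * (C b₀ + C b₁ * X) +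
    C b₀ ^ 2 * C d₄ + C b₁ ^ 2 * C d₄ * X ^ 2 + C b₂ ^ 2 * (C d₀ + C d₁ * X + C d₂ * X ^ 2) +
    C d₃ ^ 2 * X ^ 2) with hw₂
  have hW : w₀ + w₁ * T + w₂ * T ^ 2 = 0 := by
    have hne : (T - X) ^ 2 ≠ 0 :=
      pow_ne_zero 2 (FiniteField.X_pow_card_sub_X_ne_zero κ (Fintype.one_lt_card (α := κ)))
    refine (mul_eq_zero.mp (?_ : (T - X) ^ 2 * _ = 0)).resolve_left hne
    have hsq : S ^ 2 + B ^ q * S = B ^ (2 * q - 2) * D + D ^ q := by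
      have := artinSchreier_sum_sq B D hm.ge
      have e : 2 ^ (m + 1) = 2 * q := by rw [pow_succ, ← hm, mul_comm]
      rwa [e, ← hm, Nat.sub_self, pow_zero, mul_one] at this
    have hB2 : B ^ 2 * B ^ (2 * q - 2) = (B ^ q) ^ 2 := by
      rw [← pow_add, ← pow_mul]; congr 1; omega
    -- By the divisibility, the first bracket is B²S up to sign, and signs do not matter in
    -- characteristic two. The equation of S is multiplied by B⁴ so that only B^q and D^q,
    -- polynomials in T, remain.
    have hmain : (U * (T - X) ^ 2 - B * G) ^ 2 + B ^ 2 * B ^ q * (U * (T - X) ^ 2 - B * G) -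
        B ^ 2 * ((B ^ q) ^ 2 * D + B ^ 2 * D ^ q) = 0 := by
      rw [← hU]
      linear_combination B ^ 4 * hsq + B ^ 2 * D * hB2
    rw [hBq, hDq] at hmain
    have key := artinSchreier_biquadratic X T (C b₀) (C b₁) (C b₂) (C d₀) (C d₁) (C d₂) (C d₃) (C d₄)
    rw [← hB, ← hD, ← hG] at key
    rw [← hmain, hw₀, hw₁, hw₂]
    linear_combination B ^ 2 * key + U * (T - X) ^ 2 * B * G * h2X +
      X * T * U ^ 2 * (T - X) ^ 2 * h2X
  have hUf : (U ^ 2).natDegree ≤ 8 := natDegree_pow_le.trans (by omega)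
  have hff : (B ^ 2).natDegree ≤ 4 := natDegree_pow_le.trans (by omega)
  obtain ⟨z₀, z₂⟩ := eq_zero_of_add_mul_X_pow (q := q) (w₀ := w₀) (w₁ := w₁) (w₂ := w₂)
    (lt_of_le_of_lt (b := 10) (by rw [hw₀]; compute_degree; omega) (by omega))
    (lt_of_le_of_lt (b := 10) (by rw [hw₁]; compute_degree; omega) (by omega)) hW
  have hB0 : eval 0 B = b₀ := by simp [hB]
  -- At 0 the first relation gives b₀U(0) = r, and the second becomes the claim after substituting
  -- this.
  have e0 := congrArg (eval 0) z₀
  have e2 := congrArg (eval 0) z₂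
  simp [hw₀, hB0] at e0
  simp [hw₂, hB0] at e2
  have hu : b₀ * eval 0 U = r := by
    refine mul_left_cancel₀ (pow_ne_zero 2 hb) ?_
    linear_combination e0 + b₀ ^ 2 * hr - b₀ ^ 2 * r * h2
  rw [← hu]
  linear_combination (-b₀ ^ 2) * e2 + b₀ ^ 6 * d₄ * h2

end Polynomial
end

/-! ### From binary quartics to quartic forms in several variables. -/

noncomputable section
open MvPolynomial

section Expansion

variable {ι R : Type*} [CommRing R]

/-- Induction on homogeneous polynomials. -/
theorem MvPolynomial.IsHomogeneous.induction {P : ℕ → MvPolynomial ι R → Prop}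
    (h0 : ∀ m, P m 0) (hC : ∀ a, P 0 (C a)) (hadd : ∀ m p q, P m p → P m q → P m (p + q))
    (hX : ∀ m i p, P m p → P (m + 1) (X i * p)) {m : ℕ} {F : MvPolynomial ι R}
    (hF : F.IsHomogeneous m) : P m F := by
  rw [F.as_sum]
  refine Finset.sum_induction _ (P m) (fun p q => hadd m p q) (h0 m) fun d hd => ?_
  have hdeg := hF.degree_of_mem_support hd
  generalize coeff d F = a
  clear hd hF
  induction m generalizing d with
  | zero =>
    rw [Finsupp.degree_eq_zero_iff] at hdeg
    subst hdeg
    exact hC a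
  | succ m ih =>
    obtain ⟨i, e, rfl, he⟩ := Finsupp.exists_eq_single_add hdeg
    have : monomial (Finsupp.single i 1 + e) a = (X i * monomial e a : MvPolynomial ι R) := by
      simp [X, monomial_mul]
    rw [this]
    exact hX m i _ (ih e he)

/-- The expansion of a form at a point. -/
theorem MvPolynomial.IsHomogeneous.exists_expansion {m : ℕ} {p : MvPolynomial ι R}
    (hp : p.IsHomogeneous m) (s : ι → R) :
    ∃ f : ℕ → MvPolynomial ι R, (∀ i, (f i).IsHomogeneous i) ∧ f 0 = C (eval s p) ∧ f m = p ∧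
      ∀ (c : R) (z : ι → R), eval (s + c • z) p =
        ∑ i ∈ Finset.range (m + 1), c ^ i * eval z (f i) := by
  -- Vanishing of the components beyond the degree is added so that the induction can multiply by a
  -- variable without a boundary case.
  suffices h : ∃ f : ℕ → MvPolynomial ι R, (∀ i, (f i).IsHomogeneous i) ∧ f 0 = C (eval s p) ∧
      f m = p ∧ (∀ i, m < i → f i = 0) ∧ ∀ (c : R) (z : ι → R), eval (s + c • z) p =
        ∑ i ∈ Finset.range (m + 1), c ^ i * eval z (f i) by
    obtain ⟨f, h1, h2, h3, -, h4⟩ := h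
    exact ⟨f, h1, h2, h3, h4⟩
  refine hp.induction (P := fun m p => ∃ f : ℕ → MvPolynomial ι R, (∀ i, (f i).IsHomogeneous i) ∧
    f 0 = C (eval s p) ∧ f m = p ∧ (∀ i, m < i → f i = 0) ∧ ∀ (c : R) (z : ι → R),
      eval (s + c • z) p = ∑ i ∈ Finset.range (m + 1), c ^ i * eval z (f i)) ?_ ?_ ?_ ?_
  · exact fun m => ⟨0, fun i => isHomogeneous_zero _ _ _, by simp, rfl, fun _ _ => rfl, by simp⟩
  · refine fun a => ⟨fun i => if i = 0 then C a else 0, fun i => ?_, by simp, by simp, ?_, ?_⟩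
    · dsimp only
      split_ifs with h
      · subst h; exact isHomogeneous_C _ _
      · exact isHomogeneous_zero _ _ _
    · intro i hi
      exact if_neg hi.ne'
    · simp
  · rintro m p q ⟨f, f1, f2, f3, f4, f5⟩ ⟨g, g1, g2, g3, g4, g5⟩
    refine ⟨f + g, fun i => (f1 i).add (g1 i), by simp [f2, g2], by simp [f3, g3], ?_, ?_⟩
    · intro i hi
      simp [f4 i hi, g4 i hi]
    · intro c z
      rw [map_add, f5, g5, ← Finset.sum_add_distrib]
      exact Finset.sum_congr rfl fun i _ => by simp [mul_add]
  · rintro m j p ⟨f, f1, f2, f3, f4, f5⟩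
    refine ⟨fun i => Nat.casesOn i (C (s j) * f 0) fun i => C (s j) * f (i + 1) + X j * f i,
      fun i => ?_, by simp [f2], ?_, ?_, ?_⟩
    · cases i with
      | zero => exact (f1 0).C_mul _
      | succ i =>
        refine IsHomogeneous.add ?_ ?_
        · exact (f1 (i + 1)).C_mul _
        · simpa [add_comm] using (isHomogeneous_X R j).mul (f1 i)
    · simp [f3, f4 (m + 1) (Nat.lt_succ_self m)]
    · intro i hi
      cases i with
      | zero => omega
      | succ i => simp [f4 i (by omega), f4 (i + 1) (by omega)]
    · intro c z
      have e1 : ∑ i ∈ Finset.range (m + 1), c ^ (i + 1) * eval z (f (i + 1)) + eval z (f 0) =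
          eval (s + c • z) p := by
        have := Finset.sum_range_succ' (fun i => c ^ i * eval z (f i)) (m + 1)
        rw [Finset.sum_range_succ, f4 (m + 1) (Nat.lt_succ_self m), map_zero, mul_zero, add_zero,
          ← f5, pow_zero, one_mul] at this
        exact this.symm
      rw [map_mul, eval_X, Finset.sum_range_succ']
      simp only [map_add, map_mul, eval_C, eval_X, mul_add, Finset.sum_add_distrib]
      have e2 : ∑ i ∈ Finset.range (m + 1), c ^ (i + 1) * (s j * eval z (f (i + 1))) =
          s j * ∑ i ∈ Finset.range (m + 1), c ^ (i + 1) * eval z (f (i + 1)) := by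
        rw [Finset.mul_sum]; exact Finset.sum_congr rfl fun i _ => by ring
      have e3 : ∑ i ∈ Finset.range (m + 1), c ^ (i + 1) * (z j * eval z (f i)) =
          c * z j * ∑ i ∈ Finset.range (m + 1), c ^ i * eval z (f i) := by
        rw [Finset.mul_sum]; exact Finset.sum_congr rfl fun i _ => by ring
      rw [e2, e3, ← f5, Pi.add_apply, Pi.smul_apply, smul_eq_mul]
      have e4 : eval z (Nat.casesOn (motive := fun _ => MvPolynomial ι R) 0 (C (s j) * f 0)
          fun i => C (s j) * f (i + 1) + X j * f i) = s j * eval z (f 0) := by simp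
      rw [e4]
      linear_combination (-s j) * e1

end Expansion

section FiniteField

variable {κ : Type*} [Field κ] [Fintype κ]

/-- A quartic form over a finite field with more than ten elements of odd order that takes no
nonzero square value is a constant multiple of a square. -/
theorem quarticForm_eq_square {m : ℕ} (hq : 11 ≤ Fintype.card κ) (h2 : (2 : κ) ≠ 0)
    {p : MvPolynomial (Fin m) κ} (hp : p.IsHomogeneous 4)
    (h : ∀ t, ∀ y : κ, y ≠ 0 → eval t p ≠ y ^ 2) :
    ∃ (e : κ) (S : MvPolynomial (Fin m) κ), S.IsHomogeneous 2 ∧ p = C e * S ^ 2 := by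
  by_cases h0 : ∀ t, eval t p = 0
  · have : p = 0 := eq_zero_of_totalDegree_lt_card
      (lt_of_le_of_lt hp.totalDegree_le (by omega)) h0
    exact ⟨0, 0, isHomogeneous_zero _ _ _, by simp [this]⟩
  push Not at h0
  obtain ⟨s, hs⟩ := h0
  obtain ⟨f, f1, f2, f3, f4⟩ := hp.exists_expansion s
  -- On the line s + cz the form is a quartic in c with constant term p(s), linear term f₁(z),
  -- quadratic term f₂(z) and leading term p(z). The binary result then expresses p(z) by the square
  -- of this S; equality at all z is equality of forms because 4 < q.
  set S : MvPolynomial (Fin m) κ := C (4⁻¹) * f 1 ^ 2 - C (eval s p) * f 2 with hS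
  have h4 : (4 : κ) ≠ 0 := by
    rw [show (4 : κ) = 2 * 2 by norm_num]; exact mul_ne_zero h2 h2
  have hSh : S.IsHomogeneous 2 := by
    refine IsHomogeneous.sub ?_ ?_
    · exact ((f1 1).pow 2).C_mul _
    · exact (f1 2).C_mul _
  have key : C (4 * eval s p ^ 3) * p - S ^ 2 = 0 := by
    refine eq_zero_of_totalDegree_lt_card (lt_of_le_of_lt (b := 4) ?_ (by omega)) fun z => ?_
    · refine IsHomogeneous.totalDegree_le (IsHomogeneous.sub ?_ ?_)
      · exact hp.C_mul _
      · exact hSh.pow 2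
    · have hval : ∀ c : κ, eval (s + c • z) p = eval s p + 2 * (eval z (f 1) / 2) * c +
          eval z (f 2) * c ^ 2 + 2 * (eval z (f 3) / 2) * c ^ 3 + eval z p * c ^ 4 := fun c => by
        rw [f4, Finset.sum_range_succ, Finset.sum_range_succ, Finset.sum_range_succ,
          Finset.sum_range_succ, Finset.sum_range_succ, f2, f3]
        simp only [Finset.range_zero, Finset.sum_empty, eval_C]
        field_simp
        ring
      have := Polynomial.quartic_eq_square_of_no_square_value hq h2 hs
        (fun c y hy => by rw [← hval]; exact h _ y hy) (h z)
      simp only [hS, map_sub, map_mul, map_pow, eval_C]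
      rw [sub_eq_zero]
      rw [this]
      congr 2
      rw [div_pow, show (2 : κ) ^ 2 = 4 by norm_num]; field_simp
  have hne : 4 * eval s p ^ 3 ≠ 0 := mul_ne_zero h4 (pow_ne_zero 3 hs)
  refine ⟨(4 * eval s p ^ 3)⁻¹, S, hSh, ?_⟩
  rw [← sub_eq_zero.mp key, ← mul_assoc, ← C_mul, inv_mul_cancel₀ hne, C_1, one_mul]

/-- If `y ^ 2 + B y + D` has a root at every point of a finite field of characteristic two with more
than ten elements, for a nonzero quadratic form `B` and a quartic form `D`, then `D` differs from
a constant multiple of `B ^ 2` by a form `h ^ 2 + B h`. -/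
theorem quarticForm_eq_of_root_values [CharP κ 2] {m : ℕ} (hq : 11 ≤ Fintype.card κ)
    {B D : MvPolynomial (Fin m) κ} (hB : B.IsHomogeneous 2) (hD : D.IsHomogeneous 4) (hB0 : B ≠ 0)
    (h : ∀ t, ∃ y : κ, y ^ 2 + eval t B * y + eval t D = 0) :
    ∃ (e : κ) (g : MvPolynomial (Fin m) κ), g.IsHomogeneous 2 ∧
      D = g ^ 2 + B * g + C e * B ^ 2 := by
  obtain ⟨s, hs⟩ : ∃ s, eval s B ≠ 0 := by
    by_contra! h0
    exact hB0 (eq_zero_of_totalDegree_lt_card (lt_of_le_of_lt hB.totalDegree_le (by omega)) h0)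
  obtain ⟨f, f1, f2, f3, f4⟩ := hB.exists_expansion s
  obtain ⟨g, g1, g2, g3, g4⟩ := hD.exists_expansion s
  -- This is the r of the binary result on the line s + cz, regarded as a quadratic form in z.
  set r : MvPolynomial (Fin m) κ := C (eval s B) * (f 1 * g 1) + C (eval s B ^ 2) * g 2 +
    C (eval s D) * f 1 ^ 2 + g 1 ^ 2 with hr
  have hrh : r.IsHomogeneous 2 := by
    refine ((IsHomogeneous.add ?_ ?_).add ?_).add ?_
    · exact ((f1 1).mul (g1 1)).C_mul _
    · exact (g1 2).C_mul _
    · exact ((f1 1).pow 2).C_mul _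
    · exact (g1 1).pow 2
  have key : C (eval s B ^ 6) * D - (r ^ 2 + C (eval s B ^ 3) * (B * r) +
      C (eval s B ^ 4 * eval s D) * B ^ 2) = 0 := by
    refine eq_zero_of_totalDegree_lt_card (lt_of_le_of_lt (b := 4) ?_ (by omega)) fun z => ?_
    · refine IsHomogeneous.totalDegree_le (IsHomogeneous.sub ?_ ((IsHomogeneous.add ?_ ?_).add ?_))
      · exact hD.C_mul _
      · exact hrh.pow 2
      · exact (hB.mul hrh).C_mul _
      · exact (hB.pow 2).C_mul _
    · have := Polynomial.quartic_eq_of_root_values hq (b₀ := eval s B) (b₁ := eval z (f 1))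
        (b₂ := eval z B) (d₀ := eval s D) (d₁ := eval z (g 1)) (d₂ := eval z (g 2))
        (d₃ := eval z (g 3)) (d₄ := eval z D) (r := eval z r) hs (fun c => ?_) ?_
      · simp only [map_sub, map_add, map_mul, map_pow, eval_C]
        linear_combination this
      · obtain ⟨y, hy⟩ := h (s + c • z)
        refine ⟨y, ?_⟩
        rw [← hy, f4, g4]
        simp only [Finset.sum_range_succ, Finset.range_zero, Finset.sum_empty, f2, f3, g2, g3,
          eval_C]
        ring
      · simp only [hr, map_add, map_mul, map_pow, eval_C]
        ring
  set b := eval s B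
  refine ⟨eval s D / b ^ 2, C (b⁻¹ ^ 3) * r, ?_, ?_⟩
  · exact hrh.C_mul _
  · have hb : (C (b⁻¹ ^ 6) : MvPolynomial (Fin m) κ) * C (b ^ 6) = 1 := by
      rw [← C_mul, ← mul_pow, inv_mul_cancel₀ hs, one_pow, C_1]
    have h3 : (C (b⁻¹ ^ 6) : MvPolynomial (Fin m) κ) * C (b ^ 3) = C (b⁻¹ ^ 3) := by
      rw [← C_mul]; congr 1; field_simp
    have h4 : (C (b⁻¹ ^ 6) : MvPolynomial (Fin m) κ) * C (b ^ 4 * eval s D) =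
        C (eval s D / b ^ 2) := by
      rw [← C_mul]; congr 1; field_simp
    have h6 : (C (b⁻¹ ^ 3) : MvPolynomial (Fin m) κ) ^ 2 = C (b⁻¹ ^ 6) := by
      rw [← C_pow, ← pow_mul]
    linear_combination C (b⁻¹ ^ 6) * key - D * hb + B * r * h3 + B ^ 2 * h4 - r ^ 2 * h6

end FiniteField
end

/-! ### Split and inert lines on smooth cubics over finite fields. -/

noncomputable section
open MvPolynomial

section Smooth

variable {κ : Type*} [Field κ] {n : ℕ} {G : MvPolynomial (Fin (n + 1)) κ}

theorem map_dirDeriv {ι R S : Type*} [CommRing R] [CommRing S] [Fintype ι] (φ : R →+* S) (s : ι → R)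
    (F : MvPolynomial ι R) : map φ (dirDeriv s F) = dirDeriv (fun i => φ (s i)) (map φ F) := by
  simp [dirDeriv, pderiv_map]

theorem map_tangentForm {ι R S : Type*} [CommRing R] [CommRing S] [Fintype ι] (φ : R →+* S)
    (s : ι → R) (F : MvPolynomial ι R) :
    map φ (tangentForm s F) = tangentForm (fun i => φ (s i)) (map φ F) := by
  simp only [tangentForm, map_sum, map_mul, map_C, map_X, map_eval' φ, pderiv_map]

theorem IsSmoothCubic.not_singular_map (hG : IsSmoothCubic G) :
    ¬ ∃ x : Fin (n + 1) → AlgebraicClosure κ, x ≠ 0 ∧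
      eval x (map (algebraMap κ (AlgebraicClosure κ)) G) = 0 ∧
      ∀ i, eval x (pderiv i (map (algebraMap κ (AlgebraicClosure κ)) G)) = 0 := by
  rintro ⟨x, hx, h0, h1⟩
  refine hG.nonsingular x hx ⟨?_, fun i => ?_⟩
  · rwa [eval_map] at h0
  · have := h1 i
    rwa [pderiv_map, eval_map] at this

/-- The discriminant of the projection of a smooth cubic hypersurface from one of its points is
not a square. -/
theorem IsSmoothCubic.not_factor (hG : IsSmoothCubic G) (hn : 2 ≤ n) {s : Fin (n + 1) → κ}
    (hs : s ≠ 0) (hs0 : eval s G = 0) {y₁ y₂ : MvPolynomial (Fin (n + 1)) (AlgebraicClosure κ)}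
    (h₁ : y₁.IsHomogeneous 2) (h₂ : y₂.IsHomogeneous 2)
    (hadd : y₁ + y₂ = -map (algebraMap κ (AlgebraicClosure κ)) (dirDeriv s G))
    (hmul : y₁ * y₂ = map (algebraMap κ (AlgebraicClosure κ)) (tangentForm s G * G)) : False := by
  refine hG.not_singular_map (exists_singular_of_factor hn
    (hG.homogeneous.map _) (s := fun i => algebraMap κ (AlgebraicClosure κ) (s i)) ?_ ?_ h₁ h₂ ?_ ?_)
  · contrapose! hs
    ext i
    simpa using congrFun hs i
  · rw [← map_eval', hs0, map_zero]
  · rw [hadd, map_dirDeriv]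
  · rw [hmul, map_mul, map_tangentForm]

/-- In characteristic two, no polar quadric of a smooth cubic hypersurface vanishes. -/
theorem IsSmoothCubic.dirDeriv_ne_zero (hG : IsSmoothCubic G) (h3 : (3 : κ) ≠ 0)
    {s : Fin (n + 1) → κ} (hs : s ≠ 0) : dirDeriv s G ≠ 0 := by
  intro h0
  obtain ⟨i₀, hi₀⟩ := Function.ne_iff.mp hs
  rw [Pi.zero_apply] at hi₀
  set L := AlgebraicClosure κ
  set G' := map (algebraMap κ L) G with hG'
  have hG'h : G'.IsHomogeneous 3 := hG.homogeneous.map _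
  -- The n partial derivatives other than the one at `i₀` have a common zero. There the vanishing of
  -- the derivative along s forces the last one to vanish, since s is nonzero at `i₀`; Euler's
  -- relation and 3 ≠ 0 then put the singular point on the cubic.
  obtain ⟨x, hx, hx0⟩ := exists_common_zero (fun i => pderiv (i₀.succAbove i) G') fun i => by
    have := (hG'h.pderiv (i := i₀.succAbove i)).coeff_eq_zero (d := 0) (by simp)
    rw [← constantCoeff_eq] at this
    rw [← this, eval_zero]
  have hpol := congrArg (fun p => eval x (map (algebraMap κ L) p)) h0
  simp only [map_dirDeriv, eval_dirDeriv, map_zero] at hpol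
  have hall : ∀ i, eval x (pderiv i G') = 0 := by
    intro i
    rcases eq_or_ne i i₀ with rfl | hi
    · rw [polar, Fin.sum_univ_succAbove _ i] at hpol
      rw [Finset.sum_eq_zero (fun j _ => by rw [hx0, mul_zero]), add_zero] at hpol
      exact (mul_eq_zero.mp hpol).resolve_left (by simpa using hi₀)
    · obtain ⟨j, rfl⟩ := Fin.exists_succAbove_eq hi
      exact hx0 j
  refine hG.not_singular_map ⟨x, hx, ?_, hall⟩
  have h3' : (3 : L) ≠ 0 := by
    rw [← map_ofNat (algebraMap κ L) 3]
    exact (map_ne_zero _).mpr h3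
  have := polar_self hG'h x
  rw [polar, Finset.sum_eq_zero (fun j _ => by rw [hall, mul_zero])] at this
  exact (mul_eq_zero.mp this.symm).resolve_left h3'

/-- With e = ρ² over the closure, (−B ± ρS)/2 would be roots of y² + By + AC that are forms, which
`not_factor` excludes. -/
theorem IsSmoothCubic.not_discriminant_eq (hG : IsSmoothCubic G) (hn : 2 ≤ n)
    {s : Fin (n + 1) → κ} (hs : s ≠ 0) (hs0 : eval s G = 0) (h2 : (2 : κ) ≠ 0) (e : κ)
    {S : MvPolynomial (Fin (n + 1)) κ} (hS : S.IsHomogeneous 2) :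
    dirDeriv s G ^ 2 - C 4 * (tangentForm s G * G) ≠ C e * S ^ 2 := by
  intro h
  set L := AlgebraicClosure κ
  obtain ⟨ρ, hρ⟩ := IsAlgClosed.exists_pow_nat_eq (algebraMap κ L e) (n := 2) two_pos
  have h2' : (2 : L) ≠ 0 := by
    rw [← map_ofNat (algebraMap κ L) 2]
    exact (map_ne_zero _).mpr h2
  set B := map (algebraMap κ L) (dirDeriv s G)
  have hB : B.IsHomogeneous 2 := (hG.homogeneous.dirDeriv s).map _
  have hS' := hS.map (algebraMap κ L)
  set S' := map (algebraMap κ L) S with hS'def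
  have hh : (C (2⁻¹ : L) : MvPolynomial (Fin (n + 1)) L) * 2 = 1 := by
    rw [← map_ofNat C 2, ← C_mul, inv_mul_cancel₀ h2', C_1]
  refine hG.not_factor hn hs hs0 (y₁ := C 2⁻¹ * (C ρ * S' - B)) (y₂ := C 2⁻¹ * (-B - C ρ * S'))
    (((hS'.C_mul ρ).sub hB).C_mul _) ((hB.neg.sub (hS'.C_mul ρ)).C_mul _) ?_ ?_
  · linear_combination (-B) * hh
  · have := congrArg (map (algebraMap κ L)) h
    simp only [map_sub, map_mul, map_pow, map_C, ← hρ, map_ofNat] at this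
    have h4 : (C (2⁻¹ : L) : MvPolynomial (Fin (n + 1)) L) ^ 2 * 4 = 1 := by
      linear_combination (C (2⁻¹ : L) * 2 + 1) * hh
    rw [map_mul]
    linear_combination C (2⁻¹ : L) ^ 2 * this + map (algebraMap κ L) (tangentForm s G) * map (algebraMap κ L) G * h4

/-- With ρ² + ρ + e = 0 over the closure, g + ρB would be a root of y² + By + AC that is a form. -/
theorem IsSmoothCubic.not_artinSchreier_eq [CharP κ 2] (hG : IsSmoothCubic G) (hn : 2 ≤ n)
    {s : Fin (n + 1) → κ} (hs : s ≠ 0) (hs0 : eval s G = 0) (e : κ)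
    {g : MvPolynomial (Fin (n + 1)) κ} (hg : g.IsHomogeneous 2) :
    tangentForm s G * G ≠ g ^ 2 + dirDeriv s G * g + C e * dirDeriv s G ^ 2 := by
  intro h
  set L := AlgebraicClosure κ
  have h2 : (2 : L) = 0 := by
    rw [← map_ofNat (algebraMap κ L) 2, CharTwo.two_eq_zero, map_zero]
  have h2' : (2 : MvPolynomial (Fin (n + 1)) L) = 0 := by rw [← map_ofNat C 2, h2, C_0]
  obtain ⟨ρ, hρ⟩ := IsAlgClosed.exists_root (Polynomial.C (1 : L) * Polynomial.X ^ 2 +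
    Polynomial.C 1 * Polynomial.X + Polynomial.C (algebraMap κ L e))
    (by rw [Polynomial.degree_quadratic one_ne_zero]; norm_num)
  simp only [Polynomial.IsRoot, Polynomial.eval_add, Polynomial.eval_mul, Polynomial.eval_C,
      Polynomial.eval_pow, Polynomial.eval_X] at hρ
  set B := map (algebraMap κ L) (dirDeriv s G)
  have hB : B.IsHomogeneous 2 := (hG.homogeneous.dirDeriv s).map _
  have hg' := hg.map (algebraMap κ L)
  set g' := map (algebraMap κ L) g with hg'def
  refine hG.not_factor hn hs hs0 (y₁ := g' + C ρ * B) (y₂ := -B - (g' + C ρ * B))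
    (hg'.add (hB.C_mul _)) (hB.neg.sub (hg'.add (hB.C_mul _))) (by ring) ?_
  rw [h, map_add, map_add, map_mul, map_mul, map_pow, map_pow, map_C]
  have hρ' : C ρ ^ 2 + C ρ + C (algebraMap κ L e) = (0 : MvPolynomial (Fin (n + 1)) L) := by
    rw [← C_pow, ← C_add, ← C_add, ← C_0]
    congr 1
    linear_combination hρ
  linear_combination (-B ^ 2) * hρ' + (-g' ^ 2 - B * g' - g' * C ρ * B) * h2'

end Smooth

section Lines

variable {κ : Type*} [Field κ] [Fintype κ] {n : ℕ} {G : MvPolynomial (Fin (n + 1)) κ}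

/-- The additive map z ↦ z² + z has kernel {0, 1}, hence image of index two; c is any element
outside the image. In characteristic two it plays the part of a nonsquare. -/
theorem exists_artinSchreier_complement [CharP κ 2] :
    ∃ c : κ, ∀ d : κ, (¬ ∃ z, z ^ 2 + z = d) → ∃ z, z ^ 2 + z = d + c := by
  have h2 : (2 : κ) = 0 := CharTwo.two_eq_zero
  let φ : κ →+ κ := AddMonoidHom.mk' (fun z => z ^ 2 + z) fun a b => by
    linear_combination a * b * h2
  have hker : Nat.card φ.ker = 2 := by
    have : (φ.ker : Set κ) = {0, 1} := by
      ext z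
      simp only [SetLike.mem_coe, AddMonoidHom.mem_ker, Set.mem_insert_iff, Set.mem_singleton_iff]
      change z ^ 2 + z = 0 ↔ _
      constructor
      · intro hz
        have : z * (z - 1) = 0 := by linear_combination hz - z * h2
        rcases mul_eq_zero.mp this with h | h
        · exact Or.inl h
        · exact Or.inr (sub_eq_zero.mp h)
      · rintro (rfl | rfl)
        · ring
        · linear_combination h2
    change Nat.card (φ.ker : Set κ) = 2
    rw [this, Nat.card_coe_set_eq, Set.ncard_pair zero_ne_one]
  have hindex : φ.range.index = 2 := by
    have h1 := φ.range.card_mul_index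
    have h3 : Nat.card φ.ker * Nat.card φ.range = Nat.card κ := by
      rw [← AddSubgroup.index_ker, AddSubgroup.card_mul_index]
    have hpos : 0 < Nat.card φ.range := Nat.card_pos
    rw [hker] at h3
    nlinarith
  have hne : φ.range ≠ ⊤ := by
    intro h
    rw [h, AddSubgroup.index_top] at hindex
    omega
  obtain ⟨c, hc⟩ : ∃ c, c ∉ φ.range := by
    by_contra! h
    exact hne ((AddSubgroup.eq_top_iff' _).mpr h)
  refine ⟨c, fun d hd => ?_⟩
  exact (AddSubgroup.add_mem_iff_of_index_two hindex).mpr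
    (iff_of_false (fun ⟨z, hz⟩ => hd ⟨z, hz⟩) hc)

/-- A polynomial of degree at most two that vanishes at 0, 1 and a third element is zero, and then
so is its discriminant. This serves to move t along its line through s off the cubic. -/
theorem exists_shift_ne_zero (hq : 11 ≤ Fintype.card κ) {a b c : κ}
    (h : b ^ 2 - 4 * (a * c) ≠ 0) : ∃ x : κ, x ^ 2 * a + x * b + c ≠ 0 := by
  classical
  by_contra! h0
  obtain ⟨x, hx⟩ : ∃ x : κ, x ∉ ({0, 1} : Finset κ) := by
    by_contra! hall
    have := Finset.card_le_card (fun x _ => hall x : (Finset.univ : Finset κ) ⊆ {0, 1})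
    rw [Finset.card_univ] at this
    exact absurd (this.trans Finset.card_le_two) (by omega)
  simp only [Finset.mem_insert, Finset.mem_singleton, not_or] at hx
  have e0 := h0 0
  have e1 := h0 1
  have ex := h0 x
  have ha : x * (x - 1) * a = 0 := by linear_combination ex - x * e1 + (x - 1) * e0
  have ha0 : a = 0 := (mul_eq_zero.mp ha).resolve_left (mul_ne_zero hx.1 (sub_ne_zero.mpr hx.2))
  have hc0 : c = 0 := by linear_combination e0
  apply h
  rw [ha0, hc0] at e1
  rw [ha0, hc0]
  linear_combination b * e1

/-- Through a point of a smooth cubic hypersurface over a finite field with more than ten elements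
there is a line that meets the hypersurface in two further rational points. -/
theorem IsSmoothCubic.exists_split_line (hG : IsSmoothCubic G) (hn : 2 ≤ n)
    (hq : 11 ≤ Fintype.card κ) {s : Fin (n + 1) → κ} (hs : s ≠ 0) (hs0 : eval s G = 0) :
    ∃ (t : Fin (n + 1) → κ) (y₁ y₂ : κ), y₁ ≠ y₂ ∧ y₁ + y₂ = -polar G t s ∧
      y₁ * y₂ = polar G s t * eval t G ∧ eval t G ≠ 0 := by
  -- The condition that t is off the cubic comes last: replacing t by t + cs keeps A, turns C into
  -- c²A + cB + C, and shifts both roots by −cA.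
  suffices h : ∃ (t : Fin (n + 1) → κ) (y₁ y₂ : κ), y₁ ≠ y₂ ∧ y₁ + y₂ = -polar G t s ∧
      y₁ * y₂ = polar G s t * eval t G by
    obtain ⟨t, y₁, y₂, hne, hadd, hmul⟩ := h
    obtain ⟨c, hc⟩ := exists_shift_ne_zero hq (a := polar G s t) (b := polar G t s) (c := eval t G)
      (by
        have : polar G t s ^ 2 - 4 * (polar G s t * eval t G) = (y₁ - y₂) ^ 2 := by
          rw [← hmul, show polar G t s = -(y₁ + y₂) by rw [hadd, neg_neg]]; ring
        rw [this]
        exact pow_ne_zero 2 (sub_ne_zero.mpr hne))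
    have e1 : polar G s (c • s + (1 : κ) • t) = polar G s t := by
      rw [polar_add_right, polar_smul_right, polar_smul_right, polar_self hG.homogeneous, hs0]; ring
    have e2 : polar G (c • s + (1 : κ) • t) s = polar G t s + 2 * c * polar G s t := by
      have := polar_combination hG.homogeneous s t c 1 1 0
      rw [one_smul κ s, zero_smul, add_zero] at this
      rw [this, hs0]; ring
    have e3 : eval (c • s + (1 : κ) • t) G = c ^ 2 * polar G s t + c * polar G t s + eval t G := by
      rw [eval_combination hG.homogeneous, hs0]; ring
    refine ⟨c • s + (1 : κ) • t, y₁ - c * polar G s t, y₂ - c * polar G s t, ?_, ?_, ?_, ?_⟩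
    · exact fun h => hne (sub_left_injective h)
    · rw [e2]; linear_combination hadd
    · rw [e1, e3]; linear_combination hmul - c * polar G s t * hadd
    · rwa [e3]
  by_contra! hno
  by_cases h2 : (2 : κ) = 0
  · have hch : CharP κ 2 := CharTwo.of_one_ne_zero_of_two_eq_zero one_ne_zero h2
    have hB0 : dirDeriv s G ≠ 0 := hG.dirDeriv_ne_zero (fun h3 => one_ne_zero (α := κ)
      (by linear_combination h3 - h2)) hs
    obtain ⟨c, hc⟩ := exists_artinSchreier_complement (κ := κ)
    have hBh := hG.homogeneous.dirDeriv s
    have hAC : (tangentForm s G * G).IsHomogeneous 4 := by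
      simpa using (isHomogeneous_tangentForm s G).mul hG.homogeneous
    -- If no line splits, AC/B² is never of the form z² + z, so adding c puts it always in the
    -- image, and AC + cB² satisfies the root condition everywhere. Where B vanishes a root exists
    -- since every element is a square.
    obtain ⟨e, g, hg, hD⟩ := quarticForm_eq_of_root_values hq hBh
      (D := tangentForm s G * G + C c * dirDeriv s G ^ 2)
      (hAC.add ((hBh.pow 2).C_mul c)) hB0 (fun t => by
        simp only [map_add, map_mul, map_pow, eval_C, eval_dirDeriv, eval_tangentForm]
        by_cases hB : polar G t s = 0
        · obtain ⟨y, hy⟩ := FiniteField.isSquare_of_char_two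
            (ringChar.eq κ 2 ▸ rfl) (polar G s t * eval t G)
          refine ⟨y, ?_⟩
          rw [hB, hy]
          linear_combination y ^ 2 * h2
        · obtain ⟨z, hz⟩ := hc (polar G s t * eval t G / polar G t s ^ 2) (by
            rintro ⟨z, hz⟩
            rw [eq_div_iff (pow_ne_zero 2 hB)] at hz
            refine hno t (z * polar G t s) (-polar G t s - z * polar G t s) ?_ (by ring) ?_
            · intro h
              apply hB
              linear_combination h - z * polar G t s * h2
            · rw [← hz]
              linear_combination (-z ^ 2 - z) * polar G t s ^ 2 * h2)
          refine ⟨z * polar G t s, ?_⟩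
          have : polar G s t * eval t G = polar G t s ^ 2 * (z ^ 2 + z - c) := by
            rw [hz]; field_simp; ring
          rw [this]
          linear_combination polar G t s ^ 2 * (z ^ 2 + z) * h2)
    refine hG.not_artinSchreier_eq hn hs hs0 (e - c) hg ?_
    rw [C_sub]
    linear_combination hD
  · have hΔ : (dirDeriv s G ^ 2 - C 4 * (tangentForm s G * G)).IsHomogeneous 4 :=
      ((hG.homogeneous.dirDeriv s).pow 2).sub
        (((isHomogeneous_tangentForm s G).mul hG.homogeneous).C_mul 4)
    obtain ⟨e, S, hS, hd⟩ := quarticForm_eq_square hq h2 hΔ (fun t y hy h => by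
      simp only [map_sub, map_mul, map_pow, eval_C, eval_dirDeriv, eval_tangentForm] at h
      refine hno t ((-polar G t s + y) / 2) ((-polar G t s - y) / 2) ?_ ?_ ?_
      · intro h'
        field_simp at h'
        exact hy ((mul_eq_zero.mp (by linear_combination h' : 2 * y = 0)).resolve_left h2)
      · field_simp
        ring
      · field_simp
        linear_combination h)
    exact hG.not_discriminant_eq hn hs hs0 h2 e hS hd

/-- Through a point of a smooth cubic hypersurface over a finite field with more than ten elements
there is a line that meets the hypersurface in two further conjugate points. -/
theorem IsSmoothCubic.exists_inert_line (hG : IsSmoothCubic G) (hn : 2 ≤ n)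
    (hq : 11 ≤ Fintype.card κ) {s : Fin (n + 1) → κ} (hs : s ≠ 0) (hs0 : eval s G = 0) :
    ∃ t : Fin (n + 1) → κ, ∀ y : κ, y ^ 2 + polar G t s * y + polar G s t * eval t G ≠ 0 := by
  by_contra! hroot
  by_cases h2 : (2 : κ) = 0
  · have hch : CharP κ 2 := CharTwo.of_one_ne_zero_of_two_eq_zero one_ne_zero h2
    have hB0 : dirDeriv s G ≠ 0 := hG.dirDeriv_ne_zero (fun h3 => one_ne_zero (α := κ)
      (by linear_combination h3 - h2)) hs
    have hAC : (tangentForm s G * G).IsHomogeneous 4 := by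
      simpa using (isHomogeneous_tangentForm s G).mul hG.homogeneous
    obtain ⟨e, g, hg, hD⟩ := quarticForm_eq_of_root_values hq (hG.homogeneous.dirDeriv s) hAC hB0
      (fun t => by simpa using hroot t)
    exact hG.not_artinSchreier_eq hn hs hs0 e hg hD
  · have hch : ringChar κ ≠ 2 := fun h => h2 (by
      have := ringChar.spec κ 2
      rw [h] at this
      exact_mod_cast this.mpr dvd_rfl)
    obtain ⟨ε, hε⟩ := FiniteField.exists_nonsquare hch
    have hε0 : ε ≠ 0 := by rintro rfl; exact hε (IsSquare.zero)
    have hΔ : (dirDeriv s G ^ 2 - C 4 * (tangentForm s G * G)).IsHomogeneous 4 :=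
      ((hG.homogeneous.dirDeriv s).pow 2).sub
        (((isHomogeneous_tangentForm s G).mul hG.homogeneous).C_mul 4)
    -- If every residual quadratic has a root, the discriminant is always a square, so its multiple
    -- by the nonsquare ε has no nonzero square value.
    obtain ⟨e, S, hS, hd⟩ := quarticForm_eq_square hq h2 (hΔ.C_mul ε) (fun t y hy h => by
      simp only [map_sub, map_mul, map_pow, eval_C, eval_dirDeriv, eval_tangentForm] at h
      obtain ⟨z, hz⟩ := hroot t
      have h4 : ε * (2 * z + polar G t s) ^ 2 = y ^ 2 := by
        rw [← h]; linear_combination 4 * ε * hz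
      have hne : 2 * z + polar G t s ≠ 0 := by
        intro h0
        rw [h0] at h4
        exact hy (pow_eq_zero_iff two_ne_zero |>.mp (by rw [← h4]; ring))
      refine hε ⟨y / (2 * z + polar G t s), ?_⟩
      field_simp
      rw [← h4])
    refine hG.not_discriminant_eq hn hs hs0 h2 (ε⁻¹ * e) hS ?_
    have hc : (C ε⁻¹ : MvPolynomial (Fin (n + 1)) κ) * C ε = 1 := by
      rw [← C_mul, inv_mul_cancel₀ hε0, C_1]
    rw [C_mul, mul_assoc, ← hd]
    linear_combination (-(dirDeriv s G ^ 2 - C 4 * (tangentForm s G * G))) * hc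

end Lines
end

/-! ### Places of a curve function field are discrete valuations. -/

noncomputable section

section Uniformizer

variable {K : Type*} [Field K]

/-- A term of strictly largest value would determine the value of the sum, so the maximum is
attained twice. -/
theorem Valuation.exists_eq_of_sum_eq_zero {Γ : Type*} [LinearOrderedCommGroupWithZero Γ]
    (v : Valuation K Γ) {ι : Type*} {s : Finset ι} {f : ι → K} (hsum : ∑ i ∈ s, f i = 0)
    {i₀ : ι} (hi₀ : i₀ ∈ s) (hf : f i₀ ≠ 0) :
    ∃ i ∈ s, ∃ j ∈ s, i ≠ j ∧ f j ≠ 0 ∧ v (f i) = v (f j) := by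
  classical
  obtain ⟨j, hj, hmax⟩ := s.exists_max_image (fun i => v (f i)) ⟨i₀, hi₀⟩
  have hj0 : f j ≠ 0 := by
    intro h
    have := hmax i₀ hi₀
    rw [h, map_zero, le_zero_iff, map_eq_zero] at this
    exact hf this
  by_contra! hno
  have := v.map_sum_eq_of_lt hj (fun i hi => lt_of_le_of_ne (hmax i (Finset.mem_sdiff.mp hi).1)
    (hno i (Finset.mem_sdiff.mp hi).1 j hj (by simpa using (Finset.mem_sdiff.mp hi).2) hj0))
  rw [hsum, map_zero] at this
  exact hj0 ((map_eq_zero v).mp this.symm)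

/-- `π` generates the maximal ideal of the valuation ring `A`, which has rank one. -/
structure ValuationSubring.IsUniformizer (A : ValuationSubring K) (π : K) : Prop where
  ne_zero : π ≠ 0
  lt_one : A.valuation π < 1
  le : ∀ x, A.valuation x < 1 → A.valuation x ≤ A.valuation π
  exists_pow_le : ∀ x ≠ 0, ∃ n : ℕ, A.valuation π ^ n ≤ A.valuation x

variable {k : Type*} [Field k] [Algebra k K]

theorem Place.valuation_algebraMap (v : Place k K) {a : k} (ha : a ≠ 0) :
    v.localRing.valuation (algebraMap k K a) = 1 := by
  apply le_antisymm ((v.localRing.valuation_le_one_iff _).mpr (v.algebraMap_mem a))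
  have := (v.localRing.valuation_le_one_iff _).mpr (v.algebraMap_mem a⁻¹)
  rw [map_inv₀, map_inv₀] at this
  exact (inv_le_one₀ (by simpa [zero_lt_iff] using ha)).mp this

/-- After a power of X is split off, the constant term is a unit and the remainder has value less
than one. -/
theorem Place.valuation_aeval (v : Place k K) {t : K} (ht : v.localRing.valuation t < 1)
    (f : Polynomial k) (hf : f ≠ 0) :
    ∃ m : ℕ, v.localRing.valuation (Polynomial.aeval t f) = v.localRing.valuation t ^ m := by
  have hle : ∀ g : Polynomial k, v.localRing.valuation (Polynomial.aeval t g) ≤ 1 := by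
    intro g
    rw [ValuationSubring.valuation_le_one_iff, Polynomial.aeval_eq_sum_range]
    refine sum_mem fun i _ => ?_
    rw [Algebra.smul_def]
    exact mul_mem (v.algebraMap_mem _)
      (pow_mem ((v.localRing.valuation_le_one_iff t).mp ht.le) _)
  induction f using Polynomial.recOnHorner with
  | M0 => exact absurd rfl hf
  | MC p a hp ha _ =>
    refine ⟨0, ?_⟩
    obtain ⟨g, rfl⟩ := Polynomial.X_dvd_iff.mpr hp
    rw [pow_zero, map_add, Polynomial.aeval_C, map_mul, Polynomial.aeval_X,
      Valuation.map_add_eq_of_lt_right, v.valuation_algebraMap ha]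
    rw [v.valuation_algebraMap ha, map_mul]
    exact mul_lt_one_of_lt_of_le ht (hle g)
  | MX p hp ih =>
    obtain ⟨m, hm⟩ := ih hp
    exact ⟨m + 1, by rw [map_mul, map_mul, hm, Polynomial.aeval_X, pow_succ]⟩

theorem Place.exists_valuation_lt_one (v : Place k K) :
    ∃ t : K, t ≠ 0 ∧ v.localRing.valuation t < 1 := by
  obtain ⟨x, hx⟩ : ∃ x, x ∉ v.localRing := by
    by_contra! h
    exact v.ne_top (eq_top_iff.mpr fun x _ => h x)
  refine ⟨x⁻¹, ?_, ?_⟩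
  · rintro h
    rw [inv_eq_zero] at h
    exact hx (h ▸ zero_mem _)
  · rw [map_inv₀]
    apply inv_lt_one_of_one_lt₀
    rwa [← not_le, ValuationSubring.valuation_le_one_iff]

/-- In transcendence degree one t is a transcendence basis, and a finitely generated algebraic
extension is finite. -/
theorem IsCurveFunctionField.finiteDimensional (hK : IsCurveFunctionField k K) {t : K}
    (ht : Transcendental k t) : FiniteDimensional (IntermediateField.adjoin k {t}) K := by
  have hb : IsTranscendenceBasis k (fun _ : Unit => t) := by
    apply AlgebraicIndependent.isTranscendenceBasis_of_lift_trdeg_le_of_finite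
    · exact algebraicIndependent_unique_type_iff.mpr ht
    · simp [hK.trdeg_eq_one]
  have := hb.isAlgebraic_field
  rw [Set.range_const] at this
  obtain ⟨S, hS⟩ := hK.fg
  set L := IntermediateField.adjoin k {t}
  have htop : IntermediateField.adjoin L (S : Set K) = ⊤ := by
    apply IntermediateField.restrictScalars_injective k
    rw [IntermediateField.restrictScalars_top, eq_top_iff, ← hS, IntermediateField.adjoin_le_iff]
    exact IntermediateField.subset_adjoin L (S : Set K)
  have hfin : FiniteDimensional L (IntermediateField.adjoin L (S : Set K)) :=
    IntermediateField.finiteDimensional_adjoin fun x _ => Algebra.IsIntegral.isIntegral x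
  rw [htop] at hfin
  exact Module.Finite.equiv (IntermediateField.topEquiv (F := L) (E := K)).toLinearEquiv

theorem IsCurveFunctionField.transcendental (hK : IsCurveFunctionField k K) (v : Place k K)
    {t : K} (ht0 : t ≠ 0) (ht : v.localRing.valuation t < 1) : Transcendental k t := by
  intro halg
  have : t ∈ integralClosure k K := halg.isIntegral
  rw [hK.integralClosure_eq_bot] at this
  obtain ⟨a, rfl⟩ := Algebra.mem_bot.mp this
  rw [v.valuation_algebraMap (by rintro rfl; simp at ht0)] at ht
  exact lt_irrefl _ ht

/-- Two terms of the minimal equation of x over k(t) have equal value, and values from k(t) are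
powers of that of t. So some power of v(x), of exponent at most [K : k(t)], is a power of v(t). -/
theorem IsCurveFunctionField.exists_valuation_pow_eq (hK : IsCurveFunctionField k K)
    (v : Place k K) {t : K} (ht0 : t ≠ 0) (ht : v.localRing.valuation t < 1) :
    ∃ e : ℕ, 0 < e ∧ ∀ x ≠ 0, ∃ m : ℤ,
      v.localRing.valuation x ^ e = v.localRing.valuation t ^ m := by
  set L := IntermediateField.adjoin k {t}
  have hfin : FiniteDimensional L K := hK.finiteDimensional (hK.transcendental v ht0 ht)
  -- The factorial is divisible by every exponent that can arise, so one e serves for all x.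
  refine ⟨(Module.finrank L K).factorial, Nat.factorial_pos _, fun x hx => ?_⟩
  have hL : ∀ a : L, a ≠ 0 → ∃ m : ℤ,
      v.localRing.valuation (a : K) = v.localRing.valuation t ^ m := by
    intro a ha
    obtain ⟨r, s, hrs⟩ := (IntermediateField.mem_adjoin_simple_iff k (a : K)).mp a.2
    have ha' : (a : K) ≠ 0 := by simpa using ha
    have hr : r ≠ 0 := by rintro rfl; simp [hrs] at ha'
    have hs : s ≠ 0 := by rintro rfl; simp [hrs] at ha'
    obtain ⟨i, hi⟩ := v.valuation_aeval ht r hr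
    obtain ⟨j, hj⟩ := v.valuation_aeval ht s hs
    refine ⟨i - j, ?_⟩
    rw [hrs, map_div₀, hi, hj, zpow_sub₀ (by simpa using ht0), zpow_natCast, zpow_natCast]
  have hvx : v.localRing.valuation x ≠ 0 := by simpa using hx
  have hvt : v.localRing.valuation t ≠ 0 := by simpa using ht0
  have hint : IsIntegral L x := Algebra.IsIntegral.isIntegral x
  have hsum := minpoly.aeval L x
  rw [Polynomial.aeval_eq_sum_range] at hsum
  simp only [Algebra.smul_def] at hsum
  obtain ⟨i, hi, j, hj, hij, hj0, heq⟩ := v.localRing.valuation.exists_eq_of_sum_eq_zero hsum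
    (Finset.self_mem_range_succ _) (by
      rw [Polynomial.coeff_natDegree, minpoly.monic hint, map_one, one_mul]
      exact pow_ne_zero _ hx)
  have hi0 : algebraMap L K ((minpoly L x).coeff i) * x ^ i ≠ 0 := by
    intro h0
    rw [h0, map_zero] at heq
    exact hj0 ((map_eq_zero _).mp heq.symm)
  obtain ⟨a, ha⟩ := hL ((minpoly L x).coeff i) fun h => left_ne_zero_of_mul hi0 (by rw [h, map_zero])
  obtain ⟨b, hb⟩ := hL ((minpoly L x).coeff j) fun h => left_ne_zero_of_mul hj0 (by rw [h, map_zero])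
  have key : ∀ {i j : ℕ} {a b : ℤ}, i < j → j < (minpoly L x).natDegree + 1 →
      v.localRing.valuation t ^ a * v.localRing.valuation x ^ i =
        v.localRing.valuation t ^ b * v.localRing.valuation x ^ j →
      ∃ m : ℤ, v.localRing.valuation x ^ (Module.finrank L K).factorial =
        v.localRing.valuation t ^ m := by
    intro i j a b hij hj h
    have hd : j - i ∣ (Module.finrank L K).factorial := by
      apply Nat.dvd_factorial (by omega)
      have := minpoly.natDegree_le (A := L) x
      omega
    obtain ⟨c, hc⟩ := hd
    have h1 : v.localRing.valuation x ^ (j - i) = v.localRing.valuation t ^ (a - b) := by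
      have h2 : v.localRing.valuation x ^ j =
          v.localRing.valuation x ^ i * v.localRing.valuation x ^ (j - i) := by
        rw [← pow_add]; congr 1; omega
      rw [h2] at h
      rw [zpow_sub₀ hvt, eq_div_iff (zpow_ne_zero _ hvt)]
      apply mul_left_cancel₀ (pow_ne_zero i hvx)
      rw [mul_comm _ (v.localRing.valuation t ^ a), h]
      ac_rfl
    refine ⟨(a - b) * c, ?_⟩
    rw [hc, pow_mul, h1, zpow_mul, zpow_natCast]
  rw [map_mul, map_mul, map_pow, map_pow] at heq
  erw [ha, hb] at heq
  rcases lt_or_gt_of_ne hij with h | h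
  · exact key h (Finset.mem_range.mp hj) heq
  · exact key h (Finset.mem_range.mp hi) heq.symm

/-- The places of the function field of a curve are discrete valuations. -/
theorem IsCurveFunctionField.exists_isUniformizer (hK : IsCurveFunctionField k K)
    (v : Place k K) : ∃ π, v.localRing.IsUniformizer π := by
  classical
  obtain ⟨t, ht0, ht⟩ := v.exists_valuation_lt_one
  obtain ⟨e, he, H⟩ := hK.exists_valuation_pow_eq v ht0 ht
  have hvt : 0 < v.localRing.valuation t := by simpa [zero_lt_iff] using ht0
  -- The value group embeds in ℤ by x ↦ m with v(x)^e = v(t)^m; a uniformizer is an element with the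
  -- least positive m.
  have hex : ∃ m : ℕ, 0 < m ∧ ∃ x ≠ 0, v.localRing.valuation x ^ e = v.localRing.valuation t ^ m :=
    ⟨e, he, t, ht0, rfl⟩
  obtain ⟨hm, π, hπ0, hπ⟩ := Nat.find_spec hex
  have hmin := fun n => Nat.find_min' (m := n) hex
  set m := Nat.find hex
  refine ⟨π, hπ0, ?_, fun x hx => ?_, fun x hx => ?_⟩
  · rw [← pow_lt_one_iff_of_nonneg zero_le he.ne', hπ]
    exact pow_lt_one₀ zero_le ht hm.ne'
  · rcases eq_or_ne x 0 with rfl | hx0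
    · simp
    obtain ⟨a, ha⟩ := H x hx0
    have ha0 : 0 < a := by
      by_contra! h
      have h1 : (1 : _) ≤ v.localRing.valuation t ^ a := one_le_zpow_of_nonpos₀ hvt ht.le h
      rw [← ha] at h1
      exact absurd (pow_lt_one₀ zero_le hx he.ne') h1.not_gt
    lift a to ℕ using ha0.le
    rw [zpow_natCast] at ha
    have := hmin a ⟨by exact_mod_cast ha0, x, hx0, ha⟩
    rw [← pow_le_pow_iff_left₀ zero_le zero_le he.ne', hπ, ha]
    exact pow_le_pow_of_le_one zero_le ht.le this
  · obtain ⟨a, ha⟩ := H x hx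
    refine ⟨a.toNat, ?_⟩
    rw [← pow_le_pow_iff_left₀ zero_le zero_le he.ne', ← pow_mul, mul_comm, pow_mul, hπ, ← pow_mul,
      ha, ← zpow_natCast]
    apply zpow_le_zpow_right_of_le_one₀ hvt ht.le
    calc a ≤ a.toNat := Int.self_le_toNat a
      _ ≤ (m * a.toNat : ℕ) := by exact_mod_cast Nat.le_mul_of_pos_left _ hm

end Uniformizer
end

/-! ### The quadratic constant extension and its places. -/

noncomputable section

section ConstantExtension

/-- `K₂ = K₁(ω)` is a quadratic extension of `K₁`, with conjugation `σ`, generated by the element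
`ω` of the field of constants `F₂` of `K₂`. -/
structure IsQuadraticConstantExtension (F₂ : Type*) (K₁ : Type*) {K₂ : Type*} [Field F₂] [Field K₁]
    [Field K₂] [Algebra F₂ K₂] [Algebra K₁ K₂] (σ : K₂ →+* K₂) (ω : K₂) : Prop where
  map_algebraMap : ∀ a, σ (algebraMap K₁ K₂ a) = algebraMap K₁ K₂ a
  involutive : ∀ z, σ (σ z) = z
  exists_eq : ∀ z, ∃ a b : K₁, z = algebraMap K₁ K₂ a + algebraMap K₁ K₂ b * ω
  mem_range : ω ∈ (algebraMap F₂ K₂).range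
  map_constant : ∀ c, σ (algebraMap F₂ K₂ c) ∈ (algebraMap F₂ K₂).range
  ne : σ ω ≠ ω

/-- The conjugation is the Frobenius of `F₂` over `F₁` tensored with the identity of `K₁`, and ω is
any constant outside `F₁`. -/
theorem exists_isQuadraticConstantExtension {Q : ℕ} {F₁ F₂ : Type*} [Field F₁] [Field F₂]
    [Algebra F₁ F₂] (hQ : 1 < Q) (hF₁ : Nat.card F₁ = Q) (hF₂ : Nat.card F₂ = Q ^ 2)
    {K₁ K₂ : Type*} [Field K₁] [Field K₂] [Algebra F₁ K₁] [Algebra K₁ K₂] [Algebra F₂ K₂]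
    [Algebra F₁ K₂] [IsScalarTower F₁ K₁ K₂] [IsScalarTower F₁ F₂ K₂]
    [Algebra.IsPushout F₁ F₂ K₁ K₂] :
    ∃ (σ : K₂ →+* K₂) (ω : K₂), IsQuadraticConstantExtension F₂ K₁ σ ω := by
  have hfin₁ : Finite F₁ := Nat.finite_of_card_ne_zero (by omega)
  have hfin₂ : Finite F₂ := Nat.finite_of_card_ne_zero (by rw [hF₂]; positivity)
  have := Fintype.ofFinite F₁
  have := Fintype.ofFinite F₂
  have hc₁ : Fintype.card F₁ = Q := by rw [← hF₁, Nat.card_eq_fintype_card]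
  have hc₂ : Fintype.card F₂ = Q ^ 2 := by rw [← hF₂, Nat.card_eq_fintype_card]
  have hrank : Module.finrank F₁ F₂ = 2 := by
    have := Module.card_eq_pow_finrank (K := F₁) (V := F₂)
    rw [hc₁, hc₂] at this
    exact (Nat.pow_right_injective hQ this).symm
  obtain ⟨w, hw⟩ : ∃ w : F₂, w ∉ (algebraMap F₁ F₂).range := by
    by_contra! h
    have := Nat.card_le_card_of_surjective (algebraMap F₁ F₂) h
    rw [hF₁, hF₂] at this
    nlinarith
  have hspan : ∀ y : F₂, ∃ a b : F₁, y = algebraMap F₁ F₂ a + algebraMap F₁ F₂ b * w := by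
    have hli : LinearIndependent F₁ ![1, w] := by
      rw [LinearIndependent.pair_iff]
      intro s t hst
      simp only [Algebra.smul_def, mul_one] at hst
      have ht : t = 0 := by
        by_contra ht
        refine hw ⟨-s / t, ?_⟩
        have : algebraMap F₁ F₂ t ≠ 0 := by simpa using ht
        rw [map_div₀, map_neg]
        field_simp
        linear_combination -hst
      subst ht
      simpa using hst
    have htop := hli.span_eq_top_of_card_eq_finrank' (by simp [hrank])
    intro y
    have hy : y ∈ Submodule.span F₁ (Set.range ![1, w]) := htop ▸ Submodule.mem_top
    rw [Matrix.range_cons, Matrix.range_cons, Matrix.range_empty, Set.union_empty,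
      Set.singleton_union, Submodule.mem_span_pair] at hy
    obtain ⟨a, b, h⟩ := hy
    exact ⟨a, b, by rw [← h, Algebra.smul_def, Algebra.smul_def, mul_one]⟩
  let τ : F₂ →ₐ[F₁] F₂ := FiniteField.frobeniusAlgHom F₁ F₂
  have hτ : ∀ y, τ y = y ^ Q := fun y => by rw [← hc₁]; rfl
  let σ : K₂ →ₐ[F₁] K₂ := Algebra.pushoutDesc (R := F₁) (S := F₂) (R' := K₁) K₂
    ((IsScalarTower.toAlgHom F₁ F₂ K₂).comp τ) (IsScalarTower.toAlgHom F₁ K₁ K₂)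
    fun _ _ => mul_comm _ _
  have hσ₁ : ∀ a : K₁, σ (algebraMap K₁ K₂ a) = algebraMap K₁ K₂ a := fun a => by
    simp [σ]
  have hσ₂ : ∀ y : F₂, σ (algebraMap F₂ K₂ y) = algebraMap F₂ K₂ (y ^ Q) := fun y => by
    rw [← hτ]; simp [σ]
  have hex : ∀ z : K₂, ∃ a b : K₁,
      z = algebraMap K₁ K₂ a + algebraMap K₁ K₂ b * algebraMap F₂ K₂ w := by
    have hc : ∀ a : F₁, algebraMap F₂ K₂ (algebraMap F₁ F₂ a) =
        algebraMap K₁ K₂ (algebraMap F₁ K₁ a) := fun a => by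
      rw [← IsScalarTower.algebraMap_apply, ← IsScalarTower.algebraMap_apply]
    intro z
    induction z using (Algebra.IsPushout.out (R := F₁) (S := F₂) (R' := K₁) (S' := K₂)).inductionOn with
    | zero => exact ⟨0, 0, by simp⟩
    | tmul m => exact ⟨m, 0, by simp⟩
    | smul y z ih =>
      obtain ⟨a, b, rfl⟩ := ih
      obtain ⟨c, d, h₁⟩ := hspan y
      obtain ⟨e, f, h₂⟩ := hspan (y * w)
      have h₁' := congrArg (algebraMap F₂ K₂) h₁
      have h₂' := congrArg (algebraMap F₂ K₂) h₂
      simp only [map_add, map_mul, hc] at h₁' h₂'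
      refine ⟨a * algebraMap F₁ K₁ c + b * algebraMap F₁ K₁ e,
        a * algebraMap F₁ K₁ d + b * algebraMap F₁ K₁ f, ?_⟩
      rw [Algebra.smul_def]
      simp only [map_add, map_mul]
      linear_combination algebraMap K₁ K₂ a * h₁' + algebraMap K₁ K₂ b * h₂'
    | add x y hx hy =>
      obtain ⟨a, b, rfl⟩ := hx
      obtain ⟨c, d, rfl⟩ := hy
      exact ⟨a + c, b + d, by simp only [map_add]; ring⟩
  refine ⟨σ, algebraMap F₂ K₂ w, hσ₁, fun z => ?_, hex, ⟨w, rfl⟩, fun c => ⟨c ^ Q, ?_⟩, ?_⟩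
  · obtain ⟨a, b, rfl⟩ := hex z
    simp only [RingHom.coe_coe, map_add, map_mul, hσ₁, hσ₂, ← pow_mul]
    rw [← sq, ← hc₂, FiniteField.pow_card]
  · exact (hσ₂ c).symm
  · change σ _ ≠ _
    rw [hσ₂]
    intro h
    -- A constant fixed by Frobenius is a root of X^Q − X, whose roots are exactly the elements of
    -- `F₁`.
    have h0 : w ^ Q - w = 0 := sub_eq_zero.mpr ((algebraMap F₂ K₂).injective h)
    have hprod := congrArg (Polynomial.aeval w) (Polynomial.X_pow_card_sub_X_eq_prod (κ := F₁))
    rw [hc₁] at hprod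
    simp only [map_sub, map_pow, Polynomial.aeval_X, h0, map_prod, Polynomial.aeval_C] at hprod
    obtain ⟨a, -, ha⟩ := Finset.prod_eq_zero_iff.mp hprod.symm
    exact hw ⟨a, (sub_eq_zero.mp ha).symm⟩

end ConstantExtension

section Places

theorem ValuationSubring.valuation_le_iff_div_mem {K : Type*} [Field K] (A : ValuationSubring K) {x y : K}
    (hy : y ≠ 0) : A.valuation x ≤ A.valuation y ↔ x / y ∈ A := by
  rw [← A.valuation_le_one_iff, map_div₀, div_le_one₀ (by simpa [zero_lt_iff] using hy)]

/-- The place `w` lies over `v` along the field embedding `φ`, and is unramified. -/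
structure Place.IsUnramified {k k' K K' : Type*} [Field k] [Field K] [Algebra k K] [Field k']
    [Field K'] [Algebra k' K'] (φ : K →+* K') (v : Place k K) (w : Place k' K') : Prop where
  mem_iff : ∀ z, φ z ∈ w.localRing ↔ z ∈ v.localRing
  exists_isUniformizer : ∃ π, v.localRing.IsUniformizer π ∧ w.localRing.IsUniformizer (φ π)

variable {k k' K K' : Type*} [Field k] [Field K] [Algebra k K] [Field k']
    [Field K'] [Algebra k' K'] {φ : K →+* K'} {v : Place k K} {w : Place k' K'}

theorem Place.valuation_le_iff_of_mem_iff (h : ∀ z, φ z ∈ w.localRing ↔ z ∈ v.localRing) {x y : K} :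
    w.localRing.valuation (φ x) ≤ w.localRing.valuation (φ y) ↔
      v.localRing.valuation x ≤ v.localRing.valuation y := by
  rcases eq_or_ne y 0 with rfl | hy
  · simp
  rw [ValuationSubring.valuation_le_iff_div_mem _ hy, ValuationSubring.valuation_le_iff_div_mem _ (by simpa using hy),
    ← map_div₀, h]

theorem Place.valuation_lt_iff_of_mem_iff (h : ∀ z, φ z ∈ w.localRing ↔ z ∈ v.localRing) {x y : K} :
    w.localRing.valuation (φ x) < w.localRing.valuation (φ y) ↔
      v.localRing.valuation x < v.localRing.valuation y := by
  rw [← not_le, ← not_le, Place.valuation_le_iff_of_mem_iff h]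

/-- A valuation ring dominating the image of the local ring contracts to it: an element outside has
a nonunit inverse, which cannot become a unit above. -/
theorem Place.exists_over [Algebra K K'] [Finite k'] (v : Place k K) :
    ∃ w : Place k' K', ∀ z, algebraMap K K' z ∈ w.localRing ↔ z ∈ v.localRing := by
  obtain ⟨A, h, hloc⟩ := IsLocalRing.exists_factor_valuationRing
    ((algebraMap K K').comp v.localRing.subtype)
  have hmem : ∀ z, algebraMap K K' z ∈ A ↔ z ∈ v.localRing := by
    refine fun z => ⟨fun hz => ?_, fun hz => h ⟨z, hz⟩⟩
    by_contra hzv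
    have hz0 : z ≠ 0 := by rintro rfl; exact hzv (zero_mem _)
    have hinv := (v.localRing.mem_or_inv_mem z).resolve_left hzv
    have hu : IsUnit (⟨z⁻¹, hinv⟩ : v.localRing) := by
      apply hloc.map_nonunit
      refine isUnit_iff_exists_inv.mpr ⟨⟨algebraMap K K' z, hz⟩, ?_⟩
      ext
      change algebraMap K K' z⁻¹ * algebraMap K K' z = 1
      rw [← map_mul, inv_mul_cancel₀ hz0, map_one]
    obtain ⟨b, hb⟩ := isUnit_iff_exists_inv.mp hu
    have hb' : z⁻¹ * (b : K) = 1 := congrArg Subtype.val hb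
    rw [inv_mul_eq_one₀ hz0] at hb'
    exact hzv (hb' ▸ b.2)
  refine ⟨⟨A, fun a => ?_, ?_⟩, hmem⟩
  · have := Fintype.ofFinite k'
    by_contra ha
    have hinv := (A.mem_or_inv_mem _).resolve_left ha
    apply ha
    -- A constant of a finite field is a power of its inverse, so every valuation ring contains it.
    have hcard : a = a⁻¹ ^ (Fintype.card k' - 2) := by
      rcases eq_or_ne a 0 with rfl | ha0
      · simp at ha
      have h2 : 2 ≤ Fintype.card k' := Fintype.one_lt_card
      have := FiniteField.pow_card_sub_one_eq_one a ha0
      rw [inv_pow]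
      apply eq_inv_of_mul_eq_one_left
      rw [← pow_succ', ← this]
      congr 1; omega
    rw [hcard, map_pow, map_inv₀]
    exact pow_mem hinv _
  · intro htop
    apply v.ne_top
    rw [eq_top_iff]
    intro z _
    rw [← hmem, htop]
    trivial


variable {F₁ F₂ K₁ K₂ : Type*} [Field F₁] [Field F₂] [Field K₁] [Field K₂] [Algebra F₁ K₁]
  [Algebra F₂ K₂] [Algebra K₁ K₂] {σ : K₂ →+* K₂} {ω : K₂}

namespace IsQuadraticConstantExtension

theorem exists_of_fixed (H : IsQuadraticConstantExtension F₂ K₁ σ ω) {z : K₂} (hz : σ z = z) :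
    ∃ a : K₁, algebraMap K₁ K₂ a = z := by
  obtain ⟨a, b, rfl⟩ := H.exists_eq z
  refine ⟨a, ?_⟩
  rw [map_add, map_mul, H.map_algebraMap, H.map_algebraMap, add_right_inj] at hz
  have : algebraMap K₁ K₂ b * (σ ω - ω) = 0 := by rw [mul_sub, hz, sub_self]
  rw [(mul_eq_zero.mp this).resolve_right (sub_ne_zero.mpr H.ne), zero_mul, add_zero]

/-- ω − σω is a nonzero constant, hence a unit at every place. The absence of ramification rests on
this. -/
theorem valuation_sub (H : IsQuadraticConstantExtension F₂ K₁ σ ω) (w : Place F₂ K₂) :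
    w.localRing.valuation (ω - σ ω) = 1 := by
  obtain ⟨c, rfl⟩ := H.mem_range
  obtain ⟨d, hd⟩ := H.map_constant c
  rw [← hd, ← map_sub]
  refine w.valuation_algebraMap fun h => H.ne ?_
  rw [← hd, ← sub_eq_zero, ← map_sub, ← neg_sub, h, neg_zero, map_zero]

theorem mem_localRing (H : IsQuadraticConstantExtension F₂ K₁ σ ω) (w : Place F₂ K₂) :
    ω ∈ w.localRing := by
  obtain ⟨c, rfl⟩ := H.mem_range
  exact w.algebraMap_mem c

/-- The extension has no ramification: the value group does not grow. -/
theorem exists_valuation_eq (H : IsQuadraticConstantExtension F₂ K₁ σ ω) (w : Place F₂ K₂)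
    {z : K₂} (hz : z ≠ 0) :
    ∃ a : K₁, a ≠ 0 ∧ w.localRing.valuation z = w.localRing.valuation (algebraMap K₁ K₂ a) := by
  obtain ⟨a, b, rfl⟩ := H.exists_eq z
  rcases eq_or_ne b 0 with rfl | hb
  · refine ⟨a, ?_, by simp⟩
    rintro rfl
    simp at hz
  have hb' : algebraMap K₁ K₂ b ≠ 0 := by simpa using hb
  suffices h : ∃ c : K₁, c ≠ 0 ∧ w.localRing.valuation (ω + algebraMap K₁ K₂ (a / b)) =
      w.localRing.valuation (algebraMap K₁ K₂ c) by
    obtain ⟨c, hc0, hc⟩ := h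
    refine ⟨b * c, mul_ne_zero hb hc0, ?_⟩
    rw [map_mul, map_mul, ← hc, ← map_mul]
    congr 1
    rw [map_div₀]
    field_simp
    ring
  set c := a / b
  have hω := (w.localRing.valuation_le_one_iff ω).mpr (H.mem_localRing w)
  rcases lt_trichotomy (w.localRing.valuation (ω + algebraMap K₁ K₂ c)) 1 with h | h | h
  -- If ω + c is not a unit, its conjugate differs from it by the unit ω − σω and so is a unit; the
  -- norm N, which lies in `K₁`, then has the value of ω + c.
  · obtain ⟨N, hN⟩ := H.exists_of_fixed (z := (ω + algebraMap K₁ K₂ c) * (σ ω + algebraMap K₁ K₂ c))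
      (by simp only [map_mul, map_add, H.involutive, H.map_algebraMap, mul_comm])
    have hconj : w.localRing.valuation (σ ω + algebraMap K₁ K₂ c) = 1 := by
      have : σ ω + algebraMap K₁ K₂ c = (ω + algebraMap K₁ K₂ c) - (ω - σ ω) := by ring
      rw [this, Valuation.map_sub_eq_of_lt_right _ (by rwa [H.valuation_sub]), H.valuation_sub]
    have heq : w.localRing.valuation (ω + algebraMap K₁ K₂ c) =
        w.localRing.valuation (algebraMap K₁ K₂ N) := by
      rw [hN, map_mul, hconj, mul_one]
    refine ⟨N, ?_, heq⟩
    rintro rfl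
    rw [map_zero, map_zero, map_eq_zero] at heq
    have h1 : (1 : w.localRing.ValueGroup) = 0 := by
      rw [← H.valuation_sub w, map_eq_zero, sub_eq_zero]
      have h2 : ω = algebraMap K₁ K₂ (-c) := by rw [map_neg]; linear_combination heq
      rw [h2, H.map_algebraMap]
    exact one_ne_zero h1
  · exact ⟨1, one_ne_zero, by rw [h, map_one, map_one]⟩
  · have hc : 1 < w.localRing.valuation (algebraMap K₁ K₂ c) := by
      by_contra! hle
      exact h.not_ge ((w.localRing.valuation.map_add _ _).trans (max_le hω hle))
    refine ⟨c, ?_, Valuation.map_add_eq_of_lt_right _ (hω.trans_lt hc)⟩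
    rintro hc0
    rw [hc0, map_zero, map_zero] at hc
    exact hc.not_ge zero_le_one

theorem isUnramified (H : IsQuadraticConstantExtension F₂ K₁ σ ω) (hK₁ : IsCurveFunctionField F₁ K₁)
    {v : Place F₁ K₁} {w : Place F₂ K₂}
    (h : ∀ z, algebraMap K₁ K₂ z ∈ w.localRing ↔ z ∈ v.localRing) :
    Place.IsUnramified (algebraMap K₁ K₂) v w := by
  obtain ⟨π, hπ⟩ := hK₁.exists_isUniformizer v
  have hlt := fun x y : K₁ => Place.valuation_lt_iff_of_mem_iff h (x := x) (y := y)
  have hle := fun x y : K₁ => Place.valuation_le_iff_of_mem_iff h (x := x) (y := y)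
  refine ⟨h, π, hπ, by simpa using hπ.ne_zero, ?_, fun x hx => ?_, fun x hx => ?_⟩
  · simpa using (hlt π 1).mpr (by simpa using hπ.lt_one)
  · rcases eq_or_ne x 0 with rfl | hx0
    · simp
    obtain ⟨a, -, ha⟩ := H.exists_valuation_eq w hx0
    rw [ha, hle]
    apply hπ.le
    simpa using (hlt a 1).mp (by simpa [← ha] using hx)
  · obtain ⟨a, ha0, ha⟩ := H.exists_valuation_eq w hx
    obtain ⟨n, hn⟩ := hπ.exists_pow_le a ha0
    refine ⟨n, ?_⟩
    rw [ha, ← map_pow, ← map_pow, hle, map_pow]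
    exact hn

/-- The conjugate of a place. -/
def conj (H : IsQuadraticConstantExtension F₂ K₁ σ ω) (w : Place F₂ K₂) : Place F₂ K₂ where
  localRing := w.localRing.comap σ
  algebraMap_mem a := by
    obtain ⟨d, hd⟩ := H.map_constant a
    rw [ValuationSubring.mem_comap, ← hd]
    exact w.algebraMap_mem d
  ne_top h := w.ne_top (by
    rw [eq_top_iff]
    intro z _
    have : σ z ∈ w.localRing.comap σ := h ▸ ValuationSubring.mem_top _
    rwa [ValuationSubring.mem_comap, H.involutive] at this)

theorem mem_conj (H : IsQuadraticConstantExtension F₂ K₁ σ ω) (w : Place F₂ K₂) (z : K₂) :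
    z ∈ (H.conj w).localRing ↔ σ z ∈ w.localRing :=
  Iff.rfl

theorem isUnramified_conj (H : IsQuadraticConstantExtension F₂ K₁ σ ω)
    (hK₁ : IsCurveFunctionField F₁ K₁) {v : Place F₁ K₁} {w : Place F₂ K₂}
    (h : Place.IsUnramified (algebraMap K₁ K₂) v w) :
    Place.IsUnramified (algebraMap K₁ K₂) v (H.conj w) :=
  H.isUnramified hK₁ fun z => by rw [H.mem_conj, H.map_algebraMap, h.mem_iff]

/-- A uniformizer taken from `K₁` is fixed by σ, and any two uniformizers at v have the same value.
-/
theorem isUnramified_of_mem_iff (H : IsQuadraticConstantExtension F₂ K₁ σ ω)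
    {v : Place F₁ K₁} {w w' : Place F₂ K₂} (h : Place.IsUnramified (algebraMap K₁ K₂) v w)
    (hw : Place.IsUnramified (algebraMap K₁ K₂) v w')
    (hmem : ∀ z, σ z ∈ w'.localRing ↔ z ∈ w.localRing) :
    Place.IsUnramified σ w w' := by
  obtain ⟨π, hπ, hπw⟩ := h.exists_isUniformizer
  refine ⟨hmem, _, hπw, ?_⟩
  obtain ⟨ρ, hρ, hρw⟩ := hw.exists_isUniformizer
  have heq := (Place.valuation_le_iff_of_mem_iff hw.mem_iff).mpr (hρ.le _ hπ.lt_one)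
  have heq' := (Place.valuation_le_iff_of_mem_iff hw.mem_iff).mpr (hπ.le _ hρ.lt_one)
  have hval := le_antisymm heq heq'
  rw [H.map_algebraMap]
  exact ⟨by simpa using hπ.ne_zero, hval ▸ hρw.lt_one, fun x hx => hval ▸ hρw.le x hx,
    fun x hx => hval ▸ hρw.exists_pow_le x hx⟩

/-- At a place that is equal to its conjugate, the valuation ring is generated by `ω`. -/
theorem exists_eq_of_mem (H : IsQuadraticConstantExtension F₂ K₁ σ ω)
    {v : Place F₁ K₁} {w : Place F₂ K₂} (h : Place.IsUnramified (algebraMap K₁ K₂) v w)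
    (hσ : ∀ z, σ z ∈ w.localRing ↔ z ∈ w.localRing) {z : K₂} (hz : z ∈ w.localRing) :
    ∃ a ∈ v.localRing, ∃ b ∈ v.localRing, z = algebraMap K₁ K₂ a + algebraMap K₁ K₂ b * ω := by
  obtain ⟨a, b, rfl⟩ := H.exists_eq z
  suffices hb : b ∈ v.localRing by
    refine ⟨a, ?_, b, hb, rfl⟩
    rw [← h.mem_iff]
    simpa using sub_mem hz (mul_mem ((h.mem_iff b).mpr hb) (H.mem_localRing w))
  by_contra hb
  have hb0 : algebraMap K₁ K₂ b ≠ 0 := by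
    intro h0
    rw [map_eq_zero] at h0
    exact hb (h0 ▸ zero_mem _)
  set y := algebraMap K₁ K₂ (a / b) + ω with hy
  have hby : algebraMap K₁ K₂ a + algebraMap K₁ K₂ b * ω = algebraMap K₁ K₂ b * y := by
    rw [hy, map_div₀]
    field_simp
  -- If b were not integral, both y and σy would have value less than one, although their difference
  -- is the unit ω − σω.
  have hlt : ∀ y : K₂, algebraMap K₁ K₂ b * y ∈ w.localRing → w.localRing.valuation y < 1 := by
    intro y hy
    rw [← h.mem_iff, ← ValuationSubring.valuation_le_one_iff, not_le] at hb
    rw [← ValuationSubring.valuation_le_one_iff, map_mul] at hy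
    by_contra! hle
    exact (hb.trans_le (le_mul_of_one_le_right zero_le hle)).not_ge hy
  rw [hby] at hz
  have h1 := hlt y hz
  have h2 := hlt (σ y) (by
    rw [← H.map_algebraMap b, ← map_mul, hσ]
    exact hz)
  have h3 := H.valuation_sub w
  have h4 : ω - σ ω = y - σ y := by
    rw [hy, map_add, H.map_algebraMap]; ring
  rw [h4] at h3
  exact (Valuation.map_sub_lt _ h1 h2).ne h3

/-- The equation z² − Tz + N = 0 from trace and norm is divided by a coefficient of largest value,
so that its reduction does not vanish. -/
theorem exists_quadratic (H : IsQuadraticConstantExtension F₂ K₁ σ ω) (v : Place F₁ K₁) (z : K₂) :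
    ∃ p ∈ v.localRing, ∃ q ∈ v.localRing, ∃ r ∈ v.localRing, (p = 1 ∨ q = 1 ∨ r = 1) ∧
      algebraMap K₁ K₂ p * z ^ 2 + algebraMap K₁ K₂ q * z + algebraMap K₁ K₂ r = 0 := by
  obtain ⟨T, hT⟩ := H.exists_of_fixed (z := z + σ z) (by rw [map_add, H.involutive, add_comm])
  obtain ⟨N, hN⟩ := H.exists_of_fixed (z := z * σ z) (by rw [map_mul, H.involutive, mul_comm])
  have heq : z ^ 2 - algebraMap K₁ K₂ T * z + algebraMap K₁ K₂ N = 0 := by rw [hT, hN]; ring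
  have key : ∀ c ≠ 0, v.localRing.valuation 1 ≤ v.localRing.valuation c →
      v.localRing.valuation T ≤ v.localRing.valuation c →
      v.localRing.valuation N ≤ v.localRing.valuation c → (1 / c = 1 ∨ -T / c = 1 ∨ N / c = 1) →
      ∃ p ∈ v.localRing, ∃ q ∈ v.localRing, ∃ r ∈ v.localRing, (p = 1 ∨ q = 1 ∨ r = 1) ∧
      algebraMap K₁ K₂ p * z ^ 2 + algebraMap K₁ K₂ q * z + algebraMap K₁ K₂ r = 0 := by
    intro c hc h1 h2 h3 h4
    rw [ValuationSubring.valuation_le_iff_div_mem _ hc] at h1 h2 h3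
    refine ⟨1 / c, h1, -T / c, neg_div c T ▸ neg_mem h2, N / c, h3, h4, ?_⟩
    have hc' : algebraMap K₁ K₂ c ≠ 0 := by simpa using hc
    simp only [map_div₀, map_neg, map_one]
    field_simp
    linear_combination heq
  have hne : ∀ {a b : K₁}, a ≠ 0 → v.localRing.valuation a ≤ v.localRing.valuation b → b ≠ 0 := by
    rintro a b ha h rfl
    simp [ha] at h
  have hneg : v.localRing.valuation (-T) = v.localRing.valuation T := Valuation.map_neg _ _
  rcases le_total (v.localRing.valuation T) (v.localRing.valuation N) with h | h
  · rcases le_total (v.localRing.valuation 1) (v.localRing.valuation N) with h' | h'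
    · exact key N (hne one_ne_zero h') h' h le_rfl
        (Or.inr (Or.inr (div_self (hne one_ne_zero h'))))
    · exact key 1 one_ne_zero le_rfl (h.trans h') h' (Or.inl (div_self one_ne_zero))
  · rcases le_total (v.localRing.valuation 1) (v.localRing.valuation T) with h' | h'
    · exact key (-T) (neg_ne_zero.mpr (hne one_ne_zero h')) (hneg ▸ h') (hneg ▸ le_rfl) (hneg ▸ h)
        (Or.inr (Or.inl (div_self (neg_ne_zero.mpr (hne one_ne_zero h')))))
    · exact key 1 one_ne_zero le_rfl h' (h.trans h') (Or.inl (div_self one_ne_zero))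

end IsQuadraticConstantExtension

end Places
end

/-! ### Finiteness and size of residue fields. -/

noncomputable section

theorem Field.finite_of_forall_quadratic {κ κ' : Type*} [Field κ] [Field κ'] [Finite κ] (φ : κ →+* κ')
    (h : ∀ z : κ', ∃ p q r : κ, (p ≠ 0 ∨ q ≠ 0 ∨ r ≠ 0) ∧ φ p * z ^ 2 + φ q * z + φ r = 0) :
    Finite κ' := by
  rw [← Set.finite_univ_iff]
  let f : κ × κ × κ → Polynomial κ := fun c =>
    Polynomial.C c.1 * Polynomial.X ^ 2 + Polynomial.C c.2.1 * Polynomial.X + Polynomial.C c.2.2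
  apply (Set.finite_iUnion (f := fun c : κ × κ × κ => (((f c).map φ).rootSet κ'))
    fun c => Polynomial.rootSet_finite _ _).subset
  rintro z -
  obtain ⟨p, q, r, hne, hz⟩ := h z
  rw [Set.mem_iUnion]
  refine ⟨(p, q, r), ?_⟩
  rw [Polynomial.mem_rootSet]
  refine ⟨?_, ?_⟩
  · rw [Ne, Polynomial.map_eq_zero]
    intro h0
    have h2 := congrArg (fun g => Polynomial.coeff g 2) h0
    have h1 := congrArg (fun g => Polynomial.coeff g 1) h0
    have h3 := congrArg (fun g => Polynomial.coeff g 0) h0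
    simp [f, Polynomial.coeff_X, Polynomial.coeff_C] at h1 h2 h3
    tauto
  · simpa [f] using hz

namespace ValuationSubring

variable {L L' : Type*} [Field L] [Field L'] {A : ValuationSubring L} {B : ValuationSubring L'}

/-- The homomorphism between valuation rings, one of which lies over the other. -/
def mapOfMemIff (f : L →+* L') (h : ∀ z, f z ∈ B ↔ z ∈ A) : A →+* B :=
  (f.comp A.subtype).codRestrict B.toSubring fun x => (h _).mpr x.2

instance isLocalHom_mapOfMemIff (f : L →+* L') (h : ∀ z, f z ∈ B ↔ z ∈ A) :
    IsLocalHom (mapOfMemIff f h) := by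
  refine ⟨fun a ha => ?_⟩
  obtain ⟨b, hb⟩ := isUnit_iff_exists_inv.mp ha
  have hb' : f a * (b : L') = 1 := congrArg Subtype.val hb
  have ha0 : (a : L) ≠ 0 := by
    intro h0
    simp [h0] at hb'
  have hinv : (a : L)⁻¹ ∈ A := by
    rw [← h, map_inv₀, inv_eq_of_mul_eq_one_right hb']
    exact b.2
  exact isUnit_iff_exists_inv.mpr ⟨⟨_, hinv⟩, Subtype.ext (mul_inv_cancel₀ ha0)⟩

end ValuationSubring

namespace IsQuadraticConstantExtension
variable {F₁ F₂ K₁ K₂ : Type*} [Field F₁] [Field F₂] [Field K₁] [Field K₂] [Algebra F₁ K₁]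
  [Algebra F₂ K₂] [Algebra K₁ K₂] {σ : K₂ →+* K₂} {ω : K₂}

theorem residueCard_le (H : IsQuadraticConstantExtension F₂ K₁ σ ω) {v : Place F₁ K₁}
    {w : Place F₂ K₂} (h : ∀ z, algebraMap K₁ K₂ z ∈ w.localRing ↔ z ∈ v.localRing)
    (hv : v.residueCard ≠ 0) : v.residueCard ≤ w.residueCard := by
  have hfin : Finite (IsLocalRing.ResidueField v.localRing) := Nat.finite_of_card_ne_zero hv
  let φ := IsLocalRing.ResidueField.map (ValuationSubring.mapOfMemIff (algebraMap K₁ K₂) h)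
  -- `Nat.card` is zero on infinite types, so finiteness must come before the comparison of
  -- cardinalities.
  have : Finite (IsLocalRing.ResidueField w.localRing) := by
    apply Field.finite_of_forall_quadratic φ
    intro z
    obtain ⟨z, rfl⟩ := IsLocalRing.residue_surjective z
    obtain ⟨p, hp, q, hq, r, hr, h1, h0⟩ := H.exists_quadratic v z
    refine ⟨IsLocalRing.residue _ ⟨p, hp⟩, IsLocalRing.residue _ ⟨q, hq⟩,
      IsLocalRing.residue _ ⟨r, hr⟩, ?_, ?_⟩
    · rcases h1 with rfl | rfl | rfl
      · exact Or.inl (by erw [map_one]; exact one_ne_zero)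
      · exact Or.inr (Or.inl (by erw [map_one]; exact one_ne_zero))
      · exact Or.inr (Or.inr (by erw [map_one]; exact one_ne_zero))
    · simp only [φ, IsLocalRing.ResidueField.map_residue, ← map_pow, ← map_mul, ← map_add]
      refine (congrArg _ (Subtype.ext ?_)).trans (map_zero (IsLocalRing.residue w.localRing))
      exact h0
  exact Nat.card_le_card_of_injective φ φ.injective

end IsQuadraticConstantExtension
end

/-! ### Completions, adic completeness and Hensel's lemma. -/

noncomputable section
open Topology

namespace ValuationSubring

variable {L : Type*} [Field L] {A : ValuationSubring L} {π : L}

theorem mem_maximalIdeal_iff_lt_one (x : A) :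
    x ∈ IsLocalRing.maximalIdeal A ↔ A.valuation x < 1 :=
  A.valuation_lt_one_iff x

namespace IsUniformizer

theorem mem (h : A.IsUniformizer π) : π ∈ A :=
  (A.valuation_le_one_iff π).mp h.lt_one.le

theorem mem_maximalIdeal_pow_iff (h : A.IsUniformizer π) (N : ℕ) (e : A) :
    e ∈ IsLocalRing.maximalIdeal A ^ N ↔ (e : L) / π ^ N ∈ A := by
  have hspan : IsLocalRing.maximalIdeal A = Ideal.span {⟨π, h.mem⟩} := by
    ext x
    rw [A.valuation_lt_one_iff, Ideal.mem_span_singleton]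
    constructor
    · intro hx
      have := h.le _ hx
      rw [valuation_le_iff_div_mem _ h.ne_zero] at this
      exact ⟨⟨_, this⟩, Subtype.ext (mul_div_cancel₀ _ h.ne_zero).symm⟩
    · rintro ⟨c, rfl⟩
      rw [MulMemClass.coe_mul, map_mul]
      exact mul_lt_one_of_lt_of_le h.lt_one (A.valuation_le_one c)
  have hπN := pow_ne_zero N h.ne_zero
  rw [hspan, Ideal.span_singleton_pow, Ideal.mem_span_singleton]
  constructor
  · rintro ⟨c, rfl⟩
    have : (((⟨π, h.mem⟩ : A) ^ N * c : A) : L) = π ^ N * c := rfl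
    rw [this, mul_div_cancel_left₀ _ hπN]
    exact c.2
  · exact fun he => ⟨⟨_, he⟩, Subtype.ext (mul_div_cancel₀ _ hπN).symm⟩

end IsUniformizer

end ValuationSubring

theorem Valued.hasBasis_nhds_zero_of_field {L Γ : Type*} [Field L]
    [LinearOrderedCommGroupWithZero Γ] [hv : Valued L Γ] :
    (𝓝 (0 : L)).HasBasis (fun d => d ≠ 0) fun d => {x | hv.v x < hv.v d} := by
  refine (Valued.hasBasis_nhds_zero L Γ).to_hasBasis (fun γ _ => ?_) fun d hd => ?_
  · obtain ⟨d, hd⟩ := MonoidWithZeroHom.ValueGroup₀.restrict₀_surjective (.ofClass hv.v) γ.1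
    rw [← Valuation.restrict_def] at hd
    refine ⟨d, ?_, fun x hx => ?_⟩
    · rintro rfl
      rw [map_zero] at hd
      exact γ.ne_zero hd.symm
    · change hv.v.restrict x < γ.1
      rw [← hd]
      exact hv.v.restrict_lt_iff.mpr hx
  · have h' : hv.v.restrict d ≠ 0 := by simpa using hd
    exact ⟨Units.mk0 _ h', trivial, fun x hx => hv.v.restrict_lt_iff.mp hx⟩

namespace Place

variable {k K : Type*} [Field k] [Field K] [Algebra k K] (v : Place k K)

theorem valued_toCompletion (x : K) : Valued.v (v.toCompletion x) = v.localRing.valuation x := by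
  change Valued.v ((WithVal.toVal v.localRing.valuation x : WithVal v.localRing.valuation) :
    v.completion) = _
  rw [Valued.valuedCompletion_apply]
  rfl

theorem denseRange_toCompletion : DenseRange v.toCompletion :=
  UniformSpace.Completion.denseRange_coe.comp
    (WithVal.toVal_surjective (v := v.localRing.valuation)).denseRange
    (UniformSpace.Completion.continuous_coe _)

theorem mem_integers_iff (x : v.completion) : x ∈ v.integers ↔ Valued.v x ≤ 1 :=
  Iff.rfl

theorem toCompletion_mem_integers (x : K) : v.toCompletion x ∈ v.integers ↔ x ∈ v.localRing := by
  rw [mem_integers_iff, valued_toCompletion, ValuationSubring.valuation_le_one_iff]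

theorem valuation_integers_le_iff (x y : v.completion) :
    v.integers.valuation x ≤ v.integers.valuation y ↔ Valued.v x ≤ Valued.v y := by
  rcases eq_or_ne y 0 with rfl | hy
  · simp
  rw [ValuationSubring.valuation_le_iff_div_mem _ hy, mem_integers_iff, map_div₀,
    div_le_one₀ (by simpa [zero_lt_iff] using hy)]

theorem valuation_integers_lt_iff (x y : v.completion) :
    v.integers.valuation x < v.integers.valuation y ↔ Valued.v x < Valued.v y := by
  rw [← not_le, ← not_le, valuation_integers_le_iff]

theorem exists_valued_sub_lt (x : v.completion) {d : v.completion} (hd : d ≠ 0) :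
    ∃ a : K, Valued.v (v.toCompletion a - x) < Valued.v d := by
  have hmem : {y | Valued.v (y - x) < Valued.v d} ∈ 𝓝 x := by
    rw [← nhds_translation_sub x]
    exact ⟨_, Valued.hasBasis_nhds_zero_of_field.mem_of_mem hd, fun y hy => hy⟩
  obtain ⟨_, hy, a, rfl⟩ := (mem_closure_iff_nhds.mp (v.denseRange_toCompletion x)) _ hmem
  exact ⟨a, hy⟩

theorem exists_valued_eq {x : v.completion} (hx : x ≠ 0) :
    ∃ a : K, a ≠ 0 ∧ Valued.v x = v.localRing.valuation a := by
  obtain ⟨a, ha⟩ := v.exists_valued_sub_lt x hx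
  have := Valuation.map_add_eq_of_lt_left _ ha
  rw [add_sub_cancel, valued_toCompletion] at this
  refine ⟨a, ?_, this.symm⟩
  rintro rfl
  rw [map_zero] at this
  exact hx ((map_eq_zero _).mp this.symm)

variable {v}

theorem isUniformizer_integers {π : K} (h : v.localRing.IsUniformizer π) :
    v.integers.IsUniformizer (v.toCompletion π) := by
  refine ⟨by simpa using h.ne_zero, ?_, fun x hx => ?_, fun x hx => ?_⟩
  · rw [← map_one v.integers.valuation, valuation_integers_lt_iff, valued_toCompletion, map_one]
    exact h.lt_one
  · rw [valuation_integers_le_iff, valued_toCompletion]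
    rw [← map_one v.integers.valuation, valuation_integers_lt_iff, map_one] at hx
    rcases eq_or_ne x 0 with rfl | hx0
    · simp
    obtain ⟨a, -, ha⟩ := v.exists_valued_eq hx0
    rw [ha] at hx ⊢
    exact h.le a hx
  · obtain ⟨a, ha0, ha⟩ := v.exists_valued_eq hx
    obtain ⟨n, hn⟩ := h.exists_pow_le a ha0
    refine ⟨n, ?_⟩
    rw [← map_pow, valuation_integers_le_iff, map_pow, valued_toCompletion, ha]
    exact hn

/-- Powers of a uniformizer are cofinal among nonzero values, so the adic and the valuation topology
agree and adic Cauchy sequences converge in the completion. -/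
theorem isAdicComplete_integers {π : K} (h : v.localRing.IsUniformizer π) :
    IsAdicComplete (IsLocalRing.maximalIdeal v.integers) v.integers := by
  have hu := isUniformizer_integers h
  set ϖ := v.toCompletion π
  have hmem : ∀ (N : ℕ) (x y : v.integers),
      x ≡ y [SMOD (IsLocalRing.maximalIdeal v.integers ^ N • ⊤ : Submodule v.integers v.integers)] ↔
        Valued.v ((x : v.completion) - y) ≤ Valued.v (ϖ ^ N) := by
    intro N x y
    rw [SModEq.sub_mem, Ideal.smul_top_eq_map, Algebra.algebraMap_self, Ideal.map_id,
      Submodule.restrictScalars_mem, hu.mem_maximalIdeal_pow_iff,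
      ← ValuationSubring.valuation_le_iff_div_mem _ (pow_ne_zero N hu.ne_zero),
      valuation_integers_le_iff]
    rfl
  have hsmall : ∀ d : v.completion, d ≠ 0 → ∃ N, Valued.v (ϖ ^ N) ≤ Valued.v d := by
    intro d hd
    obtain ⟨n, hn⟩ := hu.exists_pow_le d hd
    rw [← map_pow, valuation_integers_le_iff] at hn
    exact ⟨n, hn⟩
  have hanti : ∀ {m n : ℕ}, m ≤ n → Valued.v (ϖ ^ n) ≤ Valued.v (ϖ ^ m) := by
    intro m n hmn
    rw [← valuation_integers_le_iff, map_pow, map_pow]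
    exact pow_le_pow_of_le_one zero_le hu.lt_one.le hmn
  have hstrict : ∀ N : ℕ, Valued.v (ϖ ^ (N + 1)) < Valued.v (ϖ ^ N) := by
    intro N
    rw [← valuation_integers_lt_iff, map_pow, map_pow, pow_succ]
    exact mul_lt_of_lt_one_right (by
      simpa [zero_lt_iff] using pow_ne_zero N hu.ne_zero) hu.lt_one
  refine { haus' := fun x hx => ?_, prec' := fun f hf => ?_ }
  · by_contra hx0
    obtain ⟨N, hN⟩ := hsmall x (by simpa using hx0)
    have h1 := (hmem _ _ _).mp (hx (N + 1))
    rw [ZeroMemClass.coe_zero, sub_zero] at h1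
    exact (h1.trans_lt (hstrict N)).not_ge hN
  · simp only [hmem] at hf ⊢
    have hcauchy : CauchySeq fun n => (f n : v.completion) := by
      rw [Valued.hasBasis_nhds_zero_of_field.uniformity_of_nhds_zero.cauchySeq_iff']
      intro d hd
      obtain ⟨N, hN⟩ := hsmall d hd
      refine ⟨N + 1, fun n hn => ?_⟩
      have := hf hn
      exact (this.trans_lt (hstrict N)).trans_le hN
    obtain ⟨l, hl⟩ := cauchySeq_tendsto_of_complete hcauchy
    have hle : ∀ n, Valued.v ((f n : v.completion) - l) ≤ Valued.v (ϖ ^ n) := by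
      intro n
      have hev : ∀ᶠ m in Filter.atTop, Valued.v ((f m : v.completion) - l) < Valued.v (ϖ ^ n) := by
        have : Filter.Tendsto (fun m => (f m : v.completion) - l) Filter.atTop (𝓝 0) := by
          simpa using hl.sub_const l
        exact this.eventually (Valued.hasBasis_nhds_zero_of_field.mem_of_mem
          (pow_ne_zero n hu.ne_zero))
      obtain ⟨m, hm, hmn⟩ := (hev.and (Filter.eventually_ge_atTop n)).exists
      have := Valued.v.map_add ((f n : v.completion) - f m) (f m - l)
      rw [sub_add_sub_cancel] at this
      exact this.trans (max_le (hf hmn) hm.le)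
    refine ⟨⟨l, ?_⟩, hle⟩
    have h0 := Valued.v.map_sub (f 0 : v.completion) (f 0 - l)
    rw [sub_sub_cancel] at h0
    rw [mem_integers_iff]
    exact h0.trans (max_le (f 0).2 (by simpa using hle 0))

/-- Hensel's lemma for quadratic polynomials. -/
theorem exists_root_quadratic {π : K} (h : v.localRing.IsUniformizer π) {B D y₀ : v.integers}
    (hy₀ : IsLocalRing.residue v.integers (y₀ ^ 2 + B * y₀ + D) = 0)
    (hne : IsLocalRing.residue v.integers (2 * y₀ + B) ≠ 0) :
    ∃ y : v.integers, y ^ 2 + B * y + D = 0 ∧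
      IsLocalRing.residue v.integers y = IsLocalRing.residue v.integers y₀ := by
  have := isAdicComplete_integers h
  have hroot := HenselianRing.is_henselian (I := IsLocalRing.maximalIdeal v.integers)
    (Polynomial.X ^ 2 + Polynomial.C B * Polynomial.X + Polynomial.C D) (by monicity!) y₀
    (by
      rw [← IsLocalRing.residue_eq_zero_iff, ← hy₀]
      simp)
    (by
      have : (Polynomial.X ^ 2 + Polynomial.C B * Polynomial.X + Polynomial.C D).derivative.eval y₀
          = 2 * y₀ + B := by simp [one_add_one_eq_two]
      rw [this]
      exact IsUnit.mk0 (G₀ := IsLocalRing.ResidueField v.integers) _ hne)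
  obtain ⟨y, hy, hyy⟩ := hroot
  refine ⟨y, by simpa [Polynomial.IsRoot] using hy, ?_⟩
  rw [← IsLocalRing.residue_eq_zero_iff, map_sub, sub_eq_zero] at hyy
  exact hyy

section Map

variable {k' K' k'' K'' : Type*} [Field k'] [Field K'] [Algebra k' K'] [Field k''] [Field K'']
  [Algebra k'' K''] {φ : K →+* K'} {v : Place k K} {w : Place k' K'} {u : Place k'' K''}

/-- Powers of the common uniformizer give neighbourhood bases of zero on both sides. -/
theorem IsUnramified.continuous (h : IsUnramified φ v w) :
    Continuous ((WithVal.equiv w.localRing.valuation).symm.toRingHom.comp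
      (φ.comp (WithVal.equiv v.localRing.valuation).toRingHom)) := by
  obtain ⟨π, hπ, hπw⟩ := h.exists_isUniformizer
  apply continuous_of_continuousAt_zero
  rw [ContinuousAt, map_zero]
  refine (Valued.hasBasis_nhds_zero_of_field.tendsto_iff
    Valued.hasBasis_nhds_zero_of_field).mpr fun d hd => ?_
  obtain ⟨n, hn⟩ := hπw.exists_pow_le d.ofVal (by simpa using hd)
  refine ⟨WithVal.toVal _ (π ^ n), by
    rw [Ne, WithVal.toVal_eq_zero]
    exact pow_ne_zero n hπ.ne_zero, fun x hx => ?_⟩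
  change w.localRing.valuation (φ x.ofVal) < w.localRing.valuation d.ofVal
  rw [← map_pow, ← map_pow] at hn
  exact ((valuation_lt_iff_of_mem_iff h.mem_iff).mpr hx).trans_le hn

/-- The embedding of completions at two places, one of which lies over the other. -/
def completionMap (h : IsUnramified φ v w) : v.completion →+* w.completion :=
  UniformSpace.Completion.mapRingHom _ h.continuous

theorem continuous_completionMap (h : IsUnramified φ v w) : Continuous (completionMap h) :=
  UniformSpace.Completion.continuous_map

@[simp]
theorem completionMap_toCompletion (h : IsUnramified φ v w) (x : K) :
    completionMap h (v.toCompletion x) = w.toCompletion (φ x) :=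
  UniformSpace.Completion.mapRingHom_coe h.continuous _

theorem completionMap_completionMap {ψ : K' →+* K''} {χ : K →+* K''} (h : IsUnramified φ v w)
    (h' : IsUnramified ψ w u) (h'' : IsUnramified χ v u) (hχ : ∀ z, ψ (φ z) = χ z)
    (x : v.completion) : completionMap h' (completionMap h x) = completionMap h'' x := by
  refine congrFun (v.denseRange_toCompletion.equalizer
    ((continuous_completionMap h').comp (continuous_completionMap h))
    (continuous_completionMap h'') ?_) x
  ext z
  simp [hχ]

/-- Both rings of integers are clopen, so the equivalence need only be checked on the dense
subfield. -/
theorem completionMap_mem_iff (h : IsUnramified φ v w) (x : v.completion) :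
    completionMap h x ∈ w.integers ↔ x ∈ v.integers := by
  have hv : IsClopen (v.integers : Set v.completion) := Valued.isClopen_valuationSubring _
  have hw : IsClopen (completionMap h ⁻¹' (w.integers : Set w.completion)) :=
    (Valued.isClopen_valuationSubring _).preimage (continuous_completionMap h)
  refine v.denseRange_toCompletion.induction_on
    (p := fun x => completionMap h x ∈ w.integers ↔ x ∈ v.integers) x ?_ fun a => ?_
  · convert (hv.inter hw).isClosed.union (hv.compl.inter hw.compl).isClosed using 1
    ext y
    simp only [Set.mem_ofPred_eq, Set.mem_union, Set.mem_inter_iff, Set.mem_compl_iff,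
      Set.mem_preimage, SetLike.mem_coe]
    tauto
  · rw [completionMap_toCompletion, toCompletion_mem_integers, toCompletion_mem_integers, h.mem_iff]

end Map

end Place
end

/-! ### Residue field extensions at self-conjugate places. -/

noncomputable section

/-- A quadratic polynomial over a finite field has a root in any quadratic extension. -/
theorem FiniteField.exists_root_quadratic {κ κ' : Type*} [Field κ] [Field κ'] [Finite κ]
    (φ : κ →+* κ') {ω : κ'} (hω : ∀ c, φ c ≠ ω) (hspan : ∀ z, ∃ a b, z = φ a + φ b * ω) (B D : κ) :
    ∃ y : κ', y ^ 2 + φ B * y + φ D = 0 := by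
  have := Fintype.ofFinite κ
  let g : κ × κ → κ' := fun c => φ c.1 + φ c.2 * ω
  have hg : Function.Bijective g := by
    refine ⟨?_, fun z => ?_⟩
    · rintro ⟨a, b⟩ ⟨c, d⟩ h
      have h' : φ a + φ b * ω = φ c + φ d * ω := h
      have hbd : b = d := by
        by_contra hne
        have hne' : φ d - φ b ≠ 0 := by rwa [← map_sub, Ne, map_eq_zero, sub_eq_zero, eq_comm]
        refine hω ((a - c) / (d - b)) ?_
        rw [map_div₀, map_sub, map_sub, div_eq_iff hne']
        linear_combination h'
      subst hbd
      rw [add_left_inj] at h'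
      rw [φ.injective h']
    · obtain ⟨a, b, h⟩ := hspan z
      exact ⟨(a, b), h.symm⟩
  have := Fintype.ofBijective g hg
  have hcard : Fintype.card κ' = Fintype.card κ * Fintype.card κ := by
    rw [← Fintype.card_prod, Fintype.card_of_bijective hg]
  let Ω := AlgebraicClosure κ'
  let ψ : κ →+* Ω := (algebraMap κ' Ω).comp φ
  algebraize [ψ]
  obtain ⟨ρ, hρ⟩ := IsAlgClosed.exists_root (Polynomial.C (1 : Ω) * Polynomial.X ^ 2 +
    Polynomial.C (ψ B) * Polynomial.X + Polynomial.C (ψ D))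
    (by rw [Polynomial.degree_quadratic one_ne_zero]; norm_num)
  simp only [Polynomial.IsRoot, Polynomial.eval_add, Polynomial.eval_mul, Polynomial.eval_C,
      Polynomial.eval_pow, Polynomial.eval_X, one_mul] at hρ
  let F := FiniteField.frobeniusAlgHom κ Ω
  have hF : ∀ z, F z = z ^ Fintype.card κ := fun z => rfl
  have hFψ : ∀ a, F (ψ a) = ψ a := fun a => F.commutes a
  have hρF := congrArg F hρ
  simp only [map_add, map_mul, map_pow, hFψ, map_zero] at hρF
  -- The Frobenius of κ permutes the two roots, so its square fixes ρ; that square is the power map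
  -- of exponent #κ′, whose fixed points are the elements of κ′.
  have hfix : F (F ρ) = ρ := by
    have hprod : (F ρ - ρ) * (F ρ + ρ + ψ B) = 0 := by linear_combination hρF - hρ
    rcases mul_eq_zero.mp hprod with h | h
    · rw [sub_eq_zero.mp h, sub_eq_zero.mp h]
    · have h' := congrArg F h
      simp only [map_add, hFψ, map_zero] at h'
      linear_combination h' - h
  rw [hF, hF, ← pow_mul, ← hcard] at hfix
  have hprod := congrArg (Polynomial.aeval ρ) (Polynomial.X_pow_card_sub_X_eq_prod (κ := κ'))
  simp only [map_sub, map_pow, Polynomial.aeval_X, hfix, sub_self, map_prod,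
    Polynomial.aeval_C] at hprod
  obtain ⟨y, -, hy⟩ := Finset.prod_eq_zero_iff.mp hprod.symm
  refine ⟨y, (algebraMap κ' Ω).injective ?_⟩
  rw [sub_eq_zero.mp hy] at hρ
  rw [map_add, map_add, map_mul, map_pow, map_zero]
  exact hρ

namespace Place

variable {k k' K K' : Type*} [Field k] [Field K] [Algebra k K] [Field k']
    [Field K'] [Algebra k' K'] {φ : K →+* K'} {v : Place k K} {w : Place k' K'}

/-- The residue field of the completion. -/
abbrev residueField (v : Place k K) : Type _ := IsLocalRing.ResidueField v.integers

theorem exists_residue_toCompletion (v : Place k K) (z : v.residueField) :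
    ∃ (a : K) (ha : a ∈ v.localRing),
      IsLocalRing.residue v.integers ⟨v.toCompletion a, (v.toCompletion_mem_integers a).mpr ha⟩
        = z := by
  obtain ⟨z, rfl⟩ := IsLocalRing.residue_surjective z
  obtain ⟨a, ha⟩ := v.exists_valued_sub_lt z (d := 1) one_ne_zero
  have hint : v.toCompletion a ∈ v.integers := by
    rw [← sub_add_cancel (v.toCompletion a) z]
    refine add_mem ?_ z.2
    rw [mem_integers_iff, ← map_one (Valued.v : Valuation v.completion _)]
    exact ha.le
  refine ⟨a, (v.toCompletion_mem_integers a).mp hint, ?_⟩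
  rw [← sub_eq_zero, ← map_sub, IsLocalRing.residue_eq_zero_iff,
    ValuationSubring.mem_maximalIdeal_iff_lt_one, ← map_one v.integers.valuation,
    valuation_integers_lt_iff]
  exact ha

theorem natCard_residueField (v : Place k K) : Nat.card v.residueField = v.residueCard := by
  let f : IsLocalRing.ResidueField v.localRing →+* v.residueField :=
    IsLocalRing.ResidueField.map
      (ValuationSubring.mapOfMemIff v.toCompletion v.toCompletion_mem_integers)
  refine (Nat.card_congr (Equiv.ofBijective f ⟨f.injective, fun z => ?_⟩)).symm
  obtain ⟨a, ha, h⟩ := v.exists_residue_toCompletion z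
  exact ⟨IsLocalRing.residue _ ⟨a, ha⟩, h⟩

/-- The homomorphism of complete local rings at two places, one of which lies over the other. -/
def integersMap (h : IsUnramified φ v w) : v.integers →+* w.integers :=
  ValuationSubring.mapOfMemIff (completionMap h) (completionMap_mem_iff h)

@[simp]
theorem coe_integersMap (h : IsUnramified φ v w) (x : v.integers) :
    (integersMap h x : w.completion) = completionMap h x :=
  rfl

instance isLocalHom_integersMap (h : IsUnramified φ v w) : IsLocalHom (integersMap h) :=
  ValuationSubring.isLocalHom_mapOfMemIff _ _

/-- The extension of residue fields at two places, one of which lies over the other. -/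
def residueMap (h : IsUnramified φ v w) : v.residueField →+* w.residueField :=
  IsLocalRing.ResidueField.map (integersMap h)

@[simp]
theorem residueMap_residue (h : IsUnramified φ v w) (x : v.integers) :
    residueMap h (IsLocalRing.residue _ x) = IsLocalRing.residue _ (integersMap h x) :=
  rfl

/-- Divisibility by powers of the maximal ideal descends along an unramified extension. -/
theorem integersMap_mem_pow_iff (h : IsUnramified φ v w) (N : ℕ) (x : v.integers) :
    integersMap h x ∈ IsLocalRing.maximalIdeal w.integers ^ N ↔
      x ∈ IsLocalRing.maximalIdeal v.integers ^ N := by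
  obtain ⟨π, hπ, hπw⟩ := h.exists_isUniformizer
  rw [(isUniformizer_integers hπ).mem_maximalIdeal_pow_iff,
    (isUniformizer_integers hπw).mem_maximalIdeal_pow_iff, ← completionMap_mem_iff h, map_div₀,
    map_pow, completionMap_toCompletion]
  rfl

end Place

namespace IsQuadraticConstantExtension

variable {F₁ F₂ K₁ K₂ : Type*} [Field F₁] [Field F₂] [Field K₁] [Field K₂] [Algebra F₁ K₁]
  [Algebra F₂ K₂] [Algebra K₁ K₂] {σ : K₂ →+* K₂} {ω : K₂}

/-- The image of the generator in the residue field of a place. -/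
def residueGenerator (H : IsQuadraticConstantExtension F₂ K₁ σ ω) (w : Place F₂ K₂) :
    w.residueField :=
  IsLocalRing.residue w.integers
    ⟨w.toCompletion ω, (w.toCompletion_mem_integers ω).mpr (H.mem_localRing w)⟩

variable {v : Place F₁ K₁} {w : Place F₂ K₂}

theorem exists_residue_eq (H : IsQuadraticConstantExtension F₂ K₁ σ ω)
    (h : Place.IsUnramified (algebraMap K₁ K₂) v w)
    (hσ : ∀ z, σ z ∈ w.localRing ↔ z ∈ w.localRing) (z : w.residueField) :
    ∃ a b, z = Place.residueMap h a + Place.residueMap h b * H.residueGenerator w := by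
  obtain ⟨z, hz, rfl⟩ := w.exists_residue_toCompletion z
  obtain ⟨a, ha, b, hb, rfl⟩ := H.exists_eq_of_mem h hσ hz
  refine ⟨IsLocalRing.residue _ ⟨_, (v.toCompletion_mem_integers a).mpr ha⟩,
    IsLocalRing.residue _ ⟨_, (v.toCompletion_mem_integers b).mpr hb⟩, ?_⟩
  rw [residueGenerator, Place.residueMap_residue, Place.residueMap_residue, ← map_mul, ← map_add]
  congr 1
  ext
  simp

/-- ω − σω is a unit, so σ acts nontrivially on the residue field: a self-conjugate place is inert.
-/
theorem residueMap_conj_residueGenerator (H : IsQuadraticConstantExtension F₂ K₁ σ ω)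
    (h : Place.IsUnramified σ w w) :
    Place.residueMap h (H.residueGenerator w) ≠ H.residueGenerator w := by
  rw [residueGenerator, Place.residueMap_residue, ne_comm, Ne, ← sub_eq_zero, ← map_sub,
    IsLocalRing.residue_eq_zero_iff, ValuationSubring.mem_maximalIdeal_iff_lt_one,
    ← map_one w.integers.valuation, Place.valuation_integers_lt_iff]
  have hval : Valued.v (w.toCompletion (ω - σ ω)) = 1 := by
    rw [Place.valued_toCompletion, H.valuation_sub]
  rw [map_sub] at hval
  rw [AddSubgroupClass.coe_sub, Place.coe_integersMap, Place.completionMap_toCompletion, hval,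
    map_one]
  exact lt_irrefl _

theorem integersMap_conj_integersMap (H : IsQuadraticConstantExtension F₂ K₁ σ ω)
    {w' : Place F₂ K₂} (h : Place.IsUnramified (algebraMap K₁ K₂) v w)
    (h' : Place.IsUnramified (algebraMap K₁ K₂) v w') (hw : Place.IsUnramified σ w w')
    (x : v.integers) :
    Place.integersMap hw (Place.integersMap h x) = Place.integersMap h' x :=
  Subtype.ext (Place.completionMap_completionMap h hw h' H.map_algebraMap _)

end IsQuadraticConstantExtension
end

/-! ### Isomorphisms between smooth models are integral. -/

noncomputable section
open MvPolynomial

section SubstLinear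

variable {R : Type*} [CommRing R] {n : ℕ}

theorem substLinear_substLinear (g h : Matrix (Fin (n + 1)) (Fin (n + 1)) R)
    (F : MvPolynomial (Fin (n + 1)) R) :
    substLinear h (substLinear g F) = substLinear (g * h) F := by
  rw [substLinear, substLinear, substLinear, bind₁_bind₁]
  congr 2
  ext1 i
  simp only [map_sum, map_mul, bind₁_C_right, bind₁_X_right, Matrix.mul_apply, Finset.mul_sum,
    Finset.sum_mul]
  rw [Finset.sum_comm]
  simp only [mul_assoc]

theorem substLinear_one (F : MvPolynomial (Fin (n + 1)) R) : substLinear 1 F = F := by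
  have : (fun i => ∑ j, C ((1 : Matrix (Fin (n + 1)) (Fin (n + 1)) R) i j) * X j) =
      (X : Fin (n + 1) → MvPolynomial (Fin (n + 1)) R) := by
    ext1 i
    simp [Matrix.one_apply]
  rw [substLinear, this, bind₁_X_left]
  rfl

theorem substLinear_C_mul (g : Matrix (Fin (n + 1)) (Fin (n + 1)) R) (c : R)
    (F : MvPolynomial (Fin (n + 1)) R) : substLinear g (C c * F) = C c * substLinear g F := by
  simp [substLinear]

theorem polar_C_mul {ι : Type*} [Fintype ι] (c : R) (F : MvPolynomial ι R) (x y : ι → R) :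
    polar (C c * F) x y = c * polar F x y := by
  simp [polar_mul, polar_C]

theorem polar_smul_smul {ι : Type*} [Fintype ι] {F : MvPolynomial ι R}
    (hF : F.IsHomogeneous 3) (a b : R) (x y : ι → R) :
    polar F (a • x) (b • y) = a ^ 2 * b * polar F x y := by
  rw [polar_smul_left hF, polar_smul_right]; ring

theorem thirdPoint_smul {ι : Type*} [Fintype ι] {F : MvPolynomial ι R} (hF : F.IsHomogeneous 3)
    (a b : R) (x y : ι → R) :
    thirdPoint F (a • x) (b • y) = (a ^ 2 * b ^ 2) • thirdPoint F x y := by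
  ext j
  simp only [thirdPoint, polar_smul_smul hF, Pi.add_apply, Pi.smul_apply, smul_eq_mul]
  ring

theorem mulVec_thirdPoint_substLinear (g : Matrix (Fin (n + 1)) (Fin (n + 1)) R) (c : R)
    (F : MvPolynomial (Fin (n + 1)) R) (x y : Fin (n + 1) → R) :
    g.mulVec (thirdPoint (C c * substLinear g F) x y) =
      c • thirdPoint F (g.mulVec x) (g.mulVec y) := by
  simp only [thirdPoint, polar_C_mul, polar_substLinear, Matrix.mulVec_add, Matrix.mulVec_smul,
    smul_add, smul_smul, mul_neg]

end SubstLinear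

section Integral

variable {L : Type*} [Field L] (A : ValuationSubring L) {n : ℕ}

/-- Divide by an entry of largest value. -/
theorem ValuationSubring.exists_smul_eq_map {m : Type*} [Finite m] {g : Matrix m m L} (hg : g ≠ 0) :
    ∃ α : L, α ≠ 0 ∧ ∃ U : Matrix m m A, (∃ i j, U i j = 1) ∧ g = α • U.map A.subtype := by
  have := Fintype.ofFinite m
  obtain ⟨i, j, hij⟩ : ∃ i j, g i j ≠ 0 := by
    by_contra! h
    exact hg (Matrix.ext h)
  obtain ⟨⟨a, b⟩, -, hmax⟩ := Finset.univ.exists_max_image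
    (fun p : m × m => A.valuation (g p.1 p.2)) ⟨(i, j), Finset.mem_univ _⟩
  have hab : g a b ≠ 0 := by
    intro h0
    have := hmax (i, j) (Finset.mem_univ _)
    simp only [h0, map_zero, le_zero_iff, map_eq_zero] at this
    exact hij this
  refine ⟨g a b, hab, fun c d => ⟨g c d / g a b, ?_⟩, ⟨a, b, Subtype.ext (div_self hab)⟩, ?_⟩
  · rw [← valuation_le_iff_div_mem _ hab]
    exact hmax (c, d) (Finset.mem_univ _)
  · ext c d
    exact (mul_div_cancel₀ _ hab).symm

variable {A}

/-- The primitive column e of V is sent by the frame to β times a basis vector. By smoothness of the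
closed fibre, `G₂` or one of its partial derivatives is a unit at e, and the relation makes each of
them divisible by cβ²α. -/
theorem IsSmoothCubic.inv_mem_of_substLinear {G₁ G₂ : MvPolynomial (Fin (n + 1)) A}
    (h₁ : G₁.IsHomogeneous 3) (h₂ : IsSmoothCubic (map (IsLocalRing.residue A) G₂)) {c α β : L}
    (hβ : β ≠ 0) {U V : Matrix (Fin (n + 1)) (Fin (n + 1)) A} {i₀ j₀ : Fin (n + 1)}
    (hV : V i₀ j₀ = 1) (hUV : (α • U.map A.subtype) * (β⁻¹ • V.map A.subtype) = 1)
    (hrel : map A.subtype G₂ =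
      C c * substLinear (α • U.map A.subtype) (map A.subtype G₁)) :
    (c * β ^ 2 * α)⁻¹ ∈ A := by
  set e : Fin (n + 1) → A := fun i => V i j₀ with he
  set e' : Fin (n + 1) → L := fun i => A.subtype (e i) with he'
  have h₁' : (map A.subtype G₁).IsHomogeneous 3 := h₁.map _
  have hge : (α • U.map A.subtype).mulVec e' = β • Pi.single j₀ 1 := by
    have : e' = β • (β⁻¹ • V.map A.subtype).mulVec (Pi.single j₀ 1) := by
      rw [Matrix.smul_mulVec, smul_smul, mul_inv_cancel₀ hβ, one_smul, Matrix.mulVec_single_one]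
      rfl
    rw [this, Matrix.mulVec_smul, Matrix.mulVec_mulVec, hUV, Matrix.one_mulVec]
  suffices h : ∃ d r : A, IsUnit d ∧ (d : L) = (c * β ^ 2 * α) * r by
    obtain ⟨d, r, hd, hdr⟩ := h
    obtain ⟨d', hd'⟩ := isUnit_iff_exists_inv.mp hd
    have hd1 : (d : L) * d' = 1 := congrArg Subtype.val hd'
    rw [hdr] at hd1
    have : (c * β ^ 2 * α)⁻¹ = (r * d' : A) := by
      apply inv_eq_of_mul_eq_one_right
      rw [← hd1, MulMemClass.coe_mul]; ring
    rw [this]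
    exact (r * d').2
  by_cases h0 : eval (fun i => IsLocalRing.residue A (e i)) (map (IsLocalRing.residue A) G₂) = 0
  · obtain ⟨i, hi⟩ := h₂.not_singular (x := fun i => IsLocalRing.residue A (e i)) (fun h => by
      have := congrFun h i₀
      simp only [he, hV, map_one] at this
      exact one_ne_zero this) h0
    rw [pderiv_map, ← map_eval', IsLocalRing.residue_ne_zero_iff_isUnit] at hi
    refine ⟨_, polar G₁ (Pi.single j₀ 1) (U.mulVec (Pi.single i 1)), hi, ?_⟩
    have h : polar (map A.subtype G₂) e' (Pi.single i 1) = polar _ e' (Pi.single i 1) :=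
      congrArg (fun F => polar F e' (Pi.single i 1)) hrel
    rw [polar_single, pderiv_map, polar_C_mul, polar_substLinear, hge, Matrix.smul_mulVec,
      polar_smul_smul h₁', he', ← map_eval'] at h
    change A.subtype _ = _ * A.subtype _
    have hp : A.subtype (polar G₁ (Pi.single j₀ 1) (U.mulVec (Pi.single i 1))) =
        polar (map A.subtype G₁) (Pi.single j₀ 1)
          ((U.map A.subtype).mulVec (Pi.single i 1)) := by
      rw [map_polar]
      congr 1
      · ext a
        rcases eq_or_ne a j₀ with rfl | ha
        · simp
        · simp [ha]
      · ext a
        simp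
    rw [hp, h]
    ring
  · rw [← map_eval', ← Ne, IsLocalRing.residue_ne_zero_iff_isUnit] at h0
    refine ⟨_, (U.mulVec e) j₀ * eval (Pi.single j₀ 1) G₁, h0, ?_⟩
    have h := congrArg (fun F => eval e' F) hrel
    simp only [map_mul, eval_C, eval_substLinear, hge, eval_smul_cubic h₁'] at h
    rw [he', ← map_eval'] at h
    change A.subtype (eval e G₂) = c * β ^ 2 * α *
      A.subtype (U.mulVec e j₀ * eval (Pi.single j₀ 1) G₁)
    have hβ' : α * A.subtype (U.mulVec e j₀) = β := by
      have := congrFun hge j₀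
      simp only [Matrix.smul_mulVec, Pi.smul_apply, Pi.single_eq_same, smul_eq_mul, mul_one] at this
      rw [← this]
      simp [Matrix.mulVec, dotProduct, e']
    have hp : A.subtype (eval (Pi.single j₀ 1) G₁) =
        eval (Pi.single j₀ 1) (map A.subtype G₁) := by
      rw [map_eval']
      congr 2
      ext a
      rcases eq_or_ne a j₀ with rfl | ha
      · simp
      · simp [ha]
    rw [map_mul, hp, h]
    linear_combination (-c * β ^ 2 * eval (Pi.single j₀ 1) (map A.subtype G₁)) * hβ'

/-- An isomorphism between the generic fibres of two smooth models of a cubic hypersurface over a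
valuation ring extends to the models. -/
theorem IsSmoothCubic.exists_integral_frame {G₁ G₂ : MvPolynomial (Fin (n + 1)) A}
    (h₁ : G₁.IsHomogeneous 3) (h₂ : G₂.IsHomogeneous 3)
    (hs₁ : IsSmoothCubic (map (IsLocalRing.residue A) G₁))
    (hs₂ : IsSmoothCubic (map (IsLocalRing.residue A) G₂)) {c : L} (hc : c ≠ 0)
    {g g' : Matrix (Fin (n + 1)) (Fin (n + 1)) L} (hg : g * g' = 1)
    (hrel : map A.subtype G₂ = C c * substLinear g (map A.subtype G₁)) :
    ∃ α : L, α ≠ 0 ∧ ∃ U V : Matrix (Fin (n + 1)) (Fin (n + 1)) A,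
      g = α • U.map A.subtype ∧ U * V = 1 := by
  have hrel' : map A.subtype G₁ = C c⁻¹ * substLinear g' (map A.subtype G₂) := by
    rw [hrel, substLinear_C_mul, substLinear_substLinear, hg, substLinear_one, ← mul_assoc, ← C_mul,
      inv_mul_cancel₀ hc, C_1, one_mul]
  obtain ⟨α, hα, U, ⟨i₁, j₁, hU⟩, rfl⟩ := A.exists_smul_eq_map (g := g) (by
    rintro rfl
    simp at hg)
  obtain ⟨β', hβ', V, ⟨i₂, j₂, hV⟩, rfl⟩ := A.exists_smul_eq_map (g := g') (by
    rintro rfl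
    simp at hg)
  obtain ⟨β, rfl⟩ : ∃ β, β' = β⁻¹ := ⟨β'⁻¹, (inv_inv _).symm⟩
  have hβ : β ≠ 0 := by simpa using hβ'
  have e₁ := inv_mem_of_substLinear h₁ hs₂ hβ hV hg hrel
  have e₂ := inv_mem_of_substLinear h₂ hs₁ (c := c⁻¹) (α := β⁻¹) (β := α⁻¹) (U := V) (V := U)
    (inv_ne_zero hα) hU (by rw [inv_inv]; exact mul_eq_one_comm.mp hg) hrel'
  -- The bounds for the frame and for its inverse multiply to α/β, precisely the factor by which V
  -- must be scaled to become an inverse of U.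
  have hδ : α / β ∈ A := by
    have : α / β = (c * β ^ 2 * α)⁻¹ * (c⁻¹ * α⁻¹ ^ 2 * β⁻¹)⁻¹ := by field_simp
    rw [this]
    exact mul_mem e₁ e₂
  refine ⟨α, hα, U, (⟨α / β, hδ⟩ : A) • V, rfl, ?_⟩
  have hinj : Function.Injective fun M : Matrix (Fin (n + 1)) (Fin (n + 1)) A => M.map A.subtype :=
    Matrix.map_injective Subtype.val_injective
  apply hinj
  change (U * _).map _ = (1 : Matrix _ _ A).map _
  rw [Matrix.map_mul, Matrix.map_one _ (map_zero _) (map_one _), ← hg]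
  have : ((⟨α / β, hδ⟩ : A) • V).map A.subtype = (α / β) • V.map A.subtype := by
    ext i j
    rfl
  rw [this, Matrix.mul_smul, Matrix.smul_mul, Matrix.mul_smul, smul_smul, div_eq_mul_inv]

end Integral
end

/-! ### Base change and change of smooth models. -/

noncomputable section
open MvPolynomial

/-- A finite extension is algebraic, so the closure of κ′ embeds in that of κ and carries a singular
point there. -/
theorem IsSmoothCubic.map_of_finite {κ κ' : Type*} [Field κ] [Field κ'] [Finite κ'] {n : ℕ}
    {G : MvPolynomial (Fin (n + 1)) κ} (hG : IsSmoothCubic G) (φ : κ →+* κ') :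
    IsSmoothCubic (map φ G) := by
  have : Finite κ := Finite.of_injective φ φ.injective
  algebraize [φ]
  have : Module.Finite κ κ' := inferInstance
  have : Algebra.IsAlgebraic κ (AlgebraicClosure κ') :=
    Algebra.IsAlgebraic.trans κ κ' (AlgebraicClosure κ')
  let ψ : AlgebraicClosure κ' →ₐ[κ] AlgebraicClosure κ := IsAlgClosed.lift
  have key : ∀ (p : MvPolynomial (Fin (n + 1)) κ) (x : Fin (n + 1) → AlgebraicClosure κ'),
      aeval (fun i => ψ (x i)) p = ψ (aeval x (map φ p)) := by
    intro p x
    have : aeval x (map φ p) = aeval x p := aeval_map_algebraMap κ' x p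
    rw [this, ← AlgHom.comp_apply, comp_aeval]
  refine ⟨hG.homogeneous.map φ, fun x hx h => hG.nonsingular (fun i => ψ (x i)) ?_ ⟨?_, fun i => ?_⟩⟩
  · contrapose! hx
    ext i
    exact (map_eq_zero ψ).mp (congrFun hx i)
  · rw [key, h.1, map_zero]
  · rw [key, ← pderiv_map, h.2, map_zero]

namespace SmoothModel

variable {k k' K K' : Type*} [Field k] [Field K] [Algebra k K] [Field k']
    [Field K'] [Algebra k' K'] {φ : K →+* K'} {v : Place k K} {w : Place k' K'} {n : ℕ}
    {F : MvPolynomial (Fin (n + 1)) K}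

/-- The base change of a smooth model to an unramified extension. -/
def baseChange (M : SmoothModel F v) (h : Place.IsUnramified φ v w) (hw : Finite w.residueField) :
    SmoothModel (map φ F) w where
  form := map (Place.integersMap h) M.form
  homogeneous := M.homogeneous.map _
  closedFibre := by
    have : (IsLocalRing.residue w.integers).comp (Place.integersMap h) =
      (Place.residueMap h).comp (IsLocalRing.residue v.integers) := rfl
    rw [map_map, this, ← map_map]
    exact M.closedFibre.map_of_finite _
  frame := Matrix.GeneralLinearGroup.map (Place.completionMap h) M.frame
  scale := Place.completionMap h M.scale
  scale_ne_zero := by simpa using M.scale_ne_zero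
  genericFibre := by
    have h₁ : w.integers.subtype.comp (Place.integersMap h) =
      (Place.completionMap h).comp v.integers.subtype := rfl
    have h₂ : (Place.completionMap h).comp v.toCompletion = w.toCompletion.comp φ :=
      RingHom.ext fun x => Place.completionMap_toCompletion h x
    rw [map_map, h₁, ← map_map, M.genericFibre, map_mul, map_C, map_substLinear, map_map, map_map,
      h₂]
    rfl

theorem inv_frame_baseChange (M : SmoothModel F v) (h : Place.IsUnramified φ v w)
    (hw : Finite w.residueField) :
    (M.baseChange h hw).frame⁻¹.val = M.frame⁻¹.val.map (Place.completionMap h) := by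
  rw [baseChange, ← map_inv]
  rfl

/-- The change of models is a scalar times an integral invertible matrix, which preserves
primitivity and congruences; approximation on a given model thus gives approximation on any other.
-/
theorem exists_formalSection {F : MvPolynomial (Fin (n + 1)) K} {w : Place k K}
    (M M' : SmoothModel F w) {t : Fin (n + 1) → w.integers} (ht : ∃ i, IsUnit (t i))
    (h0 : eval t M'.form = 0) :
    ∃ s : FormalSection M, ∀ (N : ℕ) (x : RationalPoint F), Agrees N x s →
      ∃ a : w.completion, ∀ j, ∃ e ∈ IsLocalRing.maximalIdeal w.integers ^ (N + 1),
        a * (M'.frame⁻¹.val.mulVec (fun i => w.toCompletion (x.coord i))) j =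
          ((t j + e : w.integers) : w.completion) := by
  have hff' : M'.frame.val * M'.frame⁻¹.val = 1 := M'.frame.mul_inv
  have hff'' : M'.frame⁻¹.val * M'.frame.val = 1 := M'.frame.inv_mul
  have hf : M.frame.val * M.frame⁻¹.val = 1 := M.frame.mul_inv
  set f := M.frame.val
  set f' := M'.frame.val
  set fi := M.frame⁻¹.val
  set fi' := M'.frame⁻¹.val
  obtain ⟨α, hα, U, V, hU, hUV⟩ := IsSmoothCubic.exists_integral_frame
    M'.homogeneous M.homogeneous M'.closedFibre M.closedFibre
    (c := M.scale / M'.scale) (div_ne_zero M.scale_ne_zero M'.scale_ne_zero)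
    (g := fi' * f) (g' := fi * f')
    (by rw [← mul_assoc, mul_assoc fi', hf, mul_one, hff''])
    (by
      rw [M.genericFibre, M'.genericFibre, substLinear_C_mul, substLinear_substLinear, ← mul_assoc,
        ← mul_assoc, hff', one_mul, ← C_mul, div_mul_cancel₀ _ M'.scale_ne_zero])
  have hUVt : U.mulVec (V.mulVec t) = t := by rw [Matrix.mulVec_mulVec, hUV, Matrix.one_mulVec]
  refine ⟨⟨V.mulVec t, ?_, ?_⟩, fun N x => ?_⟩
  · by_contra! hno
    obtain ⟨i, hi⟩ := ht
    have : t i ∈ IsLocalRing.maximalIdeal w.integers := by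
      rw [← hUVt, Matrix.mulVec, dotProduct]
      exact Ideal.sum_mem _ fun j _ =>
        Ideal.mul_mem_left _ _ ((IsLocalRing.mem_maximalIdeal _).mpr (hno j))
    exact (IsLocalRing.mem_maximalIdeal _).mp this hi
  · have hinj : Function.Injective w.integers.subtype := Subtype.val_injective
    apply hinj
    have hrel : map w.integers.subtype M.form = C (M.scale / M'.scale) *
        substLinear (α • U.map w.integers.subtype) (map w.integers.subtype M'.form) := by
      rw [← hU, M.genericFibre, M'.genericFibre, substLinear_C_mul, substLinear_substLinear,
        ← mul_assoc, ← mul_assoc, hff', one_mul, ← C_mul, div_mul_cancel₀ _ M'.scale_ne_zero]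
    have hvec : (U.map w.integers.subtype).mulVec (fun i => w.integers.subtype (V.mulVec t i)) =
        fun i => w.integers.subtype (t i) := by
      ext i
      conv_rhs => rw [← hUVt]
      exact (RingHom.map_mulVec w.integers.subtype U _ i).symm
    rw [map_eval', hrel, map_mul, eval_C, eval_substLinear, Matrix.smul_mulVec, hvec,
      eval_smul_cubic (M'.homogeneous.map _), ← map_eval', h0]
    simp
  · rintro ⟨a, ha⟩
    choose e he hae using ha
    refine ⟨a * α⁻¹, fun j => ⟨U.mulVec e j, ?_, ?_⟩⟩
    · rw [Matrix.mulVec, dotProduct]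
      exact Ideal.sum_mem _ fun i _ => Ideal.mul_mem_left _ _ (he i)
    · set y : Fin (n + 1) → w.completion := fun i => w.toCompletion (x.coord i)
      have h1 : fi'.mulVec y = α • (U.map w.integers.subtype).mulVec (fi.mulVec y) := by
        rw [← Matrix.smul_mulVec, ← hU, Matrix.mulVec_mulVec, mul_assoc, hf, mul_one]
      have h2 : (U.map w.integers.subtype).mulVec (a • fi.mulVec y) j =
          w.integers.subtype (U.mulVec (V.mulVec t + e) j) := by
        have : a • fi.mulVec y = fun i => w.integers.subtype ((V.mulVec t + e) i) :=
          funext fun i => hae i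
        rw [this]
        exact (RingHom.map_mulVec w.integers.subtype U _ j).symm
      rw [h1, Pi.smul_apply, smul_eq_mul]
      rw [Matrix.mulVec_smul, Matrix.mulVec_add, hUVt, Pi.smul_apply, smul_eq_mul] at h2
      rw [mul_assoc, inv_mul_cancel_left₀ hα, h2]
      rfl

end SmoothModel
end

/-! ### Approximation passes to the third point. -/

noncomputable section
open MvPolynomial

/-- The third point has degree two in each argument, so it vanishes modulo the maximal ideal as soon
as one argument does. -/
theorem exists_isUnit_of_thirdPoint {R ι : Type*} [CommRing R] [IsLocalRing R] [Fintype ι]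
    {G : MvPolynomial ι R} (hG : G.IsHomogeneous 3) {x y z : ι → R} (h : thirdPoint G x y = z)
    (hz : ∃ i, IsUnit (z i)) : (∃ i, IsUnit (x i)) ∧ ∃ i, IsUnit (y i) := by
  obtain ⟨j, hj⟩ := hz
  constructor <;> by_contra! hno
  · have := thirdPoint_sub_mem (I := IsLocalRing.maximalIdeal R) G (x := x) (x' := 0) (y := y)
      (y' := y) (fun i => by simpa using hno i) (fun i => by simp) j
    have h0 := thirdPoint_smul hG 0 1 x y
    rw [zero_smul, one_smul] at h0
    rw [h0, h, Pi.smul_apply, smul_eq_mul] at this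
    ring_nf at this
    exact (IsLocalRing.mem_maximalIdeal _).mp this hj
  · have := thirdPoint_sub_mem (I := IsLocalRing.maximalIdeal R) G (x := x) (x' := x) (y := y)
      (y' := 0) (fun i => by simp) (fun i => by simpa using hno i) j
    have h0 := thirdPoint_smul hG 1 0 x y
    rw [zero_smul, one_smul] at h0
    rw [h0, h, Pi.smul_apply, smul_eq_mul] at this
    ring_nf at this
    exact (IsLocalRing.mem_maximalIdeal _).mp this hj

namespace SmoothModel

variable {F₁ F₂ K₁ K₂ : Type*} [Field F₁] [Field F₂] [Field K₁] [Field K₂] [Algebra F₁ K₁]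
  [Algebra F₂ K₂] [Algebra K₁ K₂] {σ : K₂ →+* K₂} {ω : K₂} {n : ℕ}
  {X : MvPolynomial (Fin (n + 1)) K₁} {v : Place F₁ K₁} {w w' : Place F₂ K₂}

/-- If `x` is close to `P₁` at `w` and to `P₂` at a place conjugate to `w`, then the third point on
the line through `x` and its conjugate is close to the third point on the line through `P₁` and the
conjugate of `P₂`. -/
theorem agrees_of_thirdPoint (H : IsQuadraticConstantExtension F₂ K₁ σ ω)
    (h : Place.IsUnramified (algebraMap K₁ K₂) v w) (h' : Place.IsUnramified (algebraMap K₁ K₂) v w')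
    (hσ : Place.IsUnramified σ w' w) (hw : Finite w.residueField) (hw' : Finite w'.residueField)
    (hX : X.IsHomogeneous 3) (M : SmoothModel X v) (s : FormalSection M) {N : ℕ}
    {P₁ : Fin (n + 1) → w.integers} {P₂ : Fin (n + 1) → w'.integers} {μ : w.integers}
    (hμ : IsUnit μ)
    (hP : thirdPoint (M.baseChange h hw).form P₁ (fun i => Place.integersMap hσ (P₂ i)) =
      fun i => μ * Place.integersMap h (s.coord i))
    {x : Fin (n + 1) → K₂}
    (h₁ : ∃ a : w.completion, ∀ j, ∃ e ∈ IsLocalRing.maximalIdeal w.integers ^ (N + 1),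
      a * ((M.baseChange h hw).frame⁻¹.val.mulVec (fun i => w.toCompletion (x i))) j =
        ((P₁ j + e : w.integers) : w.completion))
    (h₂ : ∃ a : w'.completion, ∀ j, ∃ e ∈ IsLocalRing.maximalIdeal w'.integers ^ (N + 1),
      a * ((M.baseChange h' hw').frame⁻¹.val.mulVec (fun i => w'.toCompletion (x i))) j =
        ((P₂ j + e : w'.integers) : w'.completion)) :
    thirdPoint (map (algebraMap K₁ K₂) X) x (fun i => σ (x i)) ≠ 0 ∧
    ∀ z : RationalPoint X, (∃ c : K₂, c ≠ 0 ∧ ∀ j, algebraMap K₁ K₂ (z.coord j) =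
      c * thirdPoint (map (algebraMap K₁ K₂) X) x (fun i => σ (x i)) j) → Agrees N z s := by
  obtain ⟨a₁, h₁⟩ := h₁
  obtain ⟨a₂, h₂⟩ := h₂
  choose e₁ he₁ h₁ using h₁
  choose e₂ he₂ h₂ using h₂
  set X₂ := map (algebraMap K₁ K₂) X with hX₂
  set Mw := M.baseChange h hw with hMw
  set g := Mw.frame.val
  set gi := Mw.frame⁻¹.val with hgi
  have hggi : g * gi = 1 := Mw.frame.mul_inv
  have hgig : gi * g = 1 := Mw.frame.inv_mul
  set f := Place.completionMap hσ
  set ι := w.integers.subtype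
  set x' : Fin (n + 1) → K₂ := fun i => σ (x i)
  set y₁ : Fin (n + 1) → w.integers := fun i => P₁ i + e₁ i
  set y₂ : Fin (n + 1) → w.integers := fun i => Place.integersMap hσ (P₂ i + e₂ i)
  set T := thirdPoint Mw.form y₁ y₂
  have hy₁ : (fun i => ι (y₁ i)) = a₁ • gi.mulVec fun i => w.toCompletion (x i) :=
    funext fun i => (h₁ i).symm
  have hy₂ : (fun i => ι (y₂ i)) = f a₂ • gi.mulVec fun i => w.toCompletion (x' i) := by
    ext j
    change f (P₂ j + e₂ j : w'.integers) = _
    have hA : (M.frame⁻¹.val.map (Place.completionMap h')).map f =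
        M.frame⁻¹.val.map (Place.completionMap h) := by
      ext a b
      exact Place.completionMap_completionMap h' hσ h H.map_algebraMap _
    have hB : (f ∘ fun i => w'.toCompletion (x i)) = fun i => w.toCompletion (x' i) :=
      funext fun i => Place.completionMap_toCompletion hσ (x i)
    rw [← h₂ j, map_mul, RingHom.map_mulVec, hgi, hMw, inv_frame_baseChange, inv_frame_baseChange,
      hA, hB]
    rfl
  have hT : ∀ j, ∃ e ∈ IsLocalRing.maximalIdeal w.integers ^ (N + 1),
      T j = μ * Place.integersMap h (s.coord j) + e := fun j => by
    refine ⟨T j - μ * Place.integersMap h (s.coord j), ?_, by ring⟩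
    have := thirdPoint_sub_mem (I := IsLocalRing.maximalIdeal w.integers ^ (N + 1)) Mw.form
      (x := y₁) (x' := P₁) (y := y₂) (y' := fun i => Place.integersMap hσ (P₂ i))
      (fun i => by simpa [y₁] using he₁ i)
      (fun i => by
        simp only [y₂, map_add, add_sub_cancel_left]
        exact (Place.integersMap_mem_pow_iff hσ _ _).mpr (he₂ i)) j
    rwa [hP] at this
  choose e he hTe using hT
  -- `thirdPoint` commutes up to scalars with the frame and with rescaling of the points, so T
  -- represents the global third point in model coordinates.
  obtain ⟨b, hb⟩ : ∃ b : w.completion, (fun i => ι (T i)) =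
      b • gi.mulVec fun i => w.toCompletion (thirdPoint X₂ x x' i) := by
    refine ⟨Mw.scale * (a₁ ^ 2 * f a₂ ^ 2), ?_⟩
    have h3 : (fun i => ι (T i)) =
        thirdPoint (map ι Mw.form) (fun i => ι (y₁ i)) (fun i => ι (y₂ i)) :=
      funext fun i => map_thirdPoint ι _ _ _ i
    have hX' : (map w.toCompletion X₂).IsHomogeneous 3 := (hX.map _).map _
    have h4 : g.mulVec (fun i => ι (T i)) = (Mw.scale * (a₁ ^ 2 * f a₂ ^ 2)) •
        fun i => w.toCompletion (thirdPoint X₂ x x' i) := by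
      rw [h3, Mw.genericFibre, mulVec_thirdPoint_substLinear, hy₁, hy₂, Matrix.mulVec_smul,
        Matrix.mulVec_smul, Matrix.mulVec_mulVec, Matrix.mulVec_mulVec, hggi, Matrix.one_mulVec,
        Matrix.one_mulVec, thirdPoint_smul hX', smul_smul]
      congr 1
      ext i
      exact (map_thirdPoint w.toCompletion X₂ x x' i).symm
    rw [← Matrix.mulVec_smul, ← h4, Matrix.mulVec_mulVec, hgig, Matrix.one_mulVec]
  obtain ⟨j₀, hj₀⟩ := s.primitive
  have hTu : IsUnit (T j₀) := by
    by_contra hno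
    have h5 : μ * Place.integersMap h (s.coord j₀) ∈ IsLocalRing.maximalIdeal w.integers := by
      have := sub_mem ((IsLocalRing.mem_maximalIdeal _).mpr hno)
        (Ideal.pow_le_self (Nat.succ_ne_zero N) (he j₀))
      rwa [hTe j₀, add_sub_cancel_right] at this
    exact (IsLocalRing.mem_maximalIdeal _).mp h5 (hμ.mul (hj₀.map _))
  have hT0 : ι (T j₀) ≠ 0 := by
    intro h0
    exact hTu.ne_zero (Subtype.ext h0)
  refine ⟨fun h0 => hT0 ?_, ?_⟩
  · have := congrFun hb j₀
    simp only [h0] at this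
    rw [this]
    simp [Matrix.mulVec, dotProduct]
  rintro z ⟨c, hc, hz⟩
  set u := M.frame⁻¹.val.mulVec fun i => v.toCompletion (z.coord i)
  have hTu' : ∀ j, ι (T j) = b / w.toCompletion c * Place.completionMap h (u j) := by
    intro j
    have hc' : w.toCompletion c ≠ 0 := by simpa using hc
    have h6 : (fun i => w.toCompletion (thirdPoint X₂ x x' i)) =
        (w.toCompletion c)⁻¹ • fun i => Place.completionMap h (v.toCompletion (z.coord i)) := by
      ext i
      rw [Pi.smul_apply, smul_eq_mul, Place.completionMap_toCompletion, hz, map_mul,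
        inv_mul_cancel_left₀ hc']
    have h7 := congrFun hb j
    rw [h6, Matrix.mulVec_smul, smul_smul, hgi, hMw, inv_frame_baseChange, Pi.smul_apply,
      smul_eq_mul] at h7
    rw [RingHom.map_mulVec, div_eq_mul_inv]
    exact h7
  have hu0 : Place.completionMap h (u j₀) ≠ 0 := by
    intro h0
    rw [hTu', h0, mul_zero] at hT0
    exact hT0 rfl
  obtain ⟨T', hT'⟩ := isUnit_iff_exists_inv.mp hTu
  have hT1 : ι (T j₀) * ι T' = 1 := congrArg ι hT'
  -- The coordinates of z are normalised to agree exactly with s at `j₀`. This scalar lies in the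
  -- completion at v, so the remaining errors can be computed at w and descended by
  -- `integersMap_mem_pow_iff`.
  refine ⟨s.coord j₀ / u j₀, fun j => ?_⟩
  set d := s.coord j₀ / u j₀ * u j - s.coord j with hd
  have hFd : Place.completionMap h d = ι (T' * (Place.integersMap h (s.coord j₀) * e j -
      Place.integersMap h (s.coord j) * e j₀)) := by
    have e1 := congrArg ι (hTe j)
    have e2 := congrArg ι (hTe j₀)
    rw [hTu', map_add, map_mul] at e1 e2
    rw [hTu'] at hT1 hT0
    rw [hd, map_sub, map_mul, map_div₀, map_mul, map_sub, map_mul, map_mul]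
    have e3 : ∀ i, ι (Place.integersMap h (s.coord i)) = Place.completionMap h (s.coord i) :=
      fun i => rfl
    rw [e3] at e1 e2
    rw [e3, e3]
    generalize Place.completionMap h (u j₀) = A at *
    generalize Place.completionMap h (u j) = B at *
    generalize Place.completionMap h (s.coord j₀) = S₀ at *
    generalize Place.completionMap h (s.coord j) = S at *
    have hT2 : ι T' = (b / w.toCompletion c * A)⁻¹ := eq_inv_of_mul_eq_one_right hT1
    have hbc : b / w.toCompletion c ≠ 0 := left_ne_zero_of_mul hT0
    generalize b / w.toCompletion c = β at *
    rw [hT2]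
    field_simp
    linear_combination S₀ * e1 - S * e2
  have hdmem : d ∈ v.integers := by
    rw [← Place.completionMap_mem_iff h, hFd]
    exact (T' * (Place.integersMap h (s.coord j₀) * e j -
      Place.integersMap h (s.coord j) * e j₀)).2
  refine ⟨⟨d, hdmem⟩, ?_, ?_⟩
  · rw [← Place.integersMap_mem_pow_iff h]
    have : Place.integersMap h ⟨d, hdmem⟩ = T' * (Place.integersMap h (s.coord j₀) * e j -
      Place.integersMap h (s.coord j) * e j₀) := Subtype.ext hFd
    rw [this]
    exact Ideal.mul_mem_left _ _ (sub_mem (Ideal.mul_mem_left _ _ (he j))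
      (Ideal.mul_mem_left _ _ (he j₀)))
  · change s.coord j₀ / u j₀ * u j = s.coord j + d
    rw [hd]; ring

end SmoothModel
end

/-! ### Formal sections as third points. -/

noncomputable section
open MvPolynomial

namespace SmoothModel

variable {F₁ F₂ K₁ K₂ : Type*} [Field F₁] [Field F₂] [Field K₁] [Field K₂] [Algebra F₁ K₁]
  [Algebra F₂ K₂] [Algebra K₁ K₂] {σ : K₂ →+* K₂} {ω : K₂} {n : ℕ}
  {X : MvPolynomial (Fin (n + 1)) K₁} {v : Place F₁ K₁} {w : Place F₂ K₂}

theorem residue_coord_ne_zero {M : SmoothModel X v} (s : FormalSection M) :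
    (fun i => IsLocalRing.residue v.integers (s.coord i)) ≠ 0 := by
  obtain ⟨i, hi⟩ := s.primitive
  intro h
  exact (IsLocalRing.residue_ne_zero_iff_isUnit _).mpr hi (congrFun h i)

theorem eval_residue_coord {M : SmoothModel X v} (s : FormalSection M) :
    eval (fun i => IsLocalRing.residue v.integers (s.coord i))
      (map (IsLocalRing.residue v.integers) M.form) = 0 := by
  rw [← map_eval', s.eval_eq_zero, map_zero]

/-- A section of a smooth model is the third point of a line through two further sections. -/
theorem exists_thirdPoint_eq (M : SmoothModel X v) (s : FormalSection M) (hn : 2 ≤ n)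
    (hv : 11 ≤ v.residueCard) {π : K₁} (hπ : v.localRing.IsUniformizer π) :
    ∃ (Q₁ Q₂ : Fin (n + 1) → v.integers) (μ : v.integers), IsUnit μ ∧ eval Q₁ M.form = 0 ∧
      eval Q₂ M.form = 0 ∧ thirdPoint M.form Q₁ Q₂ = μ • s.coord := by
  rw [← v.natCard_residueField] at hv
  have : Finite v.residueField := Nat.finite_of_card_ne_zero (by omega)
  have := Fintype.ofFinite v.residueField
  rw [Nat.card_eq_fintype_card] at hv
  obtain ⟨t', z₁, z₂, hne, hadd, hmul, ht0⟩ := M.closedFibre.exists_split_line hn hv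
    (residue_coord_ne_zero s) (eval_residue_coord s)
  choose t ht using fun i => IsLocalRing.residue_surjective (R := v.integers) (t' i)
  obtain rfl : (fun i => IsLocalRing.residue v.integers (t i)) = t' := funext ht
  rw [← map_polar] at hadd hmul
  rw [← map_eval'] at hmul ht0
  obtain ⟨y₀, rfl⟩ := IsLocalRing.residue_surjective z₁
  obtain ⟨y, hy, hyy⟩ := Place.exists_root_quadratic hπ (y₀ := y₀) (B := polar M.form t s.coord)
    (D := polar M.form s.coord t * eval t M.form)
    (by
      simp only [map_add, map_mul, map_pow]
      rw [← hmul]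
      linear_combination IsLocalRing.residue v.integers y₀ * hadd)
    (by
      simp only [map_add, map_mul, map_ofNat]
      intro h0
      apply hne
      linear_combination h0 - hadd)
  -- Only one root is lifted; the other is determined by the sum. The resulting factor −C²(y₁ − y₂)³
  -- is a unit because t is off the closed fibre and the roots are distinct there.
  obtain ⟨h₁, h₂, h₃⟩ := residual_points M.homogeneous s.eval_eq_zero (t := t) (y₁ := y)
    (y₂ := -polar M.form t s.coord - y) (by ring) (by linear_combination -hy)
  refine ⟨_, _, _, ?_, h₁, h₂, h₃⟩
  rw [← IsLocalRing.residue_ne_zero_iff_isUnit, map_mul, map_neg, map_pow, map_pow]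
  refine mul_ne_zero (neg_ne_zero.mpr (pow_ne_zero _ ht0)) (pow_ne_zero _ ?_)
  rw [map_sub, map_sub, map_neg, hyy]
  intro h0
  apply hne
  linear_combination h0 - hadd

/-- At an inert place, a section of a smooth model is the third point of a line through two further
conjugate sections. -/
theorem exists_thirdPoint_conj_eq (H : IsQuadraticConstantExtension F₂ K₁ σ ω)
    (h : Place.IsUnramified (algebraMap K₁ K₂) v w) (hσ : Place.IsUnramified σ w w)
    (hw : Finite w.residueField) (M : SmoothModel X v) (s : FormalSection M) (hn : 2 ≤ n)
    (hv : 11 ≤ v.residueCard) :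
    ∃ (P : Fin (n + 1) → w.integers) (μ : w.integers), IsUnit μ ∧
      eval P (M.baseChange h hw).form = 0 ∧
      thirdPoint (M.baseChange h hw).form P (fun i => Place.integersMap hσ (P i)) =
        fun i => μ * Place.integersMap h (s.coord i) := by
  obtain ⟨π, -, hπ⟩ := h.exists_isUniformizer
  rw [← v.natCard_residueField] at hv
  have : Finite v.residueField := Nat.finite_of_card_ne_zero (by omega)
  have := Fintype.ofFinite v.residueField
  rw [Nat.card_eq_fintype_card] at hv
  obtain ⟨t', hno⟩ := M.closedFibre.exists_inert_line hn hv
    (residue_coord_ne_zero s) (eval_residue_coord s)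
  choose t ht using fun i => IsLocalRing.residue_surjective (R := v.integers) (t' i)
  obtain rfl : (fun i => IsLocalRing.residue v.integers (t i)) = t' := funext ht
  simp only [← map_polar, ← map_eval'] at hno
  set B := polar M.form t s.coord
  set A := polar M.form s.coord t
  set C := eval t M.form
  rw [← map_mul] at hno
  set ρ := Place.residueMap h
  set τ := Place.residueMap hσ
  have hτρ : ∀ a, τ (ρ a) = ρ a := by
    intro a
    obtain ⟨a, rfl⟩ := IsLocalRing.residue_surjective a
    simp only [τ, ρ, Place.residueMap_residue, H.integersMap_conj_integersMap h h hσ]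
  have hτω := H.residueMap_conj_residueGenerator hσ
  obtain ⟨z, hz⟩ := FiniteField.exists_root_quadratic ρ (ω := H.residueGenerator w)
    (fun c hc => hτω (by rw [← hc]; exact hτρ c)) (H.exists_residue_eq h hσ.mem_iff)
    (IsLocalRing.residue _ B) (IsLocalRing.residue _ (A * C))
  -- A fixed z would come from the residue field at v and be a root there, against the choice of an
  -- inert line.
  have hτz : τ z ≠ z := by
    intro hfix
    obtain ⟨a, b, rfl⟩ := H.exists_residue_eq h hσ.mem_iff z
    rw [map_add, map_mul, hτρ, hτρ, add_right_inj, ← sub_eq_zero, ← mul_sub] at hfix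
    rw [(mul_eq_zero.mp hfix).resolve_right (sub_ne_zero.mpr hτω), zero_mul, add_zero, ← map_pow,
      ← map_mul, ← map_add, ← map_add, map_eq_zero] at hz
    exact hno a hz
  have hzτ := congrArg τ hz
  simp only [map_add, map_mul τ, map_pow, map_zero, hτρ] at hzτ
  have hsum : τ z + z + ρ (IsLocalRing.residue _ B) = 0 := by
    refine (mul_eq_zero.mp ?_).resolve_left (sub_ne_zero.mpr hτz)
    rw [map_mul, map_mul] at hz
    rw [map_mul, map_mul] at hzτ
    linear_combination hzτ - hz
  obtain ⟨z₀, rfl⟩ := IsLocalRing.residue_surjective z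
  obtain ⟨y, hy, hyz⟩ := Place.exists_root_quadratic hπ (y₀ := z₀) (B := Place.integersMap h B)
    (D := Place.integersMap h (A * C)) (by rw [map_add, map_add, map_pow, map_mul]; exact hz)
    (by
      intro h0
      rw [map_add, map_mul, map_ofNat, ← Place.residueMap_residue] at h0
      apply hτz
      linear_combination hsum - h0)
  set y' := Place.integersMap hσ y
  have hfix := H.integersMap_conj_integersMap h h hσ
  have hy' := congrArg (Place.integersMap hσ) hy
  rw [map_add, map_add, map_pow, map_mul, map_zero, hfix, hfix] at hy'
  have hyτ : IsLocalRing.residue w.integers y' = τ (IsLocalRing.residue _ z₀) := by rw [← hyz]; rfl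
  have hne : IsLocalRing.residue w.integers (y - y') ≠ 0 := by
    rw [map_sub, hyz, hyτ]
    exact sub_ne_zero.mpr hτz.symm
  -- The conjugate of the lifted root is also a root and has a different residue, so it is the
  -- second one.
  have hadd : y + y' + Place.integersMap h B = 0 := by
    have hprod : (y - y') * (y + y' + Place.integersMap h B) = 0 := by
      linear_combination hy - hy'
    exact (mul_eq_zero.mp hprod).resolve_left fun h0 => hne (by rw [h0, map_zero])
  set t₂ : Fin (n + 1) → w.integers := fun i => Place.integersMap h (t i)
  set s₂ : Fin (n + 1) → w.integers := fun i => Place.integersMap h (s.coord i)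
  have hC : eval t₂ (M.baseChange h hw).form = Place.integersMap h C := (map_eval' _ _ _).symm
  obtain ⟨h₁, -, h₃⟩ := residual_points (M.baseChange h hw).homogeneous (s := s₂) (t := t₂)
    (y₁ := y) (y₂ := y')
    (by
      have := map_eval' (Place.integersMap h) M.form s.coord
      rw [s.eval_eq_zero, map_zero] at this
      exact this.symm)
    (by
      have : Place.integersMap h B = polar (M.baseChange h hw).form t₂ s₂ := map_polar _ _ _ _
      rw [← this]
      linear_combination hadd)
    (by
      have : Place.integersMap h A = polar (M.baseChange h hw).form s₂ t₂ := map_polar _ _ _ _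
      rw [hC, ← this, ← map_mul]
      linear_combination y * hadd - hy)
  refine ⟨_, -(eval t₂ (M.baseChange h hw).form) ^ 2 * (y - y') ^ 3, ?_, h₁, ?_⟩
  · rw [← IsLocalRing.residue_ne_zero_iff_isUnit, map_mul, map_neg, map_pow, map_pow, hC]
    refine mul_ne_zero (neg_ne_zero.mpr (pow_ne_zero _ ?_)) (pow_ne_zero _ hne)
    rw [← Place.residueMap_residue]
    intro h0
    rw [map_eq_zero] at h0
    -- If C vanished in the residue field, y = 0 would already be a root.
    apply hno 0
    rw [map_mul, h0]
    ring
  · have : (fun i => Place.integersMap hσ ((eval t₂ (M.baseChange h hw).form • s₂ + y • t₂) i)) =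
        eval t₂ (M.baseChange h hw).form • s₂ + y' • t₂ := by
      ext1 i
      simp only [hC, Pi.add_apply, Pi.smul_apply, smul_eq_mul, map_add, map_mul, s₂, t₂, hfix]
      rfl
    rw [this, h₃]
    rfl

end SmoothModel
end

/-! ### From local sections to a rational point. -/

noncomputable section
open MvPolynomial

section Sections

variable {F₁ F₂ K₁ K₂ : Type*} [Field F₁] [Field F₂] [Field K₁] [Field K₂] [Algebra F₁ K₁]
  [Algebra F₂ K₂] [Algebra K₁ K₂] {σ : K₂ →+* K₂} {ω : K₂} {n : ℕ}
  {X : MvPolynomial (Fin (n + 1)) K₁} {v : Place F₁ K₁} {w : Place F₂ K₂}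

theorem IsQuadraticConstantExtension.finite_residueField
    (H : IsQuadraticConstantExtension F₂ K₁ σ ω)
    (h : Place.IsUnramified (algebraMap K₁ K₂) v w) (hv : v.residueCard ≠ 0) :
    Finite w.residueField := by
  apply Nat.finite_of_card_ne_zero
  rw [w.natCard_residueField]
  have := H.residueCard_le h.mem_iff hv
  omega

/-- Weak approximation at the places over `v` implies weak approximation at `v`. -/
theorem SmoothModel.exists_sections (H : IsQuadraticConstantExtension F₂ K₁ σ ω)
    (hK₁ : IsCurveFunctionField F₁ K₁) (hX : X.IsHomogeneous 3) (hn : 2 ≤ n)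
    (h : Place.IsUnramified (algebraMap K₁ K₂) v w) (hv : 11 ≤ v.residueCard)
    (M : SmoothModel X v) (s : FormalSection M)
    (M₁ : SmoothModel (map (algebraMap K₁ K₂) X) w)
    (M₂ : SmoothModel (map (algebraMap K₁ K₂) X) (H.conj w)) :
    ∃ (S₁ : FormalSection M₁) (S₂ : H.conj w ≠ w → FormalSection M₂),
      ∀ (N : ℕ) (x : RationalPoint (map (algebraMap K₁ K₂) X)),
      Agrees N x S₁ → (∀ hne, Agrees N x (S₂ hne)) →
      thirdPoint (map (algebraMap K₁ K₂) X) x.coord (fun i => σ (x.coord i)) ≠ 0 ∧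
      ∀ z : RationalPoint X, (∃ c : K₂, c ≠ 0 ∧ ∀ j, algebraMap K₁ K₂ (z.coord j) =
        c * thirdPoint (map (algebraMap K₁ K₂) X) x.coord (fun i => σ (x.coord i)) j) →
        Agrees N z s := by
  have hw := H.finite_residueField h (by omega)
  obtain ⟨j₀, hj₀⟩ := s.primitive
  by_cases hc : H.conj w = w
  · have hmem : ∀ z, σ z ∈ w.localRing ↔ z ∈ w.localRing := fun z => by
      rw [← H.mem_conj, hc]
    have hσ := H.isUnramified_of_mem_iff h h hmem
    obtain ⟨P, μ, hμ, hP0, hP⟩ := exists_thirdPoint_conj_eq H h hσ hw M s hn hv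
    obtain ⟨S₁, hS₁⟩ := exists_formalSection M₁ (M.baseChange h hw)
      (exists_isUnit_of_thirdPoint (M.baseChange h hw).homogeneous hP
        ⟨j₀, hμ.mul (hj₀.map _)⟩).1 hP0
    -- At a self-conjugate place one section serves for both arguments, so no second condition is
    -- imposed there.
    refine ⟨S₁, fun hne => absurd hc hne, fun N x hx _ => ?_⟩
    exact agrees_of_thirdPoint H h h hσ hw hw hX M s hμ hP (hS₁ N x hx) (hS₁ N x hx)
  · have h' := H.isUnramified_conj hK₁ h
    have hw' := H.finite_residueField h' (by omega)
    have hσ := H.isUnramified_of_mem_iff h' h fun z => (H.mem_conj w z).symm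
    obtain ⟨π, hπ, -⟩ := h.exists_isUniformizer
    obtain ⟨Q₁, Q₂, μ, hμ, hQ₁, hQ₂, hQ⟩ := exists_thirdPoint_eq M s hn hv hπ
    obtain ⟨⟨i₁, hi₁⟩, i₂, hi₂⟩ := exists_isUnit_of_thirdPoint M.homogeneous hQ
      ⟨j₀, hμ.mul hj₀⟩
    obtain ⟨S₁, hS₁⟩ := exists_formalSection M₁ (M.baseChange h hw)
      (t := fun i => Place.integersMap h (Q₁ i)) ⟨i₁, hi₁.map _⟩
      ((map_eval' _ _ _).symm.trans (by rw [hQ₁, map_zero]))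
    obtain ⟨S₂, hS₂⟩ := exists_formalSection M₂ (M.baseChange h' hw')
      (t := fun i => Place.integersMap h' (Q₂ i)) ⟨i₂, hi₂.map _⟩
      ((map_eval' _ _ _).symm.trans (by rw [hQ₂, map_zero]))
    refine ⟨S₁, fun _ => S₂, fun N x hx hx' => ?_⟩
    refine agrees_of_thirdPoint H h h' hσ hw hw' hX M s (hμ.map (Place.integersMap h)) ?_
      (hS₁ N x hx) (hS₂ N x (hx' hc))
    ext1 j
    simp only [H.integersMap_conj_integersMap h' h hσ]
    have := congrArg (Place.integersMap h) (congrFun hQ j)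
    rw [map_thirdPoint, Pi.smul_apply, smul_eq_mul, map_mul] at this
    exact this

theorem thirdPoint_swap {R ι : Type*} [CommRing R] [Fintype ι] (F : MvPolynomial ι R)
    (x y : ι → R) : thirdPoint F y x = -thirdPoint F x y := by
  simp only [thirdPoint, neg_smul]
  abel

namespace IsQuadraticConstantExtension

theorem map_map_algebraMap (H : IsQuadraticConstantExtension F₂ K₁ σ ω) :
    map σ (map (algebraMap K₁ K₂) X) = map (algebraMap K₁ K₂) X := by
  rw [map_map, show σ.comp (algebraMap K₁ K₂) = algebraMap K₁ K₂ from RingHom.ext H.map_algebraMap]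

theorem eval_conj (H : IsQuadraticConstantExtension F₂ K₁ σ ω) {x : Fin (n + 1) → K₂}
    (hx : eval x (map (algebraMap K₁ K₂) X) = 0) :
    eval (fun i => σ (x i)) (map (algebraMap K₁ K₂) X) = 0 := by
  have := map_eval' σ (map (algebraMap K₁ K₂) X) x
  rwa [hx, map_zero, H.map_map_algebraMap, eq_comm] at this

theorem exists_rationalPoint_of_fixed (H : IsQuadraticConstantExtension F₂ K₁ σ ω)
    {y : Fin (n + 1) → K₂} (hy : y ≠ 0) (hfix : ∀ i, σ (y i) = y i)
    (h0 : eval y (map (algebraMap K₁ K₂) X) = 0) :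
    ∃ z : RationalPoint X, ∀ i, algebraMap K₁ K₂ (z.coord i) = y i := by
  choose z hz using fun i => H.exists_of_fixed (hfix i)
  obtain rfl : (fun i => algebraMap K₁ K₂ (z i)) = y := funext hz
  refine ⟨⟨z, ?_, ?_⟩, fun i => rfl⟩
  · rintro rfl
    apply hy
    ext i
    simp
  · rwa [← map_eval', map_eq_zero] at h0

/-- The third point of the line through a point and its conjugate is rational. -/
theorem exists_rationalPoint_of_thirdPoint_ne_zero (H : IsQuadraticConstantExtension F₂ K₁ σ ω)
    (hX : X.IsHomogeneous 3) (x : RationalPoint (map (algebraMap K₁ K₂) X))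
    (h : thirdPoint (map (algebraMap K₁ K₂) X) x.coord (fun i => σ (x.coord i)) ≠ 0) :
    ∃ z : RationalPoint X, ∃ c : K₂, c ≠ 0 ∧ ∀ j, algebraMap K₁ K₂ (z.coord j) =
      c * thirdPoint (map (algebraMap K₁ K₂) X) x.coord (fun i => σ (x.coord i)) j := by
  have hX₂ := hX.map (algebraMap K₁ K₂)
  set T := thirdPoint (map (algebraMap K₁ K₂) X) x.coord (fun i => σ (x.coord i)) with hT
  have hc : ω - σ ω ≠ 0 := sub_ne_zero.mpr H.ne.symm
  -- Exchanging the two points changes the sign of `thirdPoint`, so T is anti-invariant under σ; so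
  -- is ω − σω, and their product is fixed.
  obtain ⟨z, hz⟩ := H.exists_rationalPoint_of_fixed (X := X) (y := (ω - σ ω) • T)
    (smul_ne_zero hc h) (fun j => by
      have h1 : σ (T j) = -T j := by
        rw [hT, map_thirdPoint, H.map_map_algebraMap, thirdPoint_swap]
        simp only [H.involutive]
        rw [← thirdPoint_swap, thirdPoint_swap]
        rfl
      rw [Pi.smul_apply, smul_eq_mul, map_mul, map_sub, H.involutive, h1]
      ring)
    (by
      rw [eval_smul_cubic hX₂, eval_thirdPoint hX₂ x.eval_eq_zero (H.eval_conj x.eval_eq_zero),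
        mul_zero])
  exact ⟨z, _, hc, hz⟩

/-- After normalising one coordinate to 1 the two mixed polars agree. If they were nonzero, x would
equal its conjugate and Euler's relation would make them zero. So both vanish, F is zero on the span
of the two points, and a trace combination of them is rational. -/
theorem exists_rationalPoint_of_thirdPoint_eq_zero (H : IsQuadraticConstantExtension F₂ K₁ σ ω)
    (hX : X.IsHomogeneous 3) (x : RationalPoint (map (algebraMap K₁ K₂) X))
    (h : thirdPoint (map (algebraMap K₁ K₂) X) x.coord (fun i => σ (x.coord i)) = 0) :
    Nonempty (RationalPoint X) := by
  have hX₂ := hX.map (algebraMap K₁ K₂)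
  obtain ⟨x, hx0, hxe⟩ := x
  dsimp only at h
  set X₂ := map (algebraMap K₁ K₂) X
  obtain ⟨j, hj⟩ := Function.ne_iff.mp hx0
  rw [Pi.zero_apply] at hj
  set y : Fin (n + 1) → K₂ := (x j)⁻¹ • x with hy
  set y' : Fin (n + 1) → K₂ := fun i => σ (y i) with hy'
  have hyj : y j = 1 := inv_mul_cancel₀ hj
  have hyj' : y' j = 1 := by rw [hy']; simp only [hyj, map_one]
  have hy0 : eval y X₂ = 0 := by rw [hy, eval_smul_cubic hX₂, hxe, mul_zero]
  have hy0' : eval y' X₂ = 0 := H.eval_conj hy0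
  have hT : thirdPoint X₂ y y' = 0 := by
    have : y' = (σ (x j))⁻¹ • fun i => σ (x i) := by
      ext i
      simp [hy', hy]
    rw [this, hy, thirdPoint_smul hX₂, h, smul_zero]
  have hpol : polar X₂ y y' = polar X₂ y' y := by
    have := congrFun hT j
    simp only [thirdPoint, Pi.add_apply, Pi.smul_apply, smul_eq_mul, hyj, hyj', mul_one,
      Pi.zero_apply] at this
    linear_combination this
  have hpol0 : polar X₂ y y' = 0 := by
    by_contra hne
    have heq : y' = y := by
      ext i
      have := congrFun hT i
      simp only [thirdPoint, Pi.add_apply, Pi.smul_apply, smul_eq_mul, ← hpol,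
        Pi.zero_apply] at this
      apply mul_left_cancel₀ hne
      linear_combination this
    rw [heq, polar_self hX₂, hy0, mul_zero] at hne
    exact hne rfl
  -- Traces cannot all vanish: that of 1 would give 2 = 0, and then that of ω would give σω = ω.
  obtain ⟨θ, hθ⟩ : ∃ θ : K₂, θ + σ θ ≠ 0 := by
    by_contra! hall
    have h1 := hall 1
    rw [map_one] at h1
    exact H.ne (by linear_combination hall ω - ω * h1)
  obtain ⟨z, -⟩ := H.exists_rationalPoint_of_fixed (X := X) (y := θ • y + σ θ • y')
    (fun h0 => hθ (by
      have := congrFun h0 j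
      simpa [hyj, hyj'] using this))
    (fun i => by
      simp only [hy', Pi.add_apply, Pi.smul_apply, smul_eq_mul, map_add, map_mul, H.involutive]
      ring)
    (by
      rw [eval_combination hX₂, hy0, hy0', ← hpol, hpol0]
      ring)
  exact ⟨z⟩

theorem eq_of_unramified {v' : Place F₁ K₁} (h : Place.IsUnramified (algebraMap K₁ K₂) v w)
    (h' : Place.IsUnramified (algebraMap K₁ K₂) v' w) : v = v' := by
  have : v.localRing = v'.localRing := by
    ext z
    rw [← h.mem_iff, h'.mem_iff]
  cases v
  cases v'
  congr

theorem weakApproximationAtGoodPlaces (H : IsQuadraticConstantExtension F₂ K₁ σ ω) [Finite F₂]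
    (hK₁ : IsCurveFunctionField F₁ K₁) (hX : X.IsHomogeneous 3) (hn : 2 ≤ n) {N : ℕ}
    (h : WeakApproximationAtGoodPlaces F₂ (map (algebraMap K₁ K₂) X) 11 N) :
    WeakApproximationAtGoodPlaces F₁ X 11 N := by
  classical
  obtain ⟨M₂, hM₂⟩ := h
  refine ⟨fun v hv => hv.some, fun l b hb good hcard s => ?_⟩
  choose w hw using fun i => Place.exists_over (k' := F₂) (K' := K₂) (b i)
  have hun := fun i => H.isUnramified hK₁ (hw i)
  have hun' := fun i => H.isUnramified_conj hK₁ (hun i)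
  have hne := fun i => (show (b i).residueCard ≠ 0 by have := hcard i; omega)
  have hgood : ∀ i, HasGoodReduction (map (algebraMap K₁ K₂) X) (w i) := fun i =>
    ⟨(good i).some.baseChange (hun i) (H.finite_residueField (hun i) (hne i))⟩
  have hgood' : ∀ i, HasGoodReduction (map (algebraMap K₁ K₂) X) (H.conj (w i)) := fun i =>
    ⟨(good i).some.baseChange (hun' i) (H.finite_residueField (hun' i) (hne i))⟩
  choose S₁ S₂ hS using fun i => SmoothModel.exists_sections H hK₁ hX hn (hun i) (hcard i)
    (good i).some (s i) (M₂ _ (hgood i)) (M₂ _ (hgood' i))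
  -- A conjugate place is listed only if it differs from the original, as weak approximation demands
  -- distinct places.
  let ι := Fin l ⊕ {i : Fin l // H.conj (w i) ≠ w i}
  let p : ι → Place F₂ K₂ := Sum.elim w fun i => H.conj (w i)
  let idx : ι → Fin l := Sum.elim id Subtype.val
  have hp : ∀ j, Place.IsUnramified (algebraMap K₁ K₂) (b (idx j)) (p j) := by
    rintro (i | i)
    exacts [hun i, hun' i]
  have hpgood : ∀ j, HasGoodReduction (map (algebraMap K₁ K₂) X) (p j) := by
    rintro (i | i)
    exacts [hgood i, hgood' i]
  have hinj : Function.Injective p := by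
    intro j j' hjj'
    have hidx : idx j = idx j' := by
      have := hp j
      rw [hjj'] at this
      exact hb (eq_of_unramified this (hp j'))
    rcases j with i | i <;> rcases j' with i' | i'
    · exact congrArg Sum.inl hidx
    · change i = i' at hidx
      subst hidx
      exact absurd hjj'.symm i'.2
    · change (i : Fin l) = i' at hidx
      subst hidx
      exact absurd hjj' i.2
    · exact congrArg Sum.inr (Subtype.ext hidx)
  let S : ∀ j, FormalSection (M₂ (p j) (hpgood j)) := fun j => match j with
    | Sum.inl i => S₁ i
    | Sum.inr i => S₂ i i.2
  let e := (Fintype.equivFin ι).symm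
  obtain ⟨x, hx⟩ := hM₂ (Fintype.card ι) (fun m => p (e m)) (hinj.comp e.injective)
    (fun m => hpgood (e m))
    (fun m => (hcard _).trans (H.residueCard_le (hp (e m)).mem_iff (hne _))) (fun m => S (e m))
  have hx' : ∀ j, Agrees N x (S j) := by
    intro j
    obtain ⟨m, rfl⟩ := e.surjective j
    exact hx m
  have hlocal := fun i => hS i N x (hx' (Sum.inl i)) fun hi => hx' (Sum.inr ⟨i, hi⟩)
  by_cases hT : thirdPoint (map (algebraMap K₁ K₂) X) x.coord (fun i => σ (x.coord i)) = 0
  -- Each local condition implies that the third point is nonzero, so here l = 0 and any rational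
  -- point will do.
  · obtain ⟨z⟩ := H.exists_rationalPoint_of_thirdPoint_eq_zero hX x hT
    exact ⟨z, fun i => absurd hT (hlocal i).1⟩
  · obtain ⟨z, hz⟩ := H.exists_rationalPoint_of_thirdPoint_ne_zero hX x hT
    exact ⟨z, fun i => (hlocal i).2 z hz⟩

end IsQuadraticConstantExtension

end Sections
end

theorem mainTheorem6 (q k : ℕ) (hq : IsPrimePow q) (hk : 1 ≤ k)
    {F₁ F₂ : Type*} [Field F₁] [Field F₂] [Algebra F₁ F₂]
    (hF₁ : Nat.card F₁ = q ^ k) (hF₂ : Nat.card F₂ = q ^ (2 * k))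
    {K₁ K₂ : Type*} [Field K₁] [Field K₂] [Algebra F₁ K₁] [Algebra K₁ K₂] [Algebra F₂ K₂]
    [Algebra F₁ K₂] [IsScalarTower F₁ K₁ K₂] [IsScalarTower F₁ F₂ K₂]
    (hK₁ : IsCurveFunctionField F₁ K₁) [Algebra.IsPushout F₁ F₂ K₁ K₂]
    (n : ℕ) (hn : 2 ≤ n) (X : MvPolynomial (Fin (n + 1)) K₁) (hX : IsSmoothCubic X) (N : ℕ)
    (h : WeakApproximationAtGoodPlaces F₂ (MvPolynomial.map (algebraMap K₁ K₂) X) 11 N) :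
    WeakApproximationAtGoodPlaces F₁ X 11 N := by
  have hQ : 1 < q ^ k := Nat.one_lt_pow (by omega) hq.one_lt
  have hF₂' : Nat.card F₂ = (q ^ k) ^ 2 := by rw [hF₂, mul_comm, pow_mul]
  have : Finite F₂ := Nat.finite_of_card_ne_zero (by rw [hF₂']; positivity)
  obtain ⟨σ, ω, H⟩ := exists_isQuadraticConstantExtension (K₁ := K₁) (K₂ := K₂) hQ hF₁ hF₂'
  exact H.weakApproximationAtGoodPlaces hK₁ hX.homogeneous hn h
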